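/- **Theorem (Parallel repetition of 1-of-2 puzzles).** A 1-of-2 puzzle $\mathcal Z=(G,O,S,V)$ consists of four efficient (polynomial-time, uniform) algorithms, each of which is also given the security parameter $1^\lambda$: a classical randomized generator $(p,v)\leftarrow G(1^\lambda)$ of a puzzle and a verification key; a quantum algorithm $(o,\rho)\leftarrow O(p)$ producing a classical obligation and a quantum state; a quantum algorithm $a\leftarrow S(p,o,\rho,b)$ answering a challenge bit $b\in\{0,1\}$; and a classical deterministic verifier $V(p,v,o,b,a)\in\{0,1\}$. For $\eta:\mathbb N\to[0,1]$, $\mathcal Z$ has *completeness* $\eta$ if there is a negligible function $\nu$ such that for all $\lambda$ $$\Pr\bigl[(p,v)\leftarrow G(1^\lambda),\ (o,\rho)\leftarrow O(p),\ b\leftarrow\{0,1\},\ a\leftarrow S(p,o,\rho,b)\ :\ V(p,v,o,b,a)=1\bigr]\ \ge\ \eta(\lambda)-\nu(\lambda).$$ For $h:\mathbb N\to[0,1]$, $\mathcal Z$ is *$(1-h)$-hard* if for every quantum polynomial-time algorithm $\mathcal T$ there is a negligible function $\nu$ such that for all $\lambda$ $$\Pr\bigl[(p,v)\leftarrow G(1^\lambda),\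 (o,a_0,a_1)\leftarrow \mathcal T(1^\lambda,p)\ :\ V(p,v,o,0,a_0)=V(p,v,o,1,a_1)=1\bigr]\ \le\ h(\lambda)+\nu(\lambda).$$ For $n:\mathbb N\to\mathbb N$, the *$n$-fold repetition* $\mathcal Z^n=(G^n,O^n,S^n,V^n)$ is given as follows, with $n=n(\lambda)$. $G^n(1^\lambda)$ outputs $((p_1,\dots,p_n),(v_1,\dots,v_n))$ with independent $(p_i,v_i)\leftarrow G(1^\lambda)$; $O^n(p_1,\dots,p_n)$ outputs $((o_1,\dots,o_n),\rho_1\otimes\cdots\otimes\rho_n)$ with independent $(o_i,\rho_i)\leftarrow O(p_i)$; $S^n$, on $(p_i)_i,(o_i)_i,\rho_1\otimes\cdots\otimes\rho_n$ and a single bit $b$, outputs $(a_1,\dots,a_n)$ with independent $a_i\leftarrow S(p_i,o_i,\rho_i,b)$; and $V^n$ outputs $1$ iff $V(p_i,v_i,o_i,b,a_i)=1$ for all $i\le n$. Let $\eta,h:\mathbb N\to[0,1]$ be arbitrary functions, let $\mathcal Z$ be a 1-of-2 puzzle with completeness $\eta$ that is $(1-h)$-hard, and let $n:\mathbb N\to\mathbb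 N$ be polynomially bounded. Then $\mathcal Z^n$ has completeness $\lambda\mapsto\eta(\lambda)^{n(\lambda)}$ and is $(1-h^n)$-hard, where $h^n$ denotes $\lambda\mapsto h(\lambda)^{n(\lambda)}$. Moreover, if $n$ is computable in polynomial time (input and output in unary), then the algorithms of $\mathcal Z^n$ are efficient, i.e. $\mathcal Z^n$ is again a 1-of-2 puzzle. -/

import Mathlib

noncomputable section

namespace OneOfTwo

/-! ### Classical data

Strings, numbers in unary and tuples are all represented by finite binary trees.  Reading a tree
along its right spine identifies trees with finite lists of trees, so tuples nest freely. -/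

/-- Classical data: finite binary trees. -/
inductive Data : Type
  | nil : Data
  | node : Data → Data → Data
  deriving DecidableEq

namespace Data

/-- The number of vertices of a tree: the length of a classical input or value. -/
def size : Data → ℕ
  | nil => 1
  | node l r => 1 + l.size + r.size

/-- The list of components of a tree (its right spine). -/
def toList : Data → List Data
  | nil => []
  | node l r => l :: r.toList

/-- The tuple with the given components; inverse to `toList`. -/
def ofList : List Data → Data
  | [] => nil
  | x :: xs => node x (ofList xs)

/-- The `i`-th component of a tuple (`nil`, the empty string, if there is none). -/
def get (d : Data) (i : ℕ) : Data := d.toList.getD i nil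

/-- The number `m` in unary, `1^m`. -/
def unary (m : ℕ) : Data := ofList (List.replicate m nil)

/-- A bit as a classical value. -/
def ofBool : Bool → Data
  | false => nil
  | true => node nil nil

end Data

/-! ### Quantum memory

A bank of qubits has one qubit for every label in `Data`; the basis vector `|x⟩`, for `x` a finite
set of labels, is the one in which exactly the qubits with label in `x` are `1`.  Vectors need not
be normalised: only their direction matters. -/

/-- Vectors of a bank of qubits: finite combinations of computational basis vectors. -/
abbrev QVec : Type := Finset Data →₀ ℂ

namespace QVec

/-- The all-zero state `|0⋯0⟩`. -/
def vac : QVec := Finsupp.single ∅ 1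

/-- The squared Euclidean norm. -/
def normSq (ψ : QVec) : ℝ := ψ.sum fun _ z => Complex.normSq z

/-- The Hadamard gate on qubit `i`. -/
def hadamard (i : Data) : QVec →ₗ[ℂ] QVec :=
  Finsupp.linearCombination ℂ fun x : Finset Data =>
    ((Real.sqrt 2)⁻¹ : ℂ) • (Finsupp.single (x.erase i) (1 : ℂ) +
      Finsupp.single (insert i x) (if i ∈ x then (-1 : ℂ) else 1))

/-- The `T` gate `diag(1, e^{iπ/4})` on qubit `i`. -/
def tGate (i : Data) : QVec →ₗ[ℂ] QVec :=
  Finsupp.linearCombination ℂ fun x : Finset Data =>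
    Finsupp.single x (if i ∈ x then Complex.exp (Complex.I * (Real.pi / 4)) else 1)

/-- The controlled-not gate with control `i` and target `j` (the identity if `i = j`). -/
def cnot (i j : Data) : QVec →ₗ[ℂ] QVec :=
  Finsupp.linearCombination ℂ fun x : Finset Data =>
    Finsupp.single (if i ∈ x ∧ i ≠ j then symmDiff x {j} else x) (1 : ℂ)

/-- The projection onto the vectors in which qubit `i` has the value `b`. -/
def proj (i : Data) (b : Bool) (ψ : QVec) : QVec := ψ.filter fun x => decide (i ∈ x) = b

/-- The Born probability of reading `1` on qubit `i`. -/
def probOne (i : Data) (ψ : QVec) : ℝ := (proj i true ψ).normSq / ψ.normSq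

theorem normSq_nonneg (ψ : QVec) : 0 ≤ ψ.normSq :=
  Finset.sum_nonneg fun _ _ => Complex.normSq_nonneg _

theorem normSq_proj_le (i : Data) (b : Bool) (ψ : QVec) : (proj i b ψ).normSq ≤ ψ.normSq := by
  unfold normSq proj Finsupp.sum
  rw [Finsupp.support_filter]
  refine le_trans (le_of_eq (Finset.sum_congr rfl fun x hx => ?_))
    (Finset.sum_le_sum_of_subset_of_nonneg (Finset.filter_subset _ _)
      fun _ _ _ => Complex.normSq_nonneg _)
  exact congrArg _ (Finsupp.filter_apply_pos (fun x => decide (i ∈ x) = b) ψ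
    (Finset.mem_filter.mp hx).2)

theorem probOne_le_one (i : Data) (ψ : QVec) : probOne i ψ ≤ 1 :=
  div_le_one_of_le₀ (normSq_proj_le i true ψ) (normSq_nonneg ψ)

/-- The distribution of the outcome of measuring qubit `i` in the computational basis. -/
def outcome (i : Data) (ψ : QVec) : PMF Bool :=
  PMF.ofFintype
    (fun b => if b then ENNReal.ofReal (probOne i ψ) else 1 - ENNReal.ofReal (probOne i ψ))
    (by
      have h : ENNReal.ofReal (probOne i ψ) ≤ 1 := by
        simpa using ENNReal.ofReal_le_ofReal (probOne_le_one i ψ)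
      simp [add_tsub_cancel_of_le h])

end QVec

/-- A quantum memory: a family of separate banks of qubits, indexed by paths.  A program acts with
its gates on the bank `[]`, which has an unlimited supply of qubits; for a label `d` the banks
`d :: π` together form a memory of their own, which the program can hand to a subprogram.  No gate
acts across two banks, so the joint state of the banks is the tensor product of their states. -/
abbrev QMem : Type := List Data → QVec

namespace QMem

/-- The memory in which every qubit is `0`. -/
def vac : QMem := fun _ => QVec.vac

/-- The part of the memory with label `d`. -/
def bank (q : QMem) (d : Data) : QMem := fun π => q (d :: π)

/-- Replace the part of the memory with label `d`. -/
def setBank (q : QMem) (d : Data) (r : QMem) : QMem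
  | [] => q []
  | e :: π => if e = d then r π else q (e :: π)

/-- Apply an operation to the qubits of the bank `[]`. -/
def onTop (q : QMem) (f : QVec → QVec) : QMem
  | [] => f (q [])
  | e :: π => q (e :: π)

/-- The state `ρ₀ ⊗ ρ₁ ⊗ ⋯` of a list of memories, with the `i`-th one in the part labelled `1^i`
(all other qubits are `0`). -/
def tensor (ρ : List QMem) : QMem
  | [] => QVec.vac
  | d :: π => if d = Data.unary d.toList.length then ρ.getD d.toList.length vac π else QVec.vac

end QMem

/-! ### Algorithms

The machine model is a language of programs with classical control, fair coins and a quantum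
memory, whose only loops run over the components of a list, so that all programs halt.  With the
polynomial time bound imposed below, the classical deterministic programs compute exactly the
polynomial-time functions (a loop may run `size` many times, and loops may be nested); with the
universal gates `H`, `T`, `CNOT` and measurements one gets (uniform) quantum polynomial time. -/

/-- Programs.  A program is evaluated in an environment, a list of values to which `var` refers by
position. -/
inductive Prog : Type
  /-- the value of the `i`-th variable -/
  | var (i : ℕ)
  /-- the constant `nil` -/
  | nil
  /-- build a tree from two subtrees -/
  | node (a b : Prog)
  /-- left subtree -/
  | fst (a : Prog)
  /-- right subtree -/
  | snd (a : Prog)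
  /-- the size of a value, in unary -/
  | size (a : Prog)
  /-- `if c ≠ nil then a else b` -/
  | ite (c a b : Prog)
  /-- evaluate `a`, then `b` with the value of `a` as new variable `0` -/
  | letIn (a b : Prog)
  /-- loop over the components of `l`: an accumulator starts with the value of `a` and is replaced
  by the value of `b`, in which variable `0` is the component and variable `1` the accumulator -/
  | fold (l a b : Prog)
  /-- run `f` on the value of `a`, with a fresh private quantum memory that is discarded after -/
  | call (f a : Prog)
  /-- run `f` on the value of `a`, with the part labelled by the value of `d` as its memory -/
  | callIn (d f a : Prog)
  /-- toss a fair coin -/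
  | flip
  /-- Hadamard gate -/
  | gateH (i : Prog)
  /-- `T` gate -/
  | gateT (i : Prog)
  /-- controlled-not gate -/
  | gateCNOT (i j : Prog)
  /-- measure a qubit; the value is the outcome -/
  | meas (i : Prog)

/-- The loop of `Prog.fold`, for a given body. -/
def foldEval (body : Data → Data → QMem → PMF (Data × QMem)) :
    List Data → Data → QMem → PMF (Data × QMem)
  | [], acc, q => PMF.pure (acc, q)
  | x :: xs, acc, q => (body x acc q).bind fun r => foldEval body xs r.1 r.2

/-- The largest value of `t` over the outcomes that occur with positive probability. -/
def worst (μ : PMF (Data × QMem)) (t : Data → QMem → ℕ∞) : ℕ∞ :=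
  ⨆ r ∈ μ.support, t r.1 r.2

/-- The worst-case running time of the loop of `Prog.fold`. -/
def foldTime (body : Data → Data → QMem → PMF (Data × QMem)) (t : Data → Data → QMem → ℕ∞) :
    List Data → Data → QMem → ℕ∞
  | [], _, _ => 0
  | x :: xs, acc, q => t x acc q + worst (body x acc q) (foldTime body t xs)

namespace Prog

/-- The joint distribution of the value of a program and of the state of the quantum memory after
its run.  Randomness of the pure state of the memory represents mixed states. -/
def eval : Prog → List Data → QMem → PMF (Data × QMem)
  | var i, env, q => PMF.pure (env.getD i Data.nil, q)
  | nil, _, q => PMF.pure (Data.nil, q)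
  | node a b, env, q => (eval a env q).bind fun r => (eval b env r.2).map fun s =>
      (Data.node r.1 s.1, s.2)
  | fst a, env, q => (eval a env q).map fun r =>
      (match r.1 with | Data.nil => Data.nil | Data.node x _ => x, r.2)
  | snd a, env, q => (eval a env q).map fun r =>
      (match r.1 with | Data.nil => Data.nil | Data.node _ y => y, r.2)
  | size a, env, q => (eval a env q).map fun r => (Data.unary r.1.size, r.2)
  | ite c a b, env, q => (eval c env q).bind fun r =>
      if r.1 ≠ Data.nil then eval a env r.2 else eval b env r.2
  | letIn a b, env, q => (eval a env q).bind fun r => eval b (r.1 :: env) r.2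
  | fold l a b, env, q => (eval l env q).bind fun r => (eval a env r.2).bind fun s =>
      foldEval (fun x acc q' => eval b (x :: acc :: env) q') r.1.toList s.1 s.2
  | call f a, env, q => (eval a env q).bind fun r => (eval f [r.1] QMem.vac).map fun s =>
      (s.1, r.2)
  | callIn d f a, env, q => (eval d env q).bind fun r => (eval a env r.2).bind fun s =>
      (eval f [s.1] (s.2.bank r.1)).map fun u => (u.1, s.2.setBank r.1 u.2)
  | flip, _, q => (PMF.uniformOfFintype Bool).map fun b => (Data.ofBool b, q)
  | gateH i, env, q => (eval i env q).map fun r => (Data.nil, r.2.onTop (QVec.hadamard r.1))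
  | gateT i, env, q => (eval i env q).map fun r => (Data.nil, r.2.onTop (QVec.tGate r.1))
  | gateCNOT i j, env, q => (eval i env q).bind fun r => (eval j env r.2).map fun s =>
      (Data.nil, s.2.onTop (QVec.cnot r.1 s.1))
  | meas i, env, q => (eval i env q).bind fun r => (QVec.outcome r.1 (r.2 [])).map fun b =>
      (Data.ofBool b, r.2.onTop (QVec.proj r.1 b))

/-- The worst-case running time: copying or measuring the size of a value costs its size, every
other operation a constant.  In particular the size of the result is at most the running time. -/
def time : Prog → List Data → QMem → ℕ∞
  | var i, env, _ => (env.getD i Data.nil).size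
  | nil, _, _ => 1
  | node a b, env, q => 1 + time a env q + worst (eval a env q) fun _ q' => time b env q'
  | fst a, env, q => 1 + time a env q
  | snd a, env, q => 1 + time a env q
  | size a, env, q => 1 + time a env q +
      worst (eval a env q) fun x _ => ((Data.unary x.size).size : ℕ∞)
  | ite c a b, env, q => 1 + time c env q + worst (eval c env q) fun x q' =>
      if x ≠ Data.nil then time a env q' else time b env q'
  | letIn a b, env, q => 1 + time a env q + worst (eval a env q) fun x q' => time b (x :: env) q'
  | fold l a b, env, q => 1 + time l env q + worst (eval l env q) fun x q' =>
      time a env q' + worst (eval a env q') fun y q'' =>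
        foldTime (fun z acc p => eval b (z :: acc :: env) p)
          (fun z acc p => 1 + time b (z :: acc :: env) p) x.toList y q''
  | call f a, env, q => 1 + time a env q + worst (eval a env q) fun x _ => time f [x] QMem.vac
  | callIn d f a, env, q => 1 + time d env q + worst (eval d env q) fun x q' =>
      time a env q' + worst (eval a env q') fun y q'' => time f [y] (q''.bank x)
  | flip, _, _ => 3
  | gateH i, env, q => 1 + time i env q
  | gateT i, env, q => 1 + time i env q
  | gateCNOT i j, env, q => 1 + time i env q + worst (eval i env q) fun _ q' => time j env q'
  | meas i, env, q => 3 + time i env q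

/-- Classical programs: coins are allowed, gates and measurements are not. -/
def Classical : Prog → Prop
  | var _ => True
  | nil => True
  | node a b => a.Classical ∧ b.Classical
  | fst a => a.Classical
  | snd a => a.Classical
  | size a => a.Classical
  | ite c a b => c.Classical ∧ a.Classical ∧ b.Classical
  | letIn a b => a.Classical ∧ b.Classical
  | fold l a b => l.Classical ∧ a.Classical ∧ b.Classical
  | call f a => f.Classical ∧ a.Classical
  | callIn d f a => d.Classical ∧ f.Classical ∧ a.Classical
  | flip => True
  | gateH _ => False
  | gateT _ => False
  | gateCNOT _ _ => False
  | meas _ => False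

/-- Programs without coin tosses. -/
def CoinFree : Prog → Prop
  | var _ => True
  | nil => True
  | node a b => a.CoinFree ∧ b.CoinFree
  | fst a => a.CoinFree
  | snd a => a.CoinFree
  | size a => a.CoinFree
  | ite c a b => c.CoinFree ∧ a.CoinFree ∧ b.CoinFree
  | letIn a b => a.CoinFree ∧ b.CoinFree
  | fold l a b => l.CoinFree ∧ a.CoinFree ∧ b.CoinFree
  | call f a => f.CoinFree ∧ a.CoinFree
  | callIn d f a => d.CoinFree ∧ f.CoinFree ∧ a.CoinFree
  | flip => False
  | gateH i => i.CoinFree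
  | gateT i => i.CoinFree
  | gateCNOT i j => i.CoinFree ∧ j.CoinFree
  | meas i => i.CoinFree

/-- Polynomial running time, in the size of the classical input. -/
def PolyTime (f : Prog) : Prop :=
  ∃ P : Polynomial ℕ, ∀ (x : Data) (q : QMem), f.time [x] q ≤ (P.eval x.size : ℕ)

/-- The distribution of the output on a classical input, with all qubits initially `0`. -/
def run (f : Prog) (x : Data) : PMF Data := (f.eval [x] QMem.vac).map Prod.fst

end Prog

/-- Functions computable by a deterministic algorithm in polynomial time, with input and output in
unary; they are polynomially bounded. -/
def PolyTimeComputable (n : ℕ → ℕ) : Prop :=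
  ∃ f : Prog, f.Classical ∧ f.CoinFree ∧ f.PolyTime ∧
    ∀ k, f.run (Data.unary k) = PMF.pure (Data.unary (n k))

/-- Negligible functions of the security parameter. -/
def Negligible (ν : ℕ → ℝ) : Prop :=
  Asymptotics.SuperpolynomialDecay Filter.atTop (fun k : ℕ => (k : ℝ)) ν

/-- One sample from each distribution of a list, independently. -/
def sampleList {α : Type} : List (PMF α) → PMF (List α)
  | [] => PMF.pure []
  | μ :: μs => μ.bind fun x => (sampleList μs).map fun xs => x :: xs

/-! ### 1-of-2 puzzles -/

/-- The input-output behaviour of the four algorithms of a 1-of-2 puzzle; the first argument `k` is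
the security parameter.  That these behaviours come from efficient algorithms of the right kind is
`IsOneOfTwoPuzzle`. -/
structure Puzzle : Type where
  /-- puzzle generator: a random puzzle and its verification key -/
  G : ℕ → PMF (Data × Data)
  /-- obligation algorithm: from a puzzle, an obligation and a quantum state -/
  O : ℕ → Data → PMF (Data × QMem)
  /-- 1-of-2 solver: from puzzle, obligation, quantum state and challenge bit, an answer -/
  S : ℕ → Data → Data → QMem → Bool → PMF Data
  /-- verification of puzzle, key, obligation, challenge bit and answer -/
  V : ℕ → Data → Data → Data → Bool → Data → Bool

namespace Puzzle

open Data

/-- The four algorithms are efficient, `G` is classical, `V` is classical and deterministic, and `O`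
and `S` are quantum.  Every algorithm also gets the security parameter in unary. -/
structure IsOneOfTwoPuzzle (Z : Puzzle) : Prop where
  effG : ∃ f : Prog, f.Classical ∧ f.PolyTime ∧
    ∀ k, f.run (unary k) = (Z.G k).map fun pv => ofList [pv.1, pv.2]
  effO : ∃ f : Prog, f.PolyTime ∧
    ∀ k p, f.eval [ofList [unary k, p]] QMem.vac = Z.O k p
  effS : ∃ f : Prog, f.PolyTime ∧
    ∀ k p o ρ b, (f.eval [ofList [unary k, p, o, ofBool b]] ρ).map Prod.fst = Z.S k p o ρ b
  effV : ∃ f : Prog, f.Classical ∧ f.CoinFree ∧ f.PolyTime ∧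
    ∀ k p v o b a, f.run (ofList [unary k, p, v, o, ofBool b, a]) =
      PMF.pure (ofBool (Z.V k p v o b a))

/-- The honest experiment: a puzzle, an obligation, a random challenge bit, an answer, and the
verdict of the verifier. -/
def honest (Z : Puzzle) (k : ℕ) : PMF Bool :=
  (Z.G k).bind fun pv => (Z.O k pv.1).bind fun oρ => (PMF.uniformOfFintype Bool).bind fun b =>
    (Z.S k pv.1 oρ.1 oρ.2 b).map fun a => Z.V k pv.1 pv.2 oρ.1 b a

/-- Completeness `η`. -/
def HasCompleteness (Z : Puzzle) (η : ℕ → ℝ) : Prop :=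
  ∃ ν, Negligible ν ∧ ∀ k, η k - ν k ≤ (Z.honest k true).toReal

/-- Verification of answers to both challenges. -/
def V₂ (Z : Puzzle) (k : ℕ) (p v o a₀ a₁ : Data) : Bool :=
  Z.V k p v o false a₀ && Z.V k p v o true a₁

/-- The 2-of-2 solving game: the solver `T` gets a puzzle `p` and outputs a triple `(o, a₀, a₁)`. -/
def solveBoth (Z : Puzzle) (T : Prog) (k : ℕ) : PMF Bool :=
  (Z.G k).bind fun pv => (T.run (ofList [unary k, pv.1])).map fun t =>
    Z.V₂ k pv.1 pv.2 (t.get 0) (t.get 1) (t.get 2)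

/-- Hardness `δ`: every quantum polynomial-time 2-of-2 solver wins with probability at most
`1 - δ`, up to a negligible function. -/
def IsHard (Z : Puzzle) (δ : ℕ → ℝ) : Prop :=
  ∀ T : Prog, T.PolyTime →
    ∃ ν, Negligible ν ∧ ∀ k, (Z.solveBoth T k true).toReal ≤ (1 - δ k) + ν k

/-- The `n`-fold parallel repetition: `n k` independent puzzles, with one shared challenge bit. -/
def rep (Z : Puzzle) (n : ℕ → ℕ) : Puzzle where
  G k := (sampleList (List.replicate (n k) (Z.G k))).map fun l =>
    (ofList (l.map Prod.fst), ofList (l.map Prod.snd))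
  O k p := (sampleList ((List.range (n k)).map fun i => Z.O k (p.get i))).map fun l =>
    (ofList (l.map Prod.fst), QMem.tensor (l.map Prod.snd))
  S k p o ρ b := (sampleList ((List.range (n k)).map fun i =>
    Z.S k (p.get i) (o.get i) (ρ.bank (unary i)) b)).map ofList
  V k p v o b a := decide (∀ i < n k, Z.V k (p.get i) (v.get i) (o.get i) b (a.get i) = true)

end Puzzle

end OneOfTwo

end

/-! Hardness. Let T attack the n-fold repetition. Fix a list π of puzzles, append s fresh ones drawn
together with their keys, and let `value` be the probability that T solves all fresh ones; the
puzzles in π are not checked, so their keys are not needed. For one more puzzle p with key v, put b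
= `value` of (p :: π, s), and let a be the probability that p is solved as well. Then the value of
(π, s + 1) is the mean of a. Rerunning T with new fresh puzzles until these are solved gives a
solver for p alone, with success r close to a / b; precisely a ≤ b * r + 1 / (R + 1) after R
attempts (`expect_trial_le`). If p* is a puzzle whose b is, up to δ, at least that of almost every
p, the value of (π, s + 1) is at most E[r] * (b(p*) + δ) plus errors (`value_succ_le`). If E[r] ≤ h
+ 2δ except with small probability over the prefixes π built from such choices, n steps bound the
success of T by h^n + n * error (`value_nil_le`).

Such choices are made by sampling: draw N + 1 candidates, estimate each by N' trials, keep the one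
with the highest count. A further draw ranks strictly higher with probability at most 1 / (N + 2),
and Chebyshev's inequality controls the estimates (`expect_bestP_le`).

The solver for a single puzzle guesses a total m and a position i, builds a prefix of length i,
tests the resulting retry solver on puzzles it generates itself, and plays the best of many such
candidates. Hardness bounds its success by h + ν, so a random candidate rarely exceeds h + 2δ
(`expect_candidate_le`); for the true m = n(k) and any i < m this costs a factor polynomial in k
(`expect_choosePath_le`). Since m is guessed, n need not be computable. For every exponent c the
parameters can be set so that the total error is at most 72 / (2k+2)^c. Only the output distribution
of T on classical inputs matters, so its being quantum is no obstacle to rerunning it.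

Completeness. Given the shared bit, the n runs are independent, so the success probability is the
mean over b of s_b^n, which is at least (mean of s_b)^n by convexity.

Efficiency. Each algorithm of the repetition computes n(k) in unary and loops over it, with the i-th
copy confined to its own part of the quantum memory (`exists_prog_banks`). -/

namespace OneOfTwo

/-! ### Trees as lists -/

namespace Data

/-- Left subtree. -/
def fst : Data → Data
  | nil => nil
  | node x _ => x

/-- Right subtree. -/
def snd : Data → Data
  | nil => nil
  | node _ y => y

@[simp] theorem fst_node (x y : Data) : (node x y).fst = x := rfl
@[simp] theorem snd_node (x y : Data) : (node x y).snd = y := rfl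
@[simp] theorem fst_nil : nil.fst = nil := rfl
@[simp] theorem snd_nil : nil.snd = nil := rfl

@[simp] theorem toList_nil : nil.toList = [] := rfl
@[simp] theorem toList_node (x y : Data) : (node x y).toList = x :: y.toList := rfl

@[simp] theorem toList_ofList (l : List Data) : (ofList l).toList = l := by
  induction l with
  | nil => rfl
  | cons a l ih => simp [ofList, ih]

@[simp] theorem ofList_toList (d : Data) : ofList d.toList = d := by
  induction d with
  | nil => rfl
  | node a b _ ih => simp [ofList, ih]

@[simp] theorem ofList_nil : ofList [] = nil := rfl
@[simp] theorem ofList_cons (a : Data) (l : List Data) : ofList (a :: l) = node a (ofList l) := rfl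

@[simp] theorem toList_unary (m : ℕ) : (unary m).toList = List.replicate m nil := by
  simp [unary]

@[simp] theorem unary_zero : unary 0 = nil := rfl

theorem unary_succ (m : ℕ) : unary (m + 1) = node nil (unary m) := rfl

theorem size_unary (m : ℕ) : (unary m).size = 2 * m + 1 := by
  induction m with
  | zero => rfl
  | succ m ih => rw [unary_succ, size, ih, size]; omega

theorem unary_injective : Function.Injective unary := fun a b h => by
  simpa using congrArg (fun d => d.toList.length) h

theorem size_pos (d : Data) : 0 < d.size := by cases d <;> simp [size]

theorem length_toList_lt_size (d : Data) : d.toList.length < d.size := by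
  induction d with
  | nil => simp [size]
  | node a b _ ih => simp [size]; have := a.size_pos; omega

theorem size_lt_of_mem_toList {d e : Data} (h : e ∈ d.toList) : e.size < d.size := by
  induction d with
  | nil => simp at h
  | node a b _ ih =>
    simp only [toList_node, List.mem_cons] at h
    rcases h with rfl | h
    · simp [size]; omega
    · have := ih h; simp [size]; omega

theorem size_fst_le (d : Data) : d.fst.size ≤ d.size := by cases d <;> simp [size]; omega
theorem size_snd_le (d : Data) : d.snd.size ≤ d.size := by cases d <;> simp [size]

theorem get_ofList (l : List Data) (i : ℕ) : (ofList l).get i = l.getD i nil := by simp [get]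

@[simp] theorem get_zero (d : Data) : d.get 0 = d.fst := by cases d <;> rfl

theorem get_succ (d : Data) (i : ℕ) : d.get (i + 1) = d.snd.get i := by
  cases d <;> simp [get]

@[simp] theorem ofBool_ne_nil {b : Bool} : ofBool b ≠ nil ↔ b = true := by
  cases b <;> simp [ofBool]

@[simp] theorem ofBool_eq_nil {b : Bool} : ofBool b = nil ↔ b = false := by
  cases b <;> simp [ofBool]

end Data

open Data

/-! ### Expectations -/

/-- The expectation of a nonnegative function. -/
noncomputable def expect {α : Type*} (μ : PMF α) (f : α → ENNReal) : ENNReal := ∑' a, μ a * f a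

section expect

variable {α β : Type*}

@[simp] theorem expect_pure (a : α) (f : α → ENNReal) : expect (PMF.pure a) f = f a := by
  unfold expect
  rw [tsum_eq_single a]
  · simp
  · intro b hb; simp [hb]

theorem expect_bind (μ : PMF α) (g : α → PMF β) (f : β → ENNReal) :
    expect (μ.bind g) f = expect μ fun a => expect (g a) f := by
  unfold expect
  simp only [PMF.bind_apply, ← ENNReal.tsum_mul_right, ← ENNReal.tsum_mul_left]
  rw [ENNReal.tsum_comm]
  simp only [mul_assoc]

theorem expect_map (μ : PMF α) (g : α → β) (f : β → ENNReal) :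
    expect (μ.map g) f = expect μ fun a => f (g a) := by
  rw [← PMF.bind_pure_comp, expect_bind]; simp

@[simp] theorem expect_const (μ : PMF α) (c : ENNReal) : expect μ (fun _ => c) = c := by
  unfold expect; rw [ENNReal.tsum_mul_right, PMF.tsum_coe, one_mul]

theorem expect_mono_support {μ : PMF α} {f g : α → ENNReal} (h : ∀ a ∈ μ.support, f a ≤ g a) :
    expect μ f ≤ expect μ g := by
  refine ENNReal.tsum_le_tsum fun a => ?_
  by_cases ha : μ a = 0
  · simp [ha]
  · gcongr; exact h a (by simpa [PMF.mem_support_iff] using ha)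

theorem expect_mono {μ : PMF α} {f g : α → ENNReal} (h : ∀ a, f a ≤ g a) :
    expect μ f ≤ expect μ g := expect_mono_support fun a _ => h a

theorem expect_add (μ : PMF α) (f g : α → ENNReal) :
    expect μ (fun a => f a + g a) = expect μ f + expect μ g := by
  unfold expect; simp only [mul_add]; exact ENNReal.tsum_add

theorem expect_mul_left (μ : PMF α) (c : ENNReal) (f : α → ENNReal) :
    expect μ (fun a => c * f a) = c * expect μ f := by
  unfold expect; rw [← ENNReal.tsum_mul_left]; congr 1; ext a; ring

theorem expect_mul_right (μ : PMF α) (c : ENNReal) (f : α → ENNReal) :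
    expect μ (fun a => f a * c) = expect μ f * c := by
  simp only [mul_comm _ c, expect_mul_left]

theorem expect_le {μ : PMF α} {f : α → ENNReal} {c : ENNReal} (h : ∀ a, f a ≤ c) :
    expect μ f ≤ c := (expect_mono h).trans_eq (expect_const μ c)

theorem mul_le_expect (μ : PMF α) (f : α → ENNReal) (a : α) : μ a * f a ≤ expect μ f :=
  ENNReal.le_tsum a

theorem expect_bool (μ : PMF Bool) (f : Bool → ENNReal) :
    expect μ f = μ false * f false + μ true * f true := by
  unfold expect; rw [tsum_bool]

theorem apply_eq_expect [DecidableEq α] (μ : PMF α) (a : α) :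
    μ a = expect μ fun b => if b = a then 1 else 0 := by
  unfold expect; rw [tsum_eq_single a] <;> simp +contextual

theorem apply_true_eq_expect (μ : PMF Bool) : μ true = expect μ fun b => if b then 1 else 0 := by
  simpa using apply_eq_expect μ true

theorem map_true_eq_expect (μ : PMF α) (φ : α → Bool) :
    μ.map φ true = expect μ fun a => if φ a then 1 else 0 := by
  rw [apply_true_eq_expect, expect_map]

theorem expect_comm (μ : PMF α) (ν : PMF β) (f : α → β → ENNReal) :
    expect μ (fun a => expect ν (f a)) = expect ν fun b => expect μ fun a => f a b := by
  unfold expect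
  simp only [← ENNReal.tsum_mul_left]
  rw [ENNReal.tsum_comm]
  congr! 4 with b a
  ring

end expect

/-! ### Running time -/

theorem worst_le {μ : PMF (Data × QMem)} {t : Data → QMem → ℕ∞} {B : ℕ∞}
    (h : ∀ r ∈ μ.support, t r.1 r.2 ≤ B) : worst μ t ≤ B := iSup₂_le h

theorem le_worst {μ : PMF (Data × QMem)} (t : Data → QMem → ℕ∞) {r : Data × QMem}
    (h : r ∈ μ.support) : t r.1 r.2 ≤ worst μ t :=
  le_iSup₂ (f := fun (r : Data × QMem) (_ : r ∈ μ.support) => t r.1 r.2) r h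

/-- The final value is either the initial accumulator, if there is no iteration, or the result of
the last iteration, which is paid for by the time of that iteration. -/
theorem foldEval_size_le {body : Data → Data → QMem → PMF (Data × QMem)}
    {t : Data → Data → QMem → ℕ∞}
    (hb : ∀ x acc q, ∀ r ∈ (body x acc q).support, (r.1.size : ℕ∞) ≤ t x acc q) (l : List Data) :
    ∀ acc q, ∀ r ∈ (foldEval body l acc q).support,
      (r.1.size : ℕ∞) ≤ acc.size + foldTime body t l acc q := by
  induction l with
  | nil =>
    intro acc q r hr
    simp only [foldEval, PMF.support_pure, Set.mem_singleton_iff] at hr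
    subst hr; simp [foldTime]
  | cons x xs ih =>
    intro acc q r hr
    simp only [foldEval, PMF.support_bind, Set.mem_iUnion] at hr
    obtain ⟨s, hs, hr⟩ := hr
    calc (r.1.size : ℕ∞) ≤ s.1.size + foldTime body t xs s.1 s.2 := ih _ _ r hr
      _ ≤ t x acc q + worst (body x acc q) (foldTime body t xs) :=
        add_le_add (hb _ _ _ _ hs) (le_worst (foldTime body t xs) hs)
      _ ≤ acc.size + foldTime body t (x :: xs) acc q := le_add_self

/-- The size of the result of a program is at most its running time. -/
theorem Prog.size_le_time (p : Prog) : ∀ env q, ∀ r ∈ (p.eval env q).support,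
    (r.1.size : ℕ∞) ≤ p.time env q := by
  induction p with
  | var i => intro env q r hr; simp only [eval, PMF.support_pure, Set.mem_singleton_iff] at hr
             subst hr; simp [time]
  | nil => intro env q r hr; simp only [eval, PMF.support_pure, Set.mem_singleton_iff] at hr
           subst hr; simp [time, Data.size]
  | node a b iha ihb =>
    intro env q r hr
    simp only [eval, PMF.support_bind, PMF.support_map, Set.mem_iUnion, Set.mem_image] at hr
    obtain ⟨s, hs, u, hu, rfl⟩ := hr
    simp only [time, Data.size, Nat.cast_add, Nat.cast_one]
    exact add_le_add (add_le_add le_rfl (iha _ _ _ hs))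
      ((ihb _ _ _ hu).trans (le_worst (fun _ q' => b.time env q') hs))
  | fst a iha =>
    intro env q r hr
    simp only [eval, PMF.support_map, Set.mem_image] at hr
    obtain ⟨s, hs, rfl⟩ := hr
    exact le_trans (Nat.cast_le.2 (size_fst_le s.1)) ((iha _ _ _ hs).trans le_add_self)
  | snd a iha =>
    intro env q r hr
    simp only [eval, PMF.support_map, Set.mem_image] at hr
    obtain ⟨s, hs, rfl⟩ := hr
    exact le_trans (Nat.cast_le.2 (size_snd_le s.1)) ((iha _ _ _ hs).trans le_add_self)
  | size a iha =>
    intro env q r hr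
    simp only [eval, PMF.support_map, Set.mem_image] at hr
    obtain ⟨s, hs, rfl⟩ := hr
    exact (le_worst (fun x _ => ((Data.unary x.size).size : ℕ∞)) hs).trans le_add_self
  | ite c a b ihc iha ihb =>
    intro env q r hr
    simp only [eval, PMF.support_bind, Set.mem_iUnion] at hr
    obtain ⟨s, hs, hr⟩ := hr
    refine le_trans ?_ ((le_worst (fun x q' => if x ≠ Data.nil then a.time env q' else
      b.time env q') hs).trans le_add_self)
    split_ifs at hr ⊢
    · exact iha _ _ _ hr
    · exact ihb _ _ _ hr
  | letIn a b iha ihb =>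
    intro env q r hr
    simp only [eval, PMF.support_bind, Set.mem_iUnion] at hr
    obtain ⟨s, hs, hr⟩ := hr
    exact (ihb _ _ _ hr).trans
      ((le_worst (fun x q' => b.time (x :: env) q') hs).trans le_add_self)
  | fold l a b ihl iha ihb =>
    intro env q r hr
    simp only [eval, PMF.support_bind, Set.mem_iUnion] at hr
    obtain ⟨s, hs, u, hu, hr⟩ := hr
    have h1 := foldEval_size_le (body := fun x acc q' => b.eval (x :: acc :: env) q')
      (t := fun z acc p => 1 + b.time (z :: acc :: env) p)
      (fun x acc q r hr => (ihb _ _ _ hr).trans le_add_self) s.1.toList u.1 u.2 r hr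
    refine h1.trans (le_trans ?_ ((le_worst (fun x q' =>
      a.time env q' + worst (a.eval env q') fun y q'' =>
        foldTime (fun z acc p => b.eval (z :: acc :: env) p)
          (fun z acc p => 1 + b.time (z :: acc :: env) p) x.toList y q'') hs).trans le_add_self))
    exact add_le_add (iha _ _ _ hu) (le_worst (fun y q'' =>
        foldTime (fun z acc p => b.eval (z :: acc :: env) p)
          (fun z acc p => 1 + b.time (z :: acc :: env) p) s.1.toList y q'') hu)
  | call f a ihf iha =>
    intro env q r hr
    simp only [eval, PMF.support_bind, PMF.support_map, Set.mem_iUnion, Set.mem_image] at hr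
    obtain ⟨s, hs, u, hu, rfl⟩ := hr
    exact (ihf _ _ _ hu).trans
      ((le_worst (fun x _ => f.time [x] QMem.vac) hs).trans le_add_self)
  | callIn d f a ihd ihf iha =>
    intro env q r hr
    simp only [eval, PMF.support_bind, PMF.support_map, Set.mem_iUnion, Set.mem_image] at hr
    obtain ⟨s, hs, u, hu, w, hw, rfl⟩ := hr
    refine (ihf _ _ _ hw).trans (le_trans ?_ ((le_worst (fun x q' =>
      a.time env q' + worst (a.eval env q') fun y q'' => f.time [y] (q''.bank x)) hs).trans
      le_add_self))
    exact (le_worst (fun y q'' => f.time [y] (q''.bank s.1)) hu).trans le_add_self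
  | flip =>
    intro env q r hr
    simp only [eval, PMF.support_map, Set.mem_image] at hr
    obtain ⟨b, -, rfl⟩ := hr
    cases b <;> simp [time, Data.ofBool, Data.size]
  | gateH i ih =>
    intro env q r hr
    simp only [eval, PMF.support_map, Set.mem_image] at hr
    obtain ⟨s, hs, rfl⟩ := hr
    simp [time, Data.size]
  | gateT i ih =>
    intro env q r hr
    simp only [eval, PMF.support_map, Set.mem_image] at hr
    obtain ⟨s, hs, rfl⟩ := hr
    simp [time, Data.size]
  | gateCNOT i j ihi ihj =>
    intro env q r hr
    simp only [eval, PMF.support_bind, PMF.support_map, Set.mem_iUnion, Set.mem_image] at hr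
    obtain ⟨s, hs, u, hu, rfl⟩ := hr
    simp [time, Data.size, add_assoc]
  | meas i ih =>
    intro env q r hr
    simp only [eval, PMF.support_bind, PMF.support_map, Set.mem_iUnion, Set.mem_image] at hr
    obtain ⟨s, hs, b, hb, rfl⟩ := hr
    simp only [time]
    -- The charge 3 for a measurement is the size of `ofBool true`.
    refine le_trans ?_ le_self_add
    cases b <;> simp [Data.ofBool, Data.size]

/-- A uniform bound on the time of an iteration needs control of the accumulator. The invariant
carries the iteration number, so that sizes may grow from step to step. -/
theorem foldTime_le {body : Data → Data → QMem → PMF (Data × QMem)}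
    {t : Data → Data → QMem → ℕ∞} {C : ℕ} (Inv : ℕ → Data → Prop) (l : List Data) :
    ∀ j, (∀ i x acc q, i < j + l.length → x ∈ l → Inv i acc → t x acc q ≤ C) →
    (∀ i x acc q, i < j + l.length → x ∈ l → Inv i acc →
      ∀ r ∈ (body x acc q).support, Inv (i + 1) r.1) →
    ∀ acc q, Inv j acc → foldTime body t l acc q ≤ (l.length * C : ℕ) := by
  induction l with
  | nil => intro j _ _ acc q _; simp [foldTime]
  | cons x xs ih =>
    intro j ht hI acc q hacc
    have h1 : t x acc q ≤ C := ht j x acc q (by simp) (by simp) hacc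
    have h2 : worst (body x acc q) (foldTime body t xs) ≤ (xs.length * C : ℕ) := by
      refine worst_le fun r hr => ih (j + 1) ?_ ?_ _ _ (hI j x acc q (by simp) (by simp) hacc r hr)
      · intro i y a q hi hy; exact ht i y a q (by simp; omega) (by simp [hy])
      · intro i y a q hi hy; exact hI i y a q (by simp; omega) (by simp [hy])
    calc foldTime body t (x :: xs) acc q ≤ (C : ℕ∞) + (xs.length * C : ℕ) := add_le_add h1 h2
      _ = ((x :: xs).length * C : ℕ) := by push_cast [List.length_cons]; ring

theorem polynomial_eval_mono (P : Polynomial ℕ) {a b : ℕ} (h : a ≤ b) : P.eval a ≤ P.eval b := by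
  rw [Polynomial.eval_eq_sum, Polynomial.eval_eq_sum]
  exact Finset.sum_le_sum fun i _ => Nat.mul_le_mul_left _ (Nat.pow_le_pow_left h i)

/-! ### Efficiently samplable families of distributions -/

/-- Classes of programs that contain the deterministic classical constructs. -/
class Prog.Closed (Φ : Prog → Prop) : Prop where
  var : ∀ i, Φ (.var i)
  nil : Φ .nil
  node : ∀ {a b}, Φ a → Φ b → Φ (.node a b)
  fst : ∀ {a}, Φ a → Φ (.fst a)
  snd : ∀ {a}, Φ a → Φ (.snd a)
  size : ∀ {a}, Φ a → Φ (.size a)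
  ite : ∀ {c a b}, Φ c → Φ a → Φ b → Φ (.ite c a b)
  fold : ∀ {l a b}, Φ l → Φ a → Φ b → Φ (.fold l a b)
  call : ∀ {f a}, Φ f → Φ a → Φ (.call f a)

/-- All programs. -/
def Prog.Any : Prog → Prop := fun _ => True

/-- Classical programs without coin tosses. -/
def Prog.Deterministic : Prog → Prop := fun f => f.Classical ∧ f.CoinFree

instance : Prog.Closed Prog.Any := by constructor <;> intros <;> trivial

instance : Prog.Closed Prog.Classical := by
  constructor <;> intros <;> simp only [Prog.Classical] <;> tauto

instance : Prog.Closed Prog.Deterministic := by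
  constructor <;> intros <;> simp_all [Prog.Deterministic, Prog.Classical, Prog.CoinFree]

/-- `F` is sampled in polynomial time by a program of the class `Φ` that leaves the quantum memory
alone. -/
def Eff (Φ : Prog → Prop) (F : Data → PMF Data) : Prop :=
  ∃ f : Prog, Φ f ∧ f.PolyTime ∧ ∀ x q, f.eval [x] q = (F x).map fun a => (a, q)

/-- `g` is computed in polynomial time by a program of the class `Φ`. -/
def DEff (Φ : Prog → Prop) (g : Data → Data) : Prop := Eff Φ fun x => PMF.pure (g x)

/-- The loop of `Prog.fold`, for a body that does not use the quantum memory. -/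
noncomputable def foldP (body : Data → Data → PMF Data) : List Data → Data → PMF Data
  | [], acc => PMF.pure acc
  | x :: xs, acc => (body x acc).bind fun r => foldP body xs r

theorem foldEval_eq_map_foldP {body : Data → Data → QMem → PMF (Data × QMem)}
    {B : Data → Data → PMF Data} (h : ∀ x acc q, body x acc q = (B x acc).map fun a => (a, q))
    (l : List Data) : ∀ acc q, foldEval body l acc q = (foldP B l acc).map fun a => (a, q) := by
  induction l with
  | nil => intro acc q; simp [foldEval, foldP, PMF.pure_map]
  | cons x xs ih =>
    intro acc q
    simp only [foldEval, foldP, h, PMF.bind_map, PMF.map_bind, Function.comp_def, ih]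

theorem foldP_pure (g : Data → Data → Data) (l : List Data) : ∀ acc,
    foldP (fun x acc => PMF.pure (g x acc)) l acc = PMF.pure (l.foldl (fun a x => g x a) acc) := by
  induction l with
  | nil => intro acc; rfl
  | cons x xs ih => intro acc; simp [foldP, ih, PMF.pure_bind]

theorem Eff.congr {Φ : Prog → Prop} {F G : Data → PMF Data} (hF : Eff Φ F) (h : ∀ x, F x = G x) :
    Eff Φ G := by
  obtain rfl : F = G := funext h
  exact hF

theorem DEff.congr {Φ : Prog → Prop} {f g : Data → Data} (hf : DEff Φ f) (h : ∀ x, f x = g x) :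
    DEff Φ g := Eff.congr hf fun x => by rw [h]

/-- Output size is bounded by running time. This is what makes polynomial time bounds compose. -/
theorem Eff.size_le {Φ : Prog → Prop} {F : Data → PMF Data} (hF : Eff Φ F) :
    ∃ P : Polynomial ℕ, ∀ x, ∀ a ∈ (F x).support, a.size ≤ P.eval x.size := by
  obtain ⟨f, -, ⟨P, hP⟩, hf⟩ := hF
  refine ⟨P, fun x a ha => ?_⟩
  have h := f.size_le_time [x] QMem.vac (a, QMem.vac) (by rw [hf]; simpa using ha)
  exact_mod_cast h.trans (hP x _)

theorem DEff.size_le {Φ : Prog → Prop} {g : Data → Data} (hg : DEff Φ g) :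
    ∃ P : Polynomial ℕ, ∀ x, (g x).size ≤ P.eval x.size := by
  obtain ⟨P, hP⟩ := Eff.size_le hg
  exact ⟨P, fun x => hP x _ (by simp)⟩

theorem worst_map_le {F : PMF Data} {q : QMem} {t : Data → QMem → ℕ∞} {B : ℕ∞}
    (h : ∀ a ∈ F.support, t a q ≤ B) : worst (F.map fun a => (a, q)) t ≤ B := by
  refine worst_le fun r hr => ?_
  simp only [PMF.support_map, Set.mem_image] at hr
  obtain ⟨a, ha, rfl⟩ := hr
  exact h a ha

/-! ### Closure properties of efficient samplers. -/

section closure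

variable {Φ : Prog → Prop} [hΦ : Prog.Closed Φ]

theorem DEff.id : DEff Φ fun x => x := by
  refine ⟨.var 0, hΦ.var 0, ⟨.X, fun x q => ?_⟩, fun x q => ?_⟩
  · simp [Prog.time]
  · simp [Prog.eval, PMF.pure_map]

theorem DEff.nil : DEff Φ fun _ => Data.nil := by
  refine ⟨.nil, hΦ.nil, ⟨1, fun x q => ?_⟩, fun x q => ?_⟩
  · simp [Prog.time]
  · simp [Prog.eval, PMF.pure_map]

/-- Running a subroutine on a sampled argument. -/
theorem Eff.comp {F G : Data → PMF Data} (hG : Eff Φ G) (hF : Eff Φ F) :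
    Eff Φ fun x => (F x).bind G := by
  obtain ⟨P, hP⟩ := hF.size_le
  obtain ⟨f, hf, ⟨Pf, hPf⟩, ef⟩ := hF
  obtain ⟨g, hg, ⟨Pg, hPg⟩, eg⟩ := hG
  refine ⟨.call g f, hΦ.call hg hf, ⟨1 + Pf + Pg.comp P, fun x q => ?_⟩, fun x q => ?_⟩
  · rw [Prog.time, ef]
    simp only [Polynomial.eval_add, Polynomial.eval_one, Polynomial.eval_comp, Nat.cast_add,
      Nat.cast_one]
    refine add_le_add (add_le_add le_rfl (hPf x q)) (worst_map_le fun a ha => ?_)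
    exact (hPg a _).trans (Nat.cast_le.2 (polynomial_eval_mono Pg (hP x a ha)))
  · simp [Prog.eval, ef, eg, PMF.bind_map, PMF.map_comp, Function.comp_def, PMF.map_bind]

theorem Eff.comp_det {G : Data → PMF Data} {g : Data → Data} (hG : Eff Φ G) (hg : DEff Φ g) :
    Eff Φ fun x => G (g x) :=
  (Eff.comp hG hg).congr fun _ => PMF.pure_bind _ _

theorem DEff.comp {f g : Data → Data} (hf : DEff Φ f) (hg : DEff Φ g) : DEff Φ fun x => f (g x) :=
  Eff.comp_det (G := fun x => PMF.pure (f x)) hf hg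

theorem Eff.node {F G : Data → PMF Data} (hF : Eff Φ F) (hG : Eff Φ G) :
    Eff Φ fun x => (F x).bind fun a => (G x).map fun b => Data.node a b := by
  obtain ⟨f, hf, ⟨Pf, hPf⟩, ef⟩ := hF
  obtain ⟨g, hg, ⟨Pg, hPg⟩, eg⟩ := hG
  refine ⟨.node f g, hΦ.node hf hg, ⟨1 + Pf + Pg, fun x q => ?_⟩, fun x q => ?_⟩
  · rw [Prog.time, ef]
    simp only [Polynomial.eval_add, Polynomial.eval_one, Nat.cast_add, Nat.cast_one]
    exact add_le_add (add_le_add le_rfl (hPf x q)) (worst_map_le fun a ha => hPg x q)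
  · simp [Prog.eval, ef, eg, PMF.bind_map, PMF.map_comp, Function.comp_def, PMF.map_bind]

theorem DEff.node {f g : Data → Data} (hf : DEff Φ f) (hg : DEff Φ g) :
    DEff Φ fun x => Data.node (f x) (g x) :=
  (Eff.node hf hg).congr fun x => by simp [PMF.pure_bind, PMF.pure_map]

theorem DEff.fst {g : Data → Data} (hg : DEff Φ g) : DEff Φ fun x => (g x).fst := by
  obtain ⟨f, hf, ⟨P, hP⟩, ef⟩ := hg
  refine ⟨.fst f, hΦ.fst hf, ⟨1 + P, fun x q => ?_⟩, fun x q => ?_⟩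
  · simp only [Prog.time, Polynomial.eval_add, Polynomial.eval_one, Nat.cast_add, Nat.cast_one]
    exact add_le_add le_rfl (hP x q)
  · simp only [Prog.eval, ef, PMF.pure_map]; rfl

theorem DEff.snd {g : Data → Data} (hg : DEff Φ g) : DEff Φ fun x => (g x).snd := by
  obtain ⟨f, hf, ⟨P, hP⟩, ef⟩ := hg
  refine ⟨.snd f, hΦ.snd hf, ⟨1 + P, fun x q => ?_⟩, fun x q => ?_⟩
  · simp only [Prog.time, Polynomial.eval_add, Polynomial.eval_one, Nat.cast_add, Nat.cast_one]
    exact add_le_add le_rfl (hP x q)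
  · simp only [Prog.eval, ef, PMF.pure_map]; rfl

theorem DEff.size {g : Data → Data} (hg : DEff Φ g) : DEff Φ fun x => unary (g x).size := by
  obtain ⟨P', hP'⟩ := hg.size_le
  obtain ⟨f, hf, ⟨P, hP⟩, ef⟩ := hg
  refine ⟨.size f, hΦ.size hf, ⟨1 + P + (2 * P' + 1), fun x q => ?_⟩, fun x q => ?_⟩
  · rw [Prog.time, ef]
    simp only [Polynomial.eval_add, Polynomial.eval_one, Nat.cast_add, Nat.cast_one]
    refine add_le_add (add_le_add le_rfl (hP x q)) (worst_map_le fun a ha => ?_)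
    simp only [PMF.support_pure, Set.mem_singleton_iff] at ha
    subst ha
    rw [size_unary]
    have := hP' x
    norm_cast
    simp only [Polynomial.eval_mul, Polynomial.eval_ofNat]
    omega
  · simp [Prog.eval, ef, PMF.pure_map]

theorem Eff.ite {c : Data → Data} {F G : Data → PMF Data} (hc : DEff Φ c) (hF : Eff Φ F)
    (hG : Eff Φ G) : Eff Φ fun x => if c x ≠ Data.nil then F x else G x := by
  obtain ⟨c', hc', ⟨Pc, hPc⟩, ec⟩ := hc
  obtain ⟨f, hf, ⟨Pf, hPf⟩, ef⟩ := hF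
  obtain ⟨g, hg, ⟨Pg, hPg⟩, eg⟩ := hG
  refine ⟨.ite c' f g, hΦ.ite hc' hf hg, ⟨1 + Pc + (Pf + Pg), fun x q => ?_⟩, fun x q => ?_⟩
  · rw [Prog.time, ec]
    simp only [Polynomial.eval_add, Polynomial.eval_one, Nat.cast_add, Nat.cast_one]
    refine add_le_add (add_le_add le_rfl (hPc x q)) (worst_map_le fun a ha => ?_)
    split_ifs
    · exact (hPf x q).trans le_self_add
    · exact (hPg x q).trans le_add_self
  · simp only [Prog.eval, ec, ef, eg, PMF.pure_map, PMF.pure_bind]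
    split_ifs <;> rfl

theorem DEff.ite {c f g : Data → Data} (hc : DEff Φ c) (hf : DEff Φ f) (hg : DEff Φ g) :
    DEff Φ fun x => if c x ≠ Data.nil then f x else g x :=
  (Eff.ite hc hf hg).congr fun x => by dsimp only; split_ifs <;> rfl

/-- Sequential composition, where the second sampler also sees the input. -/
theorem Eff.bind {F : Data → PMF Data} {H : Data → Data → PMF Data} (hF : Eff Φ F)
    (hH : Eff Φ fun y => H y.fst y.snd) : Eff Φ fun x => (F x).bind fun a => H a x :=
  (Eff.comp hH (Eff.node hF DEff.id)).congr fun x => by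
    simp [PMF.pure_map, PMF.bind_bind, PMF.pure_bind]

theorem Eff.map {F : Data → PMF Data} {g : Data → Data → Data} (hF : Eff Φ F)
    (hg : DEff Φ fun y => g y.fst y.snd) : Eff Φ fun x => (F x).map fun a => g a x :=
  (Eff.bind (H := fun a x => PMF.pure (g a x)) hF hg).congr fun x => by
    rw [← PMF.bind_pure_comp]; rfl

/-- Loops in which the size of the accumulator stays under control. -/
theorem Eff.loop {L A : Data → Data} {B : Data → Data → Data → PMF Data} (hL : DEff Φ L)
    (hA : DEff Φ A) (hB : Eff Φ fun y => B y.fst y.snd.fst y.snd.snd)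
    (Inv : Data → ℕ → Data → Prop) (P : Polynomial ℕ) (h0 : ∀ x, Inv x 0 (A x))
    (hs : ∀ x j acc e, j < (L x).toList.length → e ∈ (L x).toList → Inv x j acc →
      ∀ r ∈ (B e acc x).support, Inv x (j + 1) r)
    (hP : ∀ x j acc, j < (L x).toList.length → Inv x j acc → acc.size ≤ P.eval x.size) :
    Eff Φ fun x => foldP (fun e acc => B e acc x) (L x).toList (A x) := by
  obtain ⟨PL', hPL'⟩ := hL.size_le
  obtain ⟨l, hl, ⟨PL, hPL⟩, el⟩ := hL
  obtain ⟨a, ha, ⟨PA, hPA⟩, ea⟩ := hA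
  obtain ⟨b, hb, ⟨PB, hPB⟩, eb⟩ := hB
  -- The body of the loop runs in the environment `[e, acc, x]`, while `b` expects a single input;
  -- `arg` packs the three values into one tree.
  set arg : Prog := .node (.var 0) (.node (.var 1) (.var 2)) with harg
  have earg : ∀ e acc x q, arg.eval [e, acc, x] q =
      PMF.pure (Data.node e (Data.node acc x), q) := by
    intro e acc x q; simp [harg, Prog.eval, PMF.pure_bind, PMF.pure_map]
  have ebody : ∀ e acc x q, (Prog.call b arg).eval [e, acc, x] q =
      (B e acc x).map fun a => (a, q) := by
    intro e acc x q
    simp [Prog.eval, earg, PMF.pure_bind, eb, PMF.map_comp, Function.comp_def]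
  refine ⟨.fold l a (.call b arg), hΦ.fold hl ha (hΦ.call hb (hΦ.node (hΦ.var _)
    (hΦ.node (hΦ.var _) (hΦ.var _)))),
    ⟨1 + PL + (PA + PL' * (4 + (PL' + P + .X) + PB.comp (2 + (PL' + P + .X)))),
      fun x q => ?_⟩, fun x q => ?_⟩
  · rw [Prog.time, el]
    simp only [Polynomial.eval_add, Polynomial.eval_one, Nat.cast_add, Nat.cast_one]
    refine add_le_add (add_le_add le_rfl (hPL x q)) (worst_map_le fun y hy => ?_)
    simp only [PMF.support_pure, Set.mem_singleton_iff] at hy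
    subst hy
    refine add_le_add (hPA x q) ?_
    rw [ea]
    refine worst_map_le fun y hy => ?_
    simp only [PMF.support_pure, Set.mem_singleton_iff] at hy
    subst hy
    -- The cost of one iteration. The 4 consists of 1 charged by the loop, 1 by the call and 2 by
    -- the nodes of `arg`; the input of `b` has size at most 2 plus the sizes of its three parts.
    set C : ℕ := 4 + ((L x).size + P.eval x.size + x.size) +
      PB.eval (2 + ((L x).size + P.eval x.size + x.size)) with hC
    refine (foldTime_le (C := C) (Inv x) (L x).toList 0 ?_ ?_ (A x) q (h0 x)).trans ?_
    · intro i e acc q hi he hacc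
      rw [zero_add] at hi
      have h1 := hP x i acc hi hacc
      have h2 := (size_lt_of_mem_toList he).le
      rw [Prog.time, earg]
      have h3 : worst (PMF.pure (Data.node e (Data.node acc x), q))
          (fun x _ => b.time [x] QMem.vac) ≤
          (PB.eval (2 + ((L x).size + P.eval x.size + x.size)) : ℕ) := by
        refine worst_le fun r hr => ?_
        simp only [PMF.support_pure, Set.mem_singleton_iff] at hr
        subst hr
        refine (hPB _ _).trans (Nat.cast_le.2 (polynomial_eval_mono _ ?_))
        simp only [Data.size]; omega
      have h4 : arg.time [e, acc, x] q ≤ (2 + ((L x).size + P.eval x.size + x.size) : ℕ) := by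
        have h5 : arg.time [e, acc, x] q ≤ 1 + (e.size : ℕ∞) + (1 + acc.size + x.size) := by
          simp only [harg, Prog.time, Prog.eval]
          refine add_le_add (add_le_add le_rfl (by simp)) (worst_le fun r _ => ?_)
          exact add_le_add (add_le_add le_rfl (by simp)) (worst_le fun r _ => by simp)
        refine h5.trans ?_
        norm_cast
        omega
      refine (add_le_add le_rfl (add_le_add (add_le_add le_rfl h4) h3)).trans ?_
      norm_cast
      omega
    · intro i e acc q hi he hacc r hr
      rw [ebody] at hr
      simp only [PMF.support_map, Set.mem_image] at hr
      obtain ⟨r, hr, rfl⟩ := hr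
      exact hs x i acc e (by simpa using hi) he hacc r hr
    · refine Nat.cast_le.2 ?_
      simp only [Polynomial.eval_add, Polynomial.eval_mul, Polynomial.eval_comp, Polynomial.eval_X,
        Polynomial.eval_ofNat]
      refine Nat.mul_le_mul ((length_toList_lt_size _).le.trans (hPL' x)) ?_
      rw [hC]
      have := hPL' x
      refine add_le_add (by omega) (polynomial_eval_mono _ (by omega))
  · simp only [Prog.eval, el, ea, PMF.pure_map, PMF.pure_bind]
    exact foldEval_eq_map_foldP (fun e acc q => ebody e acc x q) _ _ _

/-- Deterministic loops in which the size of the accumulator stays under control. -/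
theorem DEff.loop {L A : Data → Data} {B : Data → Data → Data → Data} (hL : DEff Φ L)
    (hA : DEff Φ A) (hB : DEff Φ fun y => B y.fst y.snd.fst y.snd.snd)
    (Inv : Data → ℕ → Data → Prop) (P : Polynomial ℕ) (h0 : ∀ x, Inv x 0 (A x))
    (hs : ∀ x j acc e, j < (L x).toList.length → e ∈ (L x).toList → Inv x j acc →
      Inv x (j + 1) (B e acc x))
    (hP : ∀ x j acc, j < (L x).toList.length → Inv x j acc → acc.size ≤ P.eval x.size) :
    DEff Φ fun x => (L x).toList.foldl (fun acc e => B e acc x) (A x) :=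
  (Eff.loop hL hA (B := fun e acc x => PMF.pure (B e acc x)) hB Inv P h0
    (fun x j acc e hj he hI r hr => by
      simp only [PMF.support_pure, Set.mem_singleton_iff] at hr
      subst hr; exact hs x j acc e hj he hI) hP).congr fun x => foldP_pure _ _ _

/-- Deterministic loops in which every step increases the size of the accumulator by an amount that
depends on the input only. -/
theorem DEff.loop_of_growth {L A : Data → Data} {B : Data → Data → Data → Data} (hL : DEff Φ L)
    (hA : DEff Φ A) (hB : DEff Φ fun y => B y.fst y.snd.fst y.snd.snd)
    (P : Polynomial ℕ) (hP : ∀ x acc e, e ∈ (L x).toList →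
      (B e acc x).size ≤ acc.size + P.eval x.size) :
    DEff Φ fun x => (L x).toList.foldl (fun acc e => B e acc x) (A x) := by
  obtain ⟨PL, hPL⟩ := hL.size_le
  obtain ⟨PA, hPA⟩ := hA.size_le
  refine DEff.loop hL hA hB (fun x j acc => acc.size ≤ PA.eval x.size + j * P.eval x.size)
    (PA + PL * P) (fun x => by simpa using hPA x) (fun x j acc e hj he hI => ?_)
    (fun x j acc hj hI => ?_)
  · have := hP x acc e he
    rw [add_mul, one_mul]; omega
  · simp only [Polynomial.eval_add, Polynomial.eval_mul]
    refine hI.trans (add_le_add le_rfl (Nat.mul_le_mul_right _ ?_))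
    exact (hj.le.trans (length_toList_lt_size _).le).trans (hPL x)

end closure

/-- Tossing a coin. -/
theorem Eff.flip : Eff Prog.Any fun _ => (PMF.uniformOfFintype Bool).map ofBool := by
  refine ⟨.flip, trivial, ⟨3, fun x q => ?_⟩, fun x q => ?_⟩
  · simp [Prog.time]
  · simp [Prog.eval, PMF.map_comp, Function.comp_def]

/-- Running an efficient program on a fresh quantum memory. -/
theorem Eff.run {Φ : Prog → Prop} [hΦ : Prog.Closed Φ] {f : Prog} (hf : Φ f) (h : f.PolyTime) :
    Eff Φ f.run := by
  obtain ⟨P, hP⟩ := h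
  refine ⟨.call f (.var 0), hΦ.call hf (hΦ.var 0), ⟨1 + .X + P, fun x q => ?_⟩, fun x q => ?_⟩
  · simp only [Prog.time, Prog.eval, Polynomial.eval_add, Polynomial.eval_one, Polynomial.eval_X,
      Nat.cast_add, Nat.cast_one]
    refine add_le_add (add_le_add le_rfl (by simp)) (worst_le fun r hr => ?_)
    simp only [PMF.support_pure, Set.mem_singleton_iff] at hr
    subst hr
    simpa using hP x QMem.vac
  · simp [Prog.eval, Prog.run, PMF.pure_bind, PMF.map_comp, Function.comp_def]

/-! ### Programs for lists and for numbers in unary -/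

namespace Data

/-- Prepend the reverse of a list. -/
def revAppend (a b : Data) : Data := a.toList.foldl (fun acc e => node e acc) b

/-- Drop as many components of `b` as `a` has. -/
def drop (a b : Data) : Data := a.toList.foldl (fun acc _ => snd acc) b

theorem toList_revAppend (a b : Data) : (revAppend a b).toList = a.toList.reverse ++ b.toList := by
  unfold revAppend
  generalize a.toList = l
  induction l generalizing b with
  | nil => simp
  | cons x xs ih => simp [ih]

theorem revAppend_eq (a b : Data) : revAppend a b = ofList (a.toList.reverse ++ b.toList) := by
  rw [← toList_revAppend, ofList_toList]

theorem toList_snd (d : Data) : d.snd.toList = d.toList.tail := by cases d <;> rfl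

theorem toList_drop (a b : Data) : (drop a b).toList = b.toList.drop a.toList.length := by
  unfold drop
  generalize a.toList = l
  induction l generalizing b with
  | nil => simp
  | cons x xs ih => simp [ih, toList_snd, ← List.drop_one, Nat.add_comm]

theorem fst_drop (a b : Data) : (drop a b).fst = b.get a.toList.length := by
  rw [← get_zero, get, get, toList_drop]
  simp [List.getD_eq_getElem?_getD]

theorem foldl_const_unary {α : Type*} (l : List α) (m : ℕ) :
    l.foldl (fun acc _ => node nil acc) (unary m) = unary (m + l.length) := by
  induction l generalizing m with
  | nil => simp
  | cons x xs ih => simp only [List.foldl_cons, ← unary_succ, ih, List.length_cons]; congr 1; ring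

end Data

section

variable {Φ : Prog → Prop} [hΦ : Prog.Closed Φ]

theorem DEff.revAppend {f g : Data → Data} (hf : DEff Φ f) (hg : DEff Φ g) :
    DEff Φ fun x => Data.revAppend (f x) (g x) := by
  obtain ⟨P, hP⟩ := hf.size_le
  refine DEff.loop_of_growth hf hg (B := fun e acc _ => Data.node e acc)
    (DEff.node (.fst .id) (.fst (.snd .id))) (P + 1) fun x acc e he => ?_
  have := (size_lt_of_mem_toList he).le.trans (hP x)
  simp only [Data.size, Polynomial.eval_add, Polynomial.eval_one]
  omega

theorem DEff.drop {f g : Data → Data} (hf : DEff Φ f) (hg : DEff Φ g) :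
    DEff Φ fun x => Data.drop (f x) (g x) :=
  DEff.loop_of_growth hf hg (B := fun _ acc _ => acc.snd) (.snd (.fst (.snd .id))) 0
    fun x acc e _ => by simpa using size_snd_le acc

theorem DEff.unaryLength {f : Data → Data} (hf : DEff Φ f) :
    DEff Φ fun x => unary (f x).toList.length :=
  (DEff.loop_of_growth hf .nil (B := fun _ acc _ => Data.node .nil acc)
    (.node .nil (.fst (.snd .id))) 2 fun x acc e _ => by simp [Data.size]; omega).congr fun x => by
      simpa using foldl_const_unary (f x).toList 0

theorem DEff.get {f g : Data → Data} (hf : DEff Φ f) (hg : DEff Φ g) :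
    DEff Φ fun x => (g x).get (f x).toList.length :=
  (DEff.fst (DEff.drop hf hg)).congr fun _ => fst_drop _ _

theorem DEff.unary_const (m : ℕ) : DEff Φ fun _ => unary m := by
  induction m with
  | zero => exact .nil
  | succ m ih => exact .node .nil ih

theorem DEff.unary_add {a b : Data → ℕ} (ha : DEff Φ fun x => unary (a x))
    (hb : DEff Φ fun x => unary (b x)) : DEff Φ fun x => unary (a x + b x) :=
  (DEff.revAppend ha hb).congr fun x => by
    rw [revAppend_eq]; simp [unary]

theorem DEff.unary_mul {a b : Data → ℕ} (ha : DEff Φ fun x => unary (a x))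
    (hb : DEff Φ fun x => unary (b x)) : DEff Φ fun x => unary (a x * b x) := by
  obtain ⟨Pa, hPa⟩ := ha.size_le
  obtain ⟨Pb, hPb⟩ := hb.size_le
  refine (DEff.loop (L := fun x => unary (a x)) (A := fun _ => Data.nil)
    (B := fun _ acc x => Data.revAppend (unary (b x)) acc)
    ha .nil
    (.revAppend (DEff.comp hb (.snd (.snd .id))) (.fst (.snd .id)))
    (fun x j acc => acc = unary (j * b x)) (2 * (Pa * Pb) + 1) (fun x => by simp)
    (fun x j acc e _ _ hI => ?_) (fun x j acc hj hI => ?_)).congr fun x => ?_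
  · subst hI
    rw [revAppend_eq, add_mul, one_mul]; simp [unary, add_comm]
  · subst hI
    have h1 := hPa x
    have h2 := hPb x
    simp only [toList_unary, List.length_replicate, size_unary] at hj h1 h2
    rw [size_unary]
    simp only [Polynomial.eval_add, Polynomial.eval_mul, Polynomial.eval_ofNat,
      Polynomial.eval_one]
    have : j * b x ≤ Pa.eval x.size * Pb.eval x.size := Nat.mul_le_mul (by omega) (by omega)
    omega
  · have : ∀ (l : List Data) (m : ℕ), l.foldl (fun acc _ => Data.revAppend (unary (b x)) acc)
        (unary m) = unary (m + l.length * b x) := by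
      intro l
      induction l with
      | nil => simp
      | cons y ys ih =>
        intro m
        have h : Data.revAppend (unary (b x)) (unary m) = unary (m + b x) := by
          rw [revAppend_eq]; simp [unary, add_comm]
        rw [List.foldl_cons, h, ih, List.length_cons]; congr 1; ring
    simpa using this (unary (a x)).toList 0

theorem DEff.unary_pow {a : Data → ℕ} (ha : DEff Φ fun x => unary (a x)) (e : ℕ) :
    DEff Φ fun x => unary (a x ^ e) := by
  induction e with
  | zero => simpa using DEff.unary_const (Φ := Φ) 1
  | succ e ih => simpa only [pow_succ] using DEff.unary_mul ih ha

/-- Whether all components of a list are `≠ nil`. -/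
theorem DEff.all {f : Data → Data} (hf : DEff Φ f) :
    DEff Φ fun x => ofBool ((f x).toList.all fun d => decide (d ≠ Data.nil)) := by
  refine (DEff.loop (L := f) (A := fun _ => Data.node .nil .nil)
    (B := fun e acc _ => if e ≠ Data.nil then acc else Data.nil) hf (.node .nil .nil)
    (.ite (.fst .id) (.fst (.snd .id)) .nil) (fun _ _ acc => acc.size ≤ 3) 3
    (fun x => by simp [Data.size]) (fun x j acc e _ _ hI => ?_)
    (fun x j acc _ hI => by simpa using hI)).congr fun x => ?_
  · split_ifs
    · exact hI
    · simp [Data.size]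
  · have : ∀ (l : List Data) (b : Bool),
        l.foldl (fun acc e => if e ≠ Data.nil then acc else Data.nil) (ofBool b) =
          ofBool (b && l.all fun d => decide (d ≠ Data.nil)) := by
      intro l
      induction l with
      | nil => simp
      | cons y ys ih =>
        intro b
        rw [List.foldl_cons]
        split_ifs with h
        · rw [ih]; simp [h]
        · have h2 := ih false
          simp only [ofBool, Bool.false_and] at h2
          rw [h2]; simp at h; simp [h, ofBool]
    simpa [ofBool] using this (f x).toList true

theorem sampleList_length {α : Type} (μs : List (PMF α)) :
    ∀ l ∈ (sampleList μs).support, l.length = μs.length := by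
  induction μs with
  | nil => intro l hl; simp [sampleList] at hl; simp [hl]
  | cons μ μs ih =>
    intro l hl
    simp only [sampleList, PMF.support_bind, PMF.support_map, Set.mem_iUnion, Set.mem_image] at hl
    obtain ⟨x, -, xs, hxs, rfl⟩ := hl
    simp [ih xs hxs]

/-- A loop body does not see its index, so the length of the accumulator serves as the counter. The
samples pile up in reverse order. -/
theorem foldP_collect (F : ℕ → PMF Data) (l : List Data) : ∀ acc : List Data,
    foldP (fun _ acc => (F acc.toList.length).map fun a => Data.node a acc) l (ofList acc) =
      (sampleList ((List.range' acc.length l.length).map F)).map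
        fun r => ofList (r.reverse ++ acc) := by
  induction l with
  | nil => intro acc; simp [foldP, sampleList, PMF.pure_map]
  | cons x xs ih =>
    intro acc
    simp only [foldP, toList_ofList, PMF.bind_map, List.length_cons, List.range'_succ,
      List.map_cons, sampleList, PMF.map_bind, PMF.map_comp, Function.comp_def]
    congr 1
    ext1 a
    rw [← ofList_cons, ih]
    simp

/-- Independent samples for all indices below the length of a list. -/
theorem Eff.collect {L : Data → Data} {F : Data → Data → PMF Data} (hL : DEff Φ L)
    (hF : Eff Φ fun y => F y.fst y.snd) :
    Eff Φ fun x => (sampleList ((List.range (L x).toList.length).map fun i =>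
      F (unary i) x)).map ofList := by
  obtain ⟨PL, hPL⟩ := hL.size_le
  obtain ⟨PF, hPF⟩ := hF.size_le
  have h := Eff.loop (Φ := Φ) (L := L) (A := fun _ => Data.nil)
    (B := fun _ acc x => (F (unary acc.toList.length) x).map fun a => Data.node a acc) hL .nil
    (Eff.map (F := fun y => F (unary y.snd.fst.toList.length) y.snd.snd)
      (g := fun a y => Data.node a y.snd.fst)
      (Eff.comp_det hF (g := fun y => Data.node (unary y.snd.fst.toList.length) y.snd.snd)
        (.node (.unaryLength (.fst (.snd .id))) (.snd (.snd .id))))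
      (.node (.fst .id) (.fst (.snd (.snd .id)))))
    (fun x j acc => acc.toList.length = j ∧
      acc.size ≤ 1 + j * (1 + PF.eval (2 + 2 * (L x).size + x.size)))
    (1 + PL * (1 + PF.comp (2 + 2 * PL + .X)))
    (fun x => by simp [Data.size]) (fun x j acc e hj _ hI r hr => ?_) (fun x j acc hj hI => ?_)
  · refine (Eff.comp_det (DEff.revAppend DEff.id DEff.nil) .id |> fun h' =>
      Eff.comp h' h).congr fun x => ?_
    have h2 := foldP_collect (fun i => F (unary i) x) (L x).toList []
    simp only [ofList_nil, List.append_nil, List.length_nil] at h2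
    rw [h2, List.range_eq_range', PMF.bind_map]
    simp [revAppend_eq, Function.comp_def, PMF.map]
  · simp only [PMF.support_map, Set.mem_image] at hr
    obtain ⟨a, ha, rfl⟩ := hr
    obtain ⟨rfl, hI⟩ := hI
    refine ⟨by simp, ?_⟩
    have h1 := hPF (Data.node (unary acc.toList.length) x) a (by simpa using ha)
    have h2 : PF.eval (Data.node (unary acc.toList.length) x).size ≤
        PF.eval (2 + 2 * (L x).size + x.size) := by
      refine polynomial_eval_mono _ ?_
      have := length_toList_lt_size (L x)
      simp only [Data.size, size_unary]; omega
    simp only [Data.size]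
    rw [add_mul, one_mul]; omega
  · refine hI.2.trans ?_
    simp only [Polynomial.eval_add, Polynomial.eval_one, Polynomial.eval_mul, Polynomial.eval_comp,
      Polynomial.eval_ofNat, Polynomial.eval_X]
    have h1 := hPL x
    have h2 := length_toList_lt_size (L x)
    refine add_le_add le_rfl (Nat.mul_le_mul (by omega) (add_le_add le_rfl
      (polynomial_eval_mono _ (by omega))))

theorem sampleList_map_pure {α ι : Type} (g : ι → α) (l : List ι) :
    sampleList (l.map fun i => PMF.pure (g i)) = PMF.pure (l.map g) := by
  induction l with
  | nil => rfl
  | cons i l ih => simp [sampleList, ih, PMF.pure_bind, PMF.pure_map]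

theorem DEff.collect {L : Data → Data} {F : Data → Data → Data} (hL : DEff Φ L)
    (hF : DEff Φ fun y => F y.fst y.snd) :
    DEff Φ fun x => ofList ((List.range (L x).toList.length).map fun i => F (unary i) x) :=
  (Eff.collect (F := fun i x => PMF.pure (F i x)) hL hF).congr fun x => by
    rw [sampleList_map_pure, PMF.pure_map]

theorem map_range_getD {α : Type} (d : Data) (g : Data → α) :
    (List.range d.toList.length).map (fun i => g (d.get i)) = d.toList.map g := by
  apply List.ext_getElem
  · simp
  · intro i h1 h2
    simp only [List.length_map] at h2
    simp [Data.get, List.getD_eq_getElem?_getD, h2]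

/-- Applying a function to all components of a list. -/
theorem DEff.mapList {f g : Data → Data} (hg : DEff Φ g) (hf : DEff Φ f) :
    DEff Φ fun x => ofList ((f x).toList.map g) :=
  (DEff.collect (L := f) (F := fun i x => g ((f x).get i.toList.length)) hf
    (DEff.comp hg (.get (.fst .id) (DEff.comp hf (.snd .id))))).congr fun x => by
      rw [← map_range_getD]; simp

end

/-! ### Running a quantum program on separate parts of the memory -/

namespace QMem

/-- Replace the parts of the memory labelled `1^j, 1^(j+1), …`. -/
def setBanks (q : QMem) : ℕ → List QMem → QMem
  | _, [] => q
  | j, r :: rs => setBanks (q.setBank (unary j) r) (j + 1) rs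

theorem bank_setBank_of_ne (q r : QMem) {d e : Data} (h : e ≠ d) :
    (q.setBank d r).bank e = q.bank e := by
  funext π; simp [bank, setBank, h]

theorem setBanks_nil (rs : List QMem) : ∀ (q : QMem) (j : ℕ), setBanks q j rs [] = q [] := by
  induction rs with
  | nil => intro q j; rfl
  | cons r rs ih => intro q j; rw [setBanks, ih]; rfl

theorem setBanks_cons_of_lt (rs : List QMem) : ∀ (q : QMem) (j i : ℕ) (π : List Data), i < j →
    setBanks q j rs (unary i :: π) = q (unary i :: π) := by
  induction rs with
  | nil => intro q j i π _; rfl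
  | cons r rs ih =>
    intro q j i π hi
    rw [setBanks, ih _ _ _ _ (by omega)]
    have : unary i ≠ unary j := fun h => by have := unary_injective h; omega
    simp [setBank, this]

theorem setBanks_cons_of_ne (rs : List QMem) (d : Data) (hd : ∀ i, d ≠ unary i) :
    ∀ (q : QMem) (j : ℕ) (π : List Data), setBanks q j rs (d :: π) = q (d :: π) := by
  induction rs with
  | nil => intro q j π; rfl
  | cons r rs ih => intro q j π; rw [setBanks, ih]; simp [setBank, hd]

theorem setBanks_cons_add (rs : List QMem) : ∀ (q : QMem) (j i : ℕ) (π : List Data),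
    setBanks q j rs (unary (j + i) :: π) = rs.getD i (q.bank (unary (j + i))) π := by
  induction rs with
  | nil => intro q j i π; simp [setBanks, bank]
  | cons r rs ih =>
    intro q j i π
    rw [setBanks]
    cases i with
    | zero =>
      rw [setBanks_cons_of_lt _ _ _ _ _ (by omega)]
      simp [setBank]
    | succ i =>
      rw [show j + (i + 1) = j + 1 + i by ring, ih, bank_setBank_of_ne]
      · simp
      · intro h; have := unary_injective h; omega

/-- Starting from the all-zero memory, the obligation algorithm run part by part leaves exactly the
product state that the repeated puzzle prescribes. -/
theorem setBanks_vac (rs : List QMem) : setBanks vac 0 rs = tensor rs := by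
  funext π
  cases π with
  | nil => rw [setBanks_nil]; rfl
  | cons d π =>
    rw [tensor]
    split_ifs with h
    · have := setBanks_cons_add rs vac 0 d.toList.length π
      rw [zero_add, ← h] at this
      rw [this]; rfl
    · rw [setBanks_cons_of_ne rs d]
      · rfl
      · intro i hi; apply h; rw [hi]; simp

theorem bank_tensor (rs : List QMem) (i : ℕ) : (tensor rs).bank (unary i) = rs.getD i vac := by
  funext π; simp [bank, tensor]

end QMem

/-- An iteration touches only the part labelled by its own index, so later iterations still find the
initial content of theirs, and the loop factors into independent samples. -/
theorem foldEval_banks {body : Data → Data → QMem → PMF (Data × QMem)}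
    (K : ℕ → QMem → PMF (Data × QMem))
    (h : ∀ x acc q, body x acc q = (K acc.toList.length (q.bank (unary acc.toList.length))).map
      fun u => (Data.node u.1 acc, q.setBank (unary acc.toList.length) u.2)) (l : List Data) :
    ∀ (acc : List Data) (q : QMem), foldEval body l (ofList acc) q =
      (sampleList ((List.range' acc.length l.length).map fun i => K i (q.bank (unary i)))).map
        fun r => (ofList ((r.map Prod.fst).reverse ++ acc),
          q.setBanks acc.length (r.map Prod.snd)) := by
  induction l with
  | nil => intro acc q; simp [foldEval, sampleList, PMF.pure_map, QMem.setBanks]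
  | cons x xs ih =>
    intro acc q
    simp only [foldEval, h, toList_ofList, PMF.bind_map, List.length_cons, List.range'_succ,
      List.map_cons, sampleList, PMF.map_bind, PMF.map_comp, Function.comp_def]
    congr 1
    ext1 u
    rw [← ofList_cons, ih]
    simp only [List.length_cons, List.reverse_cons, List.append_assoc, List.cons_append,
      List.nil_append, QMem.setBanks]
    congr 2
    refine List.map_congr_left fun i hi => ?_
    rw [QMem.bank_setBank_of_ne]
    intro h'
    have := unary_injective h'
    simp only [List.mem_range'_1] at hi
    omega

/-- Running a quantum program on the parts `1^0, 1^1, …` of the memory. -/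
theorem exists_prog_banks {L : Data → PMF Data} {A : Data → Data → Data} {f : Prog}
    (hL : Eff Prog.Any L) (hA : DEff Prog.Any fun y => A y.fst y.snd) (hf : f.PolyTime) :
    ∃ g : Prog, g.PolyTime ∧ ∀ x q, g.eval [x] q = (L x).bind fun l =>
      (sampleList ((List.range l.toList.length).map fun i =>
        f.eval [A (unary i) x] (q.bank (unary i)))).map fun r =>
          (ofList (r.map Prod.fst), q.setBanks 0 (r.map Prod.snd)) := by
  obtain ⟨PL', hPL'⟩ := hL.size_le
  obtain ⟨PA', hPA'⟩ := hA.size_le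
  have hA' : DEff Prog.Any fun y => A (unary y.fst.toList.length) y.snd :=
    (DEff.comp hA (DEff.node (.unaryLength (.fst .id)) (.snd .id)) :)
  obtain ⟨l, -, ⟨PL, hPL⟩, el⟩ := hL
  obtain ⟨a, -, ⟨PA, hPA⟩, ea⟩ := hA'
  obtain ⟨d, -, ⟨PD, hPD⟩, ed⟩ :=
    (DEff.unaryLength (.fst .id) : DEff Prog.Any fun y => unary y.fst.toList.length)
  obtain ⟨v, -, ⟨PV, hPV⟩, ev⟩ := (DEff.revAppend .id .nil :
    DEff Prog.Any fun y => Data.revAppend y Data.nil)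
  obtain ⟨Pf, hPf⟩ := hf
  set arg : Prog := .node (.var 1) (.var 2) with harg
  -- The index is the length of the accumulator (variable 1): `d` turns it into the label, `a` into
  -- the argument, and the value of `f` is prepended.
  set body : Prog := .node (.callIn (.call d arg) f (.call a arg)) (.var 1) with hbody
  have earg : ∀ e acc x q, arg.eval [e, acc, x] q = PMF.pure (Data.node acc x, q) := by
    intro e acc x q; simp [harg, Prog.eval, PMF.pure_bind, PMF.pure_map]
  have ebody : ∀ e acc x q, body.eval [e, acc, x] q =
      (f.eval [A (unary acc.toList.length) x] (q.bank (unary acc.toList.length))).map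
        fun u => (Data.node u.1 acc, q.setBank (unary acc.toList.length) u.2) := by
    intro e acc x q
    simp [hbody, Prog.eval, earg, ea, ed, PMF.pure_bind, PMF.map, Function.comp_def]
  have efold : ∀ x q, (Prog.fold l .nil body).eval [x] q = (L x).bind fun l =>
      (sampleList ((List.range l.toList.length).map fun i =>
        f.eval [A (unary i) x] (q.bank (unary i)))).map fun r =>
          (ofList (r.map Prod.fst).reverse, q.setBanks 0 (r.map Prod.snd)) := by
    intro x q
    simp only [Prog.eval, el, PMF.bind_map, PMF.pure_bind, Function.comp_def]
    congr 1
    ext1 y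
    have := foldEval_banks (body := fun e acc q' => body.eval [e, acc, x] q')
      (fun i q' => f.eval [A (unary i) x] q') (fun e acc q => ebody e acc x q) y.toList [] q
    simpa [List.range_eq_range'] using this
  have harg_time : ∀ e acc x q, arg.time [e, acc, x] q ≤ (1 + acc.size + x.size : ℕ) := by
    intro e acc x q
    simp only [harg, Prog.time, Prog.eval, Nat.cast_add, Nat.cast_one]
    exact add_le_add (add_le_add le_rfl (by simp)) (worst_le fun r _ => by simp)
  have hcall_time : ∀ (c : Prog) (P : Polynomial ℕ),
      (∀ x q, c.time [x] q ≤ (P.eval x.size : ℕ)) → ∀ e acc x q,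
      (Prog.call c arg).time [e, acc, x] q ≤
        (1 + (1 + acc.size + x.size) + P.eval (1 + acc.size + x.size) : ℕ) := by
    intro c P hP e acc x q
    rw [Prog.time, earg]
    push_cast
    refine add_le_add (add_le_add le_rfl ?_) (worst_le fun r hr => ?_)
    · exact_mod_cast harg_time e acc x q
    · simp only [PMF.support_pure, Set.mem_singleton_iff] at hr
      subst hr
      simpa [Data.size] using hP (Data.node acc x) QMem.vac
  have hsize : ∀ (y x : Data) i, i < y.toList.length →
      (A (unary i) x).size ≤ PA'.eval (2 + 2 * y.size + x.size) := by
    intro y x i hi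
    refine (hPA' (Data.node (unary i) x)).trans (polynomial_eval_mono _ ?_)
    have := length_toList_lt_size y
    simp only [Data.size, size_unary]; omega
  -- the size of the accumulator, and the time of one step
  set PF : Polynomial ℕ := Pf.comp (PA'.comp (2 + 2 * PL' + .X)) with hPF
  set PS : Polynomial ℕ := 1 + PL' * (1 + PF) with hPS
  set PC : Polynomial ℕ := 5 + 2 * (1 + PS + .X) + PD.comp (1 + PS + .X) +
    PA.comp (1 + PS + .X) + PF + PS with hPC
  have hfold_time : ∀ x q, (Prog.fold l .nil body).time [x] q ≤
      ((2 + PL + PL' * PC).eval x.size : ℕ) := by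
    intro x q
    rw [Prog.time, el]
    simp only [Polynomial.eval_add, Polynomial.eval_ofNat, Nat.cast_add, Nat.cast_ofNat]
    rw [show (2 : ℕ∞) + (PL.eval x.size : ℕ) + ((PL' * PC).eval x.size : ℕ) =
      1 + (PL.eval x.size : ℕ) + (1 + ((PL' * PC).eval x.size : ℕ)) by
        rw [← one_add_one_eq_two]; ring]
    refine add_le_add (add_le_add le_rfl (hPL x q)) (worst_map_le fun y hy => ?_)
    refine add_le_add (by simp [Prog.time]) (worst_le fun r hr => ?_)
    simp only [Prog.eval, PMF.support_pure, Set.mem_singleton_iff] at hr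
    subst hr
    have hy' := hPL' x y hy
    have hylen := length_toList_lt_size y
    have hfi : ∀ i < y.toList.length, Pf.eval (A (unary i) x).size ≤ PF.eval x.size := by
      intro i hi
      refine (polynomial_eval_mono Pf (hsize y x i hi)).trans ?_
      simp only [hPF, Polynomial.eval_comp, Polynomial.eval_add, Polynomial.eval_mul,
        Polynomial.eval_ofNat, Polynomial.eval_X]
      exact polynomial_eval_mono _ (polynomial_eval_mono _ (by omega))
    refine (foldTime_le (C := PC.eval x.size) (fun j acc => acc.toList.length = j ∧
      acc.size ≤ 1 + j * (1 + PF.eval x.size)) y.toList 0 ?_ ?_ _ _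
      (by simp [Data.size])).trans ?_
    · rintro i e acc q hi he ⟨rfl, hacc⟩
      rw [zero_add] at hi
      have hacc' : acc.size ≤ PS.eval x.size := by
        refine hacc.trans ?_
        simp only [hPS, Polynomial.eval_add, Polynomial.eval_mul, Polynomial.eval_one]
        exact add_le_add le_rfl (Nat.mul_le_mul_right _ (by omega))
      have h1 : (1 + acc.size + x.size) ≤ (1 + PS + .X : Polynomial ℕ).eval x.size := by
        simp only [Polynomial.eval_add, Polynomial.eval_X, Polynomial.eval_one]; omega
      have hd := hcall_time d PD hPD e acc x q
      have ha := hcall_time a PA hPA e acc x q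
      have hcallIn : (Prog.callIn (.call d arg) f (.call a arg)).time [e, acc, x] q ≤
          1 + (1 + (1 + acc.size + x.size) + PD.eval (1 + acc.size + x.size) : ℕ) +
          ((1 + (1 + acc.size + x.size) + PA.eval (1 + acc.size + x.size) : ℕ) +
            (PF.eval x.size : ℕ)) := by
        rw [Prog.time]
        refine add_le_add (add_le_add le_rfl hd) (worst_le fun r hr => ?_)
        have hr2 : r.2 = q := by
          simp only [Prog.eval, earg, ed, PMF.pure_bind, PMF.pure_map, PMF.support_pure,
            Set.mem_singleton_iff] at hr
          rw [hr]
        rw [hr2]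
        refine add_le_add ha (worst_le fun s hs => ?_)
        have hs1 : s.1 = A (unary acc.toList.length) x := by
          simp only [Prog.eval, earg, ea, PMF.pure_bind, PMF.pure_map, PMF.support_pure,
            Set.mem_singleton_iff] at hs
          rw [hs]; simp
        rw [hs1]
        exact (hPf _ _).trans (Nat.cast_le.2 (hfi _ hi))
      have hb : body.time [e, acc, x] q ≤ 1 +
          (1 + (1 + (1 + acc.size + x.size) + PD.eval (1 + acc.size + x.size) : ℕ) +
          ((1 + (1 + acc.size + x.size) + PA.eval (1 + acc.size + x.size) : ℕ) +
            (PF.eval x.size : ℕ))) + acc.size := by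
        rw [hbody, Prog.time]
        exact add_le_add (add_le_add le_rfl hcallIn) (worst_le fun r _ => by simp [Prog.time])
      refine (add_le_add le_rfl hb).trans ?_
      norm_cast
      have h2 := polynomial_eval_mono PD h1
      have h3 := polynomial_eval_mono PA h1
      simp only [hPC, Polynomial.eval_add, Polynomial.eval_mul, Polynomial.eval_comp,
        Polynomial.eval_ofNat, Polynomial.eval_X, Polynomial.eval_one] at h1 h2 h3 ⊢
      omega
    · rintro i e acc q hi he ⟨rfl, hacc⟩ r hr
      rw [ebody] at hr
      simp only [PMF.support_map, Set.mem_image] at hr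
      obtain ⟨u, hu, rfl⟩ := hr
      refine ⟨by simp, ?_⟩
      have h1 := (f.size_le_time _ _ _ hu).trans (hPf _ _)
      have h2 := hfi acc.toList.length (by simpa using hi)
      have h3 : u.1.size ≤ PF.eval x.size := by
        rw [Nat.cast_le] at h1
        exact h1.trans h2
      simp only [Data.size]
      rw [add_mul, one_mul]; omega
    · refine Nat.cast_le.2 ?_
      rw [Polynomial.eval_mul]
      exact Nat.mul_le_mul_right _ (by omega)
  -- The outputs were collected in reverse, and `v` restores the order. `call` uses a private
  -- memory, so the states left in the parts survive.
  refine ⟨.call v (.fold l .nil body), ⟨1 + (2 + PL + PL' * PC) +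
    PV.comp (2 + PL + PL' * PC), fun x q => ?_⟩, fun x q => ?_⟩
  · rw [Prog.time, Polynomial.eval_add, Polynomial.eval_add, Polynomial.eval_one,
      Polynomial.eval_comp]
    push_cast
    refine add_le_add (add_le_add le_rfl (hfold_time x q)) (worst_le fun r hr => ?_)
    refine (hPV _ _).trans (Nat.cast_le.2 (polynomial_eval_mono _ ?_))
    exact_mod_cast (Prog.size_le_time _ _ _ _ hr).trans (hfold_time x q)
  · rw [Prog.eval, efold]
    simp only [ev, PMF.bind_bind, PMF.bind_map, PMF.pure_map]
    congr 1
    ext1 y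
    simp [revAppend_eq, PMF.map, Function.comp_def]

/-! ### The repeated puzzle is a puzzle -/

theorem sampleList_map_map {α β : Type} (g : α → β) (μs : List (PMF α)) :
    sampleList (μs.map fun μ => μ.map g) = (sampleList μs).map (List.map g) := by
  induction μs with
  | nil => simp [sampleList, PMF.pure_map]
  | cons μ μs ih =>
    simp [sampleList, ih, PMF.bind_map, PMF.map_bind, PMF.map_comp, Function.comp_def]

theorem Eff.exists_run {Φ : Prog → Prop} {F : Data → PMF Data} (h : Eff Φ F) :
    ∃ f : Prog, Φ f ∧ f.PolyTime ∧ ∀ x, f.run x = F x := by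
  obtain ⟨f, hf, hP, ef⟩ := h
  exact ⟨f, hf, hP, fun x => by simp [Prog.run, ef, PMF.map_comp, Function.comp_def]; exact PMF.map_id _⟩

/-- All four programs obtain n(k) from `fn` and loop over it. The class of programs matters: the one
for `G` must stay classical and the one for `V` also free of coins, whereas `O` and `S` need the
separate parts of the quantum memory. -/
theorem Puzzle.IsOneOfTwoPuzzle.rep {Z : Puzzle} (hZ : Z.IsOneOfTwoPuzzle) {n : ℕ → ℕ}
    (hn : PolyTimeComputable n) : (Z.rep n).IsOneOfTwoPuzzle := by
  obtain ⟨fn, hn1, hn2, hn3, hn4⟩ := hn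
  have hnA : Eff Prog.Any fn.run := Eff.run trivial hn3
  refine ⟨?_, ?_, ?_, ?_⟩
  · obtain ⟨f, hf1, hf2, hf3⟩ := hZ.effG
    have hnC : Eff Prog.Classical fn.run := Eff.run hn1 hn3
    have hfC : Eff Prog.Classical f.run := Eff.run hf1 hf2
    have h : Eff Prog.Classical fun x => (fn.run x).bind fun m =>
        ((sampleList ((List.range m.toList.length).map fun _ => f.run x)).map ofList).map fun l =>
          ofList [ofList (l.toList.map Data.fst), ofList (l.toList.map fun d => d.snd.fst)] := by
      refine Eff.bind hnC ?_
      refine Eff.map (g := fun l _ => ofList [ofList (l.toList.map Data.fst),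
          ofList (l.toList.map fun d => d.snd.fst)])
        (Eff.collect (F := fun _ y => f.run y.snd) (.fst .id)
          (Eff.comp_det hfC (.snd (.snd .id)))) ?_
      exact .node (.mapList (.fst .id) (.fst .id))
        (.node (.mapList (.fst (.snd .id)) (.fst .id)) .nil)
    obtain ⟨g, hg1, hg2, hg3⟩ := h.exists_run
    refine ⟨g, hg1, hg2, fun k => ?_⟩
    rw [hg3, hn4, PMF.pure_bind]
    simp only [hf3, toList_unary, List.length_replicate, List.map_const', List.length_range]
    have := sampleList_map_map (fun pv : Data × Data => ofList [pv.1, pv.2])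
      (List.replicate (n k) (Z.G k))
    rw [List.map_replicate] at this
    rw [this]
    simp [Puzzle.rep, PMF.map_comp, Function.comp_def]
  · obtain ⟨f, hf1, hf2⟩ := hZ.effO
    obtain ⟨g, hg1, hg2⟩ := exists_prog_banks (L := fun x => fn.run x.fst)
      (A := fun i x => ofList [x.fst, x.snd.fst.get i.toList.length])
      (Eff.comp_det hnA (.fst .id))
      (.node (.fst (.snd .id)) (.node (.get (.fst .id) (.fst (.snd (.snd .id)))) .nil)) hf1
    refine ⟨g, hg1, fun k p => ?_⟩
    rw [hg2]
    simp only [ofList_cons, fst_node, snd_node, hn4, PMF.pure_bind, ofList_nil, toList_unary,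
      List.length_replicate]
    have : ∀ d, QMem.vac.bank d = QMem.vac := fun _ => rfl
    simp only [this, QMem.setBanks_vac, Puzzle.rep, ← hf2, ofList_cons, ofList_nil]
  · obtain ⟨f, hf1, hf2⟩ := hZ.effS
    obtain ⟨g, hg1, hg2⟩ := exists_prog_banks (L := fun x => fn.run x.fst)
      (A := fun i x => ofList [x.fst, x.snd.fst.get i.toList.length,
        x.snd.snd.fst.get i.toList.length, x.snd.snd.snd.fst])
      (Eff.comp_det hnA (.fst .id))
      (.node (.fst (.snd .id)) (.node (.get (.fst .id) (.fst (.snd (.snd .id))))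
        (.node (.get (.fst .id) (.fst (.snd (.snd (.snd .id)))))
          (.node (.fst (.snd (.snd (.snd (.snd .id))))) .nil)))) hf1
    refine ⟨g, hg1, fun k p o ρ b => ?_⟩
    rw [hg2]
    simp only [ofList_cons, fst_node, snd_node, hn4, PMF.pure_bind, ofList_nil, toList_unary,
      List.length_replicate, PMF.map_comp, Function.comp_def]
    simp only [Puzzle.rep, ← hf2, ofList_cons, ofList_nil]
    have := sampleList_map_map (Prod.fst : Data × QMem → Data) ((List.range (n k)).map fun i =>
      f.eval [(unary k).node ((p.get i).node ((o.get i).node ((ofBool b).node nil)))]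
        (ρ.bank (unary i)))
    rw [List.map_map] at this
    simp only [Function.comp_def] at this
    rw [this, PMF.map_comp]
    rfl
  · obtain ⟨f, hf1, hf2, hf3, hf4⟩ := hZ.effV
    have hnD : Eff Prog.Deterministic fn.run := Eff.run ⟨hn1, hn2⟩ hn3
    have hfD : Eff Prog.Deterministic f.run := Eff.run ⟨hf1, hf2⟩ hf3
    have h : Eff Prog.Deterministic fun x => (fn.run x.fst).bind fun m =>
        ((sampleList ((List.range m.toList.length).map fun i =>
          f.run (ofList [x.fst, x.snd.fst.get i, x.snd.snd.fst.get i, x.snd.snd.snd.fst.get i,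
            x.snd.snd.snd.snd.fst, x.snd.snd.snd.snd.snd.fst.get i]))).map ofList).map fun l =>
          ofBool (l.toList.all fun d => decide (d ≠ Data.nil)) := by
      refine Eff.bind (Eff.comp_det hnD (.fst .id)) ?_
      have hx : DEff Prog.Deterministic fun y => y.snd.snd := .snd (.snd .id)
      have hi : DEff Prog.Deterministic fun y => y.fst := .fst .id
      refine Eff.map (g := fun l _ => ofBool (l.toList.all fun d => decide (d ≠ Data.nil)))
        ((Eff.collect (F := fun i y => f.run (ofList [y.snd.fst, y.snd.snd.fst.get i.toList.length,
            y.snd.snd.snd.fst.get i.toList.length, y.snd.snd.snd.snd.fst.get i.toList.length,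
            y.snd.snd.snd.snd.snd.fst, y.snd.snd.snd.snd.snd.snd.fst.get i.toList.length]))
          (.fst .id) (Eff.comp_det hfD ?_)).congr fun x => by simp)
        (.all (.fst .id))
      exact .node (.fst hx) (.node (.get hi (.fst (.snd hx))) (.node (.get hi (.fst (.snd (.snd hx))))
        (.node (.get hi (.fst (.snd (.snd (.snd hx))))) (.node (.fst (.snd (.snd (.snd (.snd hx)))))
          (.node (.get hi (.fst (.snd (.snd (.snd (.snd (.snd hx))))))) .nil)))))
    obtain ⟨g, hg1, hg2, hg3⟩ := h.exists_run
    refine ⟨g, hg1.1, hg1.2, hg2, fun k p v o b a => ?_⟩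
    rw [hg3]
    simp only [ofList_cons, fst_node, snd_node, hn4, PMF.pure_bind, ofList_nil, toList_unary,
      List.length_replicate]
    simp only [ofList_cons, ofList_nil] at hf4
    simp only [hf4, sampleList_map_pure, PMF.pure_map]
    congr 2
    rw [Bool.eq_iff_iff]
    simp [Puzzle.rep]

/-! ### Completeness -/

/-- Independence: the expectation of a product is the product of the expectations. The default `d`
is never read on the support, as all indices are in range. -/
theorem expect_sampleList_prod {α : Type} (d : α) (n : ℕ) : ∀ (μ : ℕ → PMF α)
    (g : ℕ → α → ENNReal),
    expect (sampleList ((List.range n).map μ)) (fun l => ∏ i ∈ Finset.range n, g i (l.getD i d)) =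
      ∏ i ∈ Finset.range n, expect (μ i) (g i) := by
  induction n with
  | zero => intro μ g; simp [sampleList]
  | succ n ih =>
    intro μ g
    have := ih (fun i => μ (i + 1)) (fun i => g (i + 1))
    rw [List.range_succ_eq_map, List.map_cons, List.map_map, sampleList, expect_bind,
      Finset.prod_range_succ', ← this]
    simp only [expect_map, Finset.prod_range_succ', List.getD_cons_succ, List.getD_cons_zero,
      expect_mul_right, expect_mul_left]
    rfl

/-- The probability that the honest solver succeeds on the challenge `b`. -/
noncomputable def Puzzle.honestOn (Z : Puzzle) (k : ℕ) (b : Bool) : ENNReal :=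
  expect (Z.G k) fun pv => expect (Z.O k pv.1) fun oρ => expect (Z.S k pv.1 oρ.1 oρ.2 b) fun a =>
    if Z.V k pv.1 pv.2 oρ.1 b a then 1 else 0

theorem Puzzle.honestOn_le_one (Z : Puzzle) (k : ℕ) (b : Bool) : Z.honestOn k b ≤ 1 :=
  expect_le fun _ => expect_le fun _ => expect_le fun _ => by split_ifs <;> simp

theorem Puzzle.honest_eq (Z : Puzzle) (k : ℕ) :
    Z.honest k true = expect (PMF.uniformOfFintype Bool) (Z.honestOn k) := by
  rw [apply_true_eq_expect, honest]
  simp only [expect_bind, expect_map]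
  unfold honestOn
  rw [expect_comm (PMF.uniformOfFintype Bool)]
  congr 1
  ext1 pv
  rw [expect_comm (PMF.uniformOfFintype Bool)]

/-- For a fixed challenge the copies are independent and acceptance is a product of indicators;
answers, obligations and puzzles are integrated out in this order. Averaging over the shared bit
would destroy the product form. -/
theorem Puzzle.honestOn_rep (Z : Puzzle) (n : ℕ → ℕ) (k : ℕ) (b : Bool) :
    (Z.rep n).honestOn k b = Z.honestOn k b ^ n k := by
  -- The default values are chosen so that projecting commutes with out-of-range access.
  have hget : ∀ {α : Type} (g : α → Data) (l : List α) (d : α) (_ : g d = nil) (i : ℕ),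
      (ofList (l.map g)).get i = g (l.getD i d) := by
    intro α g l d hd i
    rw [get_ofList, ← hd, List.getD_map]
  have hget' : ∀ (l : List Data) (i : ℕ), (ofList l).get i = l.getD i nil := get_ofList
  have hbank : ∀ (l : List (Data × QMem)) (i : ℕ),
      (QMem.tensor (l.map Prod.snd)).bank (unary i) = (l.getD i (nil, QMem.vac)).2 := by
    intro l i
    rw [QMem.bank_tensor, ← List.getD_map (f := Prod.snd)]
  have hind : ∀ (φ : ℕ → Bool), (if decide (∀ i < n k, φ i = true) = true then (1 : ENNReal) else 0) =
      ∏ i ∈ Finset.range (n k), if φ i then 1 else 0 := by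
    intro φ
    rw [Finset.prod_boole]
    simp
  simp only [honestOn, rep, expect_map]
  simp only [hind, hget Prod.fst _ ((nil, nil) : Data × Data) rfl,
    hget Prod.snd _ ((nil, nil) : Data × Data) rfl,
    hget Prod.fst _ ((nil, QMem.vac) : Data × QMem) rfl, hbank, hget']
  have h1 : ∀ (l : List (Data × Data)) (lo : List (Data × QMem)), _ := fun l lo =>
    expect_sampleList_prod nil (n k) (fun i => Z.S k (l.getD i (nil, nil)).1
      (lo.getD i (nil, QMem.vac)).1 (lo.getD i (nil, QMem.vac)).2 b)
      (fun i a => if Z.V k (l.getD i (nil, nil)).1 (l.getD i (nil, nil)).2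
        (lo.getD i (nil, QMem.vac)).1 b a then 1 else 0)
  simp only [h1]
  have h2 : ∀ (l : List (Data × Data)), _ := fun l =>
    expect_sampleList_prod (nil, QMem.vac) (n k) (fun i => Z.O k (l.getD i (nil, nil)).1)
      (fun i oρ => expect (Z.S k (l.getD i (nil, nil)).1 oρ.1 oρ.2 b) fun a =>
        if Z.V k (l.getD i (nil, nil)).1 (l.getD i (nil, nil)).2 oρ.1 b a then 1 else 0)
  simp only [h2]
  have h3 := expect_sampleList_prod (nil, nil) (n k) (fun _ => Z.G k)
    (fun _ pv => expect (Z.O k pv.1) fun oρ => expect (Z.S k pv.1 oρ.1 oρ.2 b) fun a =>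
      if Z.V k pv.1 pv.2 oρ.1 b a then 1 else 0)
  simp only [List.map_const', List.length_range, Finset.prod_const, Finset.card_range] at h3
  exact h3

/-- On the unit interval the n-th power has slope at most n. -/
theorem pow_sub_pow_le_mul {s t : ℝ} (hs : 0 ≤ s) (hst : s ≤ t) (ht : t ≤ 1) (n : ℕ) :
    t ^ n - s ^ n ≤ n * (t - s) := by
  induction n with
  | zero => simp
  | succ n ih =>
    have h1 : s ^ n ≤ 1 := pow_le_one₀ hs (hst.trans ht)
    have h2 : 0 ≤ t ^ n - s ^ n := sub_nonneg.2 (pow_le_pow_left₀ hs hst n)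
    have h3 : t * (t ^ n - s ^ n) ≤ t ^ n - s ^ n := mul_le_of_le_one_left h2 ht
    have h4 : s ^ n * (t - s) ≤ t - s := mul_le_of_le_one_left (by linarith) h1
    push_cast
    calc t ^ (n + 1) - s ^ (n + 1) = t * (t ^ n - s ^ n) + s ^ n * (t - s) := by ring
      _ ≤ (n + 1) * (t - s) := by linarith

theorem Puzzle.HasCompleteness.rep {Z : Puzzle} {η : ℕ → ℝ} (hη : ∀ k, η k ∈ Set.Icc (0 : ℝ) 1)
    {n : ℕ → ℕ} (hn : ∃ P : Polynomial ℕ, ∀ k, n k ≤ P.eval k) (h : Z.HasCompleteness η) :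
    (Z.rep n).HasCompleteness fun k => η k ^ n k := by
  obtain ⟨ν, hν, h⟩ := h
  obtain ⟨P, hP⟩ := hn
  -- A loss ν in the base costs at most n * |ν| in the n-th power. The absolute value is needed
  -- since ν may be negative.
  refine ⟨fun k => n k * |ν k|, ?_, fun k => ?_⟩
  · have h1 := Asymptotics.SuperpolynomialDecay.polynomial_mul hν (P.map (Nat.castRingHom ℝ))
    refine h1.trans_abs_le fun k => ?_
    rw [abs_mul, abs_mul, abs_abs]
    refine mul_le_mul_of_nonneg_right ?_ (abs_nonneg _)
    have h2 : (P.map (Nat.castRingHom ℝ)).eval (k : ℝ) = (P.eval k : ℕ) := by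
      rw [Polynomial.eval_natCast_map]; simp
    rw [h2, Nat.abs_cast, Nat.abs_cast]
    exact_mod_cast hP k
  · have hunif : ∀ f : Bool → ENNReal, (∀ b, f b ≤ 1) →
        (expect (PMF.uniformOfFintype Bool) f).toReal =
          ((f false).toReal + (f true).toReal) / 2 := by
      intro f hf
      have hne : ∀ b, f b ≠ ⊤ := fun b => ((hf b).trans_lt ENNReal.one_lt_top).ne
      rw [expect_bool, ENNReal.toReal_add (ENNReal.mul_ne_top (by simp) (hne _))
        (ENNReal.mul_ne_top (by simp) (hne _))]
      simp; ring
    have hk := h k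
    rw [honest_eq, hunif _ (Z.honestOn_le_one k)] at hk
    rw [honest_eq, hunif _ ((Z.rep n).honestOn_le_one k)]
    simp only [honestOn_rep, ENNReal.toReal_pow]
    have h01 : ∀ b, (Z.honestOn k b).toReal ≤ 1 := fun b => by
      simpa using ENNReal.toReal_mono ENNReal.one_ne_top (Z.honestOn_le_one k b)
    set s₀ := (Z.honestOn k false).toReal with hs₀
    set s₁ := (Z.honestOn k true).toReal with hs₁
    have hs₀' : 0 ≤ s₀ := ENNReal.toReal_nonneg
    have hs₁' : 0 ≤ s₁ := ENNReal.toReal_nonneg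
    -- Jensen's inequality for the n-th power: sharing the challenge bit can only help the honest
    -- solver.
    have hconv : ((s₀ + s₁) / 2) ^ n k ≤ (s₀ ^ n k + s₁ ^ n k) / 2 := by
      have := (convexOn_pow (𝕜 := ℝ) (n k)).2 (Set.mem_Ici.2 hs₀') (Set.mem_Ici.2 hs₁')
        (by norm_num : (0 : ℝ) ≤ 1 / 2) (by norm_num : (0 : ℝ) ≤ 1 / 2) (by norm_num)
      simp only [smul_eq_mul] at this
      calc ((s₀ + s₁) / 2) ^ n k = (1 / 2 * s₀ + 1 / 2 * s₁) ^ n k := by ring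
        _ ≤ _ := this
        _ = _ := by ring
    have hs : 0 ≤ (s₀ + s₁) / 2 := by positivity
    have hnν : 0 ≤ (n k : ℝ) * |ν k| := by positivity
    rcases le_total (η k) ((s₀ + s₁) / 2) with hle | hle
    · have := pow_le_pow_left₀ (hη k).1 hle (n k)
      linarith
    · have h1 := pow_sub_pow_le_mul hs hle (hη k).2 (n k)
      have h2 : (n k : ℝ) * (η k - (s₀ + s₁) / 2) ≤ n k * |ν k| :=
        mul_le_mul_of_nonneg_left (by linarith [le_abs_self (ν k)]) (by positivity)
      linarith

/-! ### Choosing a good candidate by estimation -/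

/-- The probability that a trial succeeds, i.e. has a result `≠ nil`. -/
noncomputable def success (B : PMF Data) : ENNReal := expect B fun d => if d ≠ nil then 1 else 0

theorem success_le_one (B : PMF Data) : success B ≤ 1 := expect_le fun _ => by split_ifs <;> simp

theorem success_ne_top (B : PMF Data) : success B ≠ ⊤ :=
  ((success_le_one B).trans_lt ENNReal.one_lt_top).ne

/-- The number of successful trials, in unary, one trial for each element of a list. -/
noncomputable def countP (B : PMF Data) (l : List Data) : Data → PMF Data :=
  foldP (fun _ acc => B.map fun d => if d ≠ nil then node nil acc else acc) l

/-- A random candidate together with the number of trials that succeed for it. -/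
noncomputable def estimateP (D : PMF Data) (B : Data → PMF Data) (l : List Data) : PMF Data :=
  D.bind fun c => (countP (B c) l nil).map fun m => node m c

/-- Repeatedly draw a sample and keep the one with the longest first component. -/
noncomputable def maximizeP (ν : PMF Data) : List Data → Data → PMF Data :=
  foldP fun _ acc => ν.map fun e => if drop e.fst acc.fst ≠ nil then acc else e

/-- The candidate that does best in the trials `B`, among `|l| + 1` random ones with `|l'|` trials
for each. -/
noncomputable def bestP (D : PMF Data) (B : Data → PMF Data) (l l' : List Data) : PMF Data :=
  ((estimateP D B l').bind (maximizeP (estimateP D B l') l)).map Data.snd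

/-! ### Second moments of the estimates. -/

theorem expect_ite_eq_success (B : PMF Data) {u v : ℝ} (hu : 0 ≤ u) (hv : 0 ≤ v) :
    expect B (fun d => if d ≠ nil then ENNReal.ofReal u else ENNReal.ofReal v) =
      ENNReal.ofReal ((success B).toReal * u + (1 - (success B).toReal) * v) := by
  have h1 : expect B (fun d => if d ≠ nil then ENNReal.ofReal u else ENNReal.ofReal v) =
      expect (B.map fun d => decide (d ≠ nil))
        fun b => if b then ENNReal.ofReal u else ENNReal.ofReal v := by
    rw [expect_map]; simp
  have h2 : success B = B.map (fun d => decide (d ≠ nil)) true := by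
    rw [map_true_eq_expect, success]; simp
  rw [h1, h2]
  generalize B.map (fun d => decide (d ≠ nil)) = μ
  have h3 : μ false = 1 - μ true := by
    have := μ.tsum_coe
    rw [tsum_bool] at this
    rw [← this]
    exact (ENNReal.add_sub_cancel_right (μ.apply_ne_top _)).symm
  have h4 : (μ true).toReal ≤ 1 := by
    simpa using ENNReal.toReal_mono ENNReal.one_ne_top (μ.coe_le_one true)
  rw [expect_bool, h3, ENNReal.ofReal_add (by positivity)
    (mul_nonneg (by linarith) hv), ENNReal.ofReal_mul ENNReal.toReal_nonneg,
    ENNReal.ofReal_mul (by linarith), ENNReal.ofReal_toReal (μ.apply_ne_top _),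
    ENNReal.ofReal_sub _ ENNReal.toReal_nonneg, ENNReal.ofReal_one,
    ENNReal.ofReal_toReal (μ.apply_ne_top _)]
  simp [add_comm]

/-- Squared bias plus variance: each trial adds a variance p(1 - p) ≤ 1/4. The target `a` and the
accumulator are arbitrary so that the induction goes through. -/
theorem expect_countP_sq_le (B : PMF Data) (a : ℝ) (l : List Data) : ∀ acc,
    expect (countP B l acc) (fun d => ENNReal.ofReal ((d.toList.length - a) ^ 2)) ≤
      ENNReal.ofReal ((acc.toList.length + l.length * (success B).toReal - a) ^ 2 +
        l.length / 4) := by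
  induction l with
  | nil => intro acc; simp [countP, foldP]
  | cons x xs ih =>
    intro acc
    rw [countP, foldP, expect_bind, expect_map]
    set p := (success B).toReal with hp
    set y : ℝ := acc.toList.length + xs.length * p - a with hy
    calc _ ≤ expect B fun d => if d ≠ nil then
            ENNReal.ofReal ((y + 1) ^ 2 + (xs.length : ℝ) / 4) else
            ENNReal.ofReal (y ^ 2 + (xs.length : ℝ) / 4) := by
          refine expect_mono fun d => ?_
          split_ifs with h
          · refine (ih _).trans (ENNReal.ofReal_le_ofReal (le_of_eq ?_))
            simp only [toList_node, List.length_cons, hy]; push_cast; ring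
          · exact ih _
      _ = ENNReal.ofReal (p * ((y + 1) ^ 2 + (xs.length : ℝ) / 4) +
            (1 - p) * (y ^ 2 + (xs.length : ℝ) / 4)) :=
          expect_ite_eq_success B (by positivity) (by positivity)
      _ ≤ _ := by
          refine ENNReal.ofReal_le_ofReal ?_
          have : (acc.toList.length : ℝ) + ((x :: xs).length : ℕ) * p - a = y + p := by
            rw [hy, List.length_cons]; push_cast; ring
          rw [this, List.length_cons]
          push_cast
          -- The gap is 1/4 - p(1 - p) = (p - 1/2)^2.
          nlinarith [sq_nonneg (p - 1 / 2)]

/-- The estimate `e.fst` of the success probability of the candidate `e.snd` is off by at least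
`δ / 2`. -/
def BadEstimate (B : Data → PMF Data) (N : ℕ) (δ : ℝ) (e : Data) : Prop :=
  N * δ / 2 ≤ |(e.fst.toList.length : ℝ) - N * (success (B e.snd)).toReal|

-- Chebyshev's inequality: the variance is at most N / 4, and a bad estimate deviates by at least N
-- * δ / 2.
open Classical in
theorem expect_badEstimate_le (D : PMF Data) (B : Data → PMF Data) {l : List Data}
    (hl : 0 < l.length) {δ : ℝ} (hδ : 0 < δ) :
    expect (estimateP D B l) (fun e => if BadEstimate B l.length δ e then 1 else 0) ≤
      ENNReal.ofReal (1 / (l.length * δ ^ 2)) := by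
  have hl' : (0 : ℝ) < l.length := by exact_mod_cast hl
  rw [estimateP, expect_bind]
  refine expect_le fun c => ?_
  rw [expect_map]
  set p := (success (B c)).toReal with hp
  have h1 : ∀ m : Data, (if BadEstimate B l.length δ (node m c) then (1 : ENNReal) else 0) ≤
      ENNReal.ofReal ((2 / (l.length * δ)) ^ 2) *
        ENNReal.ofReal ((m.toList.length - l.length * p) ^ 2) := by
    intro m
    split_ifs with h
    · rw [← ENNReal.ofReal_mul (by positivity), ← ENNReal.ofReal_one]
      refine ENNReal.ofReal_le_ofReal ?_
      simp only [BadEstimate, fst_node, snd_node] at h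
      rw [← mul_pow, ← sq_abs, abs_mul, abs_of_pos (by positivity : 0 < 2 / (l.length * δ))]
      refine one_le_pow₀ ?_
      calc (1 : ℝ) = 2 / (l.length * δ) * (l.length * δ / 2) := by field_simp
        _ ≤ _ := by gcongr
    · positivity
  refine (expect_mono h1).trans ?_
  rw [expect_mul_left]
  refine (mul_le_mul_right (expect_countP_sq_le (B c) (l.length * p) l nil) _).trans ?_
  rw [← ENNReal.ofReal_mul (by positivity)]
  refine ENNReal.ofReal_le_ofReal (le_of_eq ?_)
  simp only [toList_nil, List.length_nil, Nat.cast_zero, ← hp]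
  field_simp
  ring

-- Union bound: the sample kept in the end is the initial one or one of those drawn.
open Classical in
theorem expect_maximizeP_le (ν : PMF Data) (φ : Data → Prop) (l : List Data) : ∀ acc,
    expect (maximizeP ν l acc) (fun e => if φ e then 1 else 0) ≤
      (if φ acc then 1 else 0) + l.length * expect ν (fun e => if φ e then 1 else 0) := by
  induction l with
  | nil => intro acc; simp [maximizeP, foldP]
  | cons x xs ih =>
    intro acc
    rw [maximizeP, foldP, expect_bind, expect_map]
    calc _ ≤ expect ν fun e => ((if φ acc then 1 else 0) + (if φ e then 1 else 0)) +
            xs.length * expect ν (fun e => if φ e then 1 else 0) := by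
          refine expect_mono fun e => (ih _).trans (add_le_add ?_ le_rfl)
          split_ifs <;> simp_all
      _ = _ := by
          rw [expect_add, expect_add, expect_const, expect_const, List.length_cons]
          push_cast; ring

/-- The maximum lies below `t` only if the initial sample and all independent draws do. -/
theorem expect_maximizeP_lt_le (ν : PMF Data) (t : ℕ) (l : List Data) : ∀ acc,
    expect (maximizeP ν l acc) (fun e => if e.fst.toList.length < t then 1 else 0) ≤
      (if acc.fst.toList.length < t then 1 else 0) *
        expect ν (fun e => if e.fst.toList.length < t then 1 else 0) ^ l.length := by
  induction l with
  | nil => intro acc; simp [maximizeP, foldP]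
  | cons x xs ih =>
    intro acc
    rw [maximizeP, foldP, expect_bind, expect_map]
    set F := expect ν (fun e => if e.fst.toList.length < t then 1 else 0) with hF
    have key : ∀ e : Data, (if (if drop e.fst acc.fst ≠ nil then acc else e).fst.toList.length < t
        then (1 : ENNReal) else 0) ≤ (if acc.fst.toList.length < t then 1 else 0) *
          (if e.fst.toList.length < t then 1 else 0) := by
      intro e
      -- `drop e.fst acc.fst` is empty exactly if the count of `acc` is at most that of `e`.
      by_cases hd : drop e.fst acc.fst = nil
      · have h1 : acc.fst.toList.length ≤ e.fst.toList.length := by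
          have := congrArg (fun d => d.toList.length) hd
          simp only [toList_drop, List.length_drop, toList_nil, List.length_nil] at this
          omega
        rw [if_neg (not_not.2 hd)]
        split_ifs <;> first | omega | simp
      · have h1 : e.fst.toList.length < acc.fst.toList.length := by
          by_contra hlt
          apply hd
          rw [← ofList_toList (drop e.fst acc.fst), toList_drop, List.drop_eq_nil_of_le (by omega)]
          rfl
        rw [if_pos hd]
        split_ifs <;> first | omega | simp
    calc _ ≤ expect ν fun e => (if acc.fst.toList.length < t then 1 else 0) *
            (if e.fst.toList.length < t then 1 else 0) * F ^ xs.length := by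
          exact expect_mono fun e => (ih _).trans (mul_le_mul_left (key e) _)
      _ = _ := by
          rw [expect_mul_right, expect_mul_left, ← hF, List.length_cons, pow_succ']
          ring

/-- Two terms of the binomial expansion. It serves twice: as a discrete form of ∫ (N + 1) F^N dF =
F^(N + 1) for the rank of a fresh sample, and to bound the chance that all retries fail. -/
theorem add_pow_succ_ge (a b : ENNReal) (N : ℕ) :
    a ^ (N + 1) + (N + 1) * (b * a ^ N) ≤ (a + b) ^ (N + 1) := by
  induction N with
  | zero => simp
  | succ N ih =>
    calc a ^ (N + 1 + 1) + ((N + 1 : ℕ) + 1) * (b * a ^ (N + 1))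
        ≤ (a ^ (N + 1) + (N + 1) * (b * a ^ N)) * (a + b) := by
          push_cast
          calc _ = a ^ (N + 1) * a + (N + 1) * (b * a ^ N) * a + a ^ (N + 1) * b := by ring
            _ ≤ a ^ (N + 1) * a + (N + 1) * (b * a ^ N) * a + a ^ (N + 1) * b +
              (N + 1) * (b * a ^ N) * b := le_self_add
            _ = _ := by ring
      _ ≤ (a + b) ^ (N + 1) * (a + b) := mul_le_mul_left ih _
      _ = _ := (pow_succ _ _).symm

/-- The probability that a fresh sample strictly beats `N` independent ones. -/
theorem expect_pow_lt_le (m : PMF ℕ) (N : ℕ) :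
    expect m (fun t => expect m (fun s => if s < t then 1 else 0) ^ N) ≤ 1 / (N + 1) := by
  have hF : ∀ t, expect m (fun s => if s < t then 1 else 0) = ∑ s ∈ Finset.range t, m s := by
    intro t
    unfold expect
    rw [tsum_eq_sum (s := Finset.range t)]
    · exact Finset.sum_congr rfl fun s hs => by simp [Finset.mem_range.1 hs]
    · intro s hs; simp only [Finset.mem_range] at hs; simp [hs]
  simp only [hF]
  rw [ENNReal.le_div_iff_mul_le (by simp) (by simp)]
  rw [mul_comm, ← expect_mul_left]
  refine ENNReal.tsum_le_of_sum_range_le fun T => ?_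
  -- With F(t) the probability of a sample below t, the increment of F^(N + 1) from t to t + 1
  -- dominates (N + 1) * m t * F(t)^N, so the sum telescopes.
  have h : ∀ T, ∑ t ∈ Finset.range T, m t * ((N + 1) * (∑ s ∈ Finset.range t, m s) ^ N) ≤
      (∑ s ∈ Finset.range T, m s) ^ (N + 1) := by
    intro T
    induction T with
    | zero => simp
    | succ T ih =>
      rw [Finset.sum_range_succ, Finset.sum_range_succ]
      refine le_trans ?_ (add_pow_succ_ge _ _ _)
      refine add_le_add ih (le_of_eq ?_)
      ring
  refine (h T).trans (pow_le_one₀ zero_le ?_)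
  rw [← m.tsum_coe]
  exact ENNReal.sum_le_tsum _

/-- The kept sample is the maximum of `l.length + 1` draws. One more draw is the strict maximum of
all `l.length + 2` with probability at most 1 / (`l.length` + 2), by exchangeability. -/
theorem expect_maximizeP_lt (ν : PMF Data) (l : List Data) :
    expect (ν.bind (maximizeP ν l)) (fun e => expect ν fun e' =>
      if e.fst.toList.length < e'.fst.toList.length then 1 else 0) ≤ 1 / (l.length + 2) := by
  rw [expect_comm]
  have h1 : ∀ t : ℕ, expect (ν.bind (maximizeP ν l))
      (fun e => if e.fst.toList.length < t then 1 else 0) ≤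
      expect ν (fun e => if e.fst.toList.length < t then 1 else 0) ^ (l.length + 1) := by
    intro t
    rw [expect_bind]
    refine (expect_mono fun acc => expect_maximizeP_lt_le ν t l acc).trans ?_
    rw [expect_mul_right, pow_succ']
  refine (expect_mono fun e' : Data => h1 e'.fst.toList.length).trans ?_
  have h2 := expect_pow_lt_le (ν.map fun e => e.fst.toList.length) (l.length + 1)
  rw [expect_map] at h2
  simp only [expect_map] at h2
  refine h2.trans (le_of_eq ?_)
  push_cast
  rw [add_assoc, one_add_one_eq_two]

open Classical in
/-- A fresh candidate is unlikely to be much better than the chosen one. -/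
theorem expect_bestP_le (D : PMF Data) (B : Data → PMF Data) (l : List Data) {l' : List Data}
    (hl' : 0 < l'.length) {δ : ℝ} (hδ : 0 < δ) :
    expect (bestP D B l l') (fun c => expect D fun c' =>
      if success (B c) + ENNReal.ofReal δ < success (B c') then 1 else 0) ≤
      1 / (l.length + 2) + (l.length + 2) * ENNReal.ofReal (1 / (l'.length * δ ^ 2)) := by
  set ν := estimateP D B l' with hν
  set ε := ENNReal.ofReal (1 / (l'.length * δ ^ 2)) with hε
  have hbad := expect_badEstimate_le D B hl' hδ
  rw [← hν, ← hε] at hbad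
  have hfst : ∀ f : Data → ENNReal, expect D f = expect ν fun e => f e.snd := by
    intro f
    rw [hν, estimateP, expect_bind]
    simp [expect_map]
  rw [bestP, expect_map]
  -- If the kept count is at least the other one and both estimates are off by less than δ / 2, the
  -- true probability of the other exceeds that of the kept one by less than δ.
  have key : ∀ e e' : Data,
      (if success (B e.snd) + ENNReal.ofReal δ < success (B e'.snd) then (1 : ENNReal) else 0) ≤
      (if e.fst.toList.length < e'.fst.toList.length then 1 else 0) +
        ((if BadEstimate B l'.length δ e then 1 else 0) +
          (if BadEstimate B l'.length δ e' then 1 else 0)) := by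
    intro e e'
    by_cases h1 : e.fst.toList.length < e'.fst.toList.length
    · rw [if_pos h1]; exact le_add_right (by split_ifs <;> simp)
    by_cases h2 : BadEstimate B l'.length δ e
    · rw [if_pos h2]; exact le_add_left (le_add_right (by split_ifs <;> simp))
    by_cases h3 : BadEstimate B l'.length δ e'
    · rw [if_pos h3]; exact le_add_left (le_add_left (by split_ifs <;> simp))
    rw [if_neg]
    · simp
    intro h4
    have h5 : (success (B e.snd)).toReal + δ < (success (B e'.snd)).toReal := by
      have := (ENNReal.toReal_lt_toReal (by simp [success_ne_top]) (success_ne_top _)).2 h4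
      rwa [ENNReal.toReal_add (success_ne_top _) ENNReal.ofReal_ne_top,
        ENNReal.toReal_ofReal hδ.le] at this
    simp only [BadEstimate, not_le, abs_lt] at h2 h3
    have h6 : (e'.fst.toList.length : ℝ) ≤ e.fst.toList.length := by exact_mod_cast not_lt.1 h1
    have h7 : (l'.length : ℝ) * ((success (B e.snd)).toReal + δ) ≤
      l'.length * (success (B e'.snd)).toReal := by gcongr
    linarith [h2.1, h2.2, h3.1, h3.2]
  calc _ ≤ expect (ν.bind (maximizeP ν l)) fun e => (expect ν fun e' =>
          if e.fst.toList.length < e'.fst.toList.length then 1 else 0) +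
          ((if BadEstimate B l'.length δ e then 1 else 0) + ε) := by
        refine expect_mono fun e => ?_
        rw [hfst]
        refine (expect_mono fun e' => key e e').trans ?_
        rw [expect_add, expect_add, expect_const]
        gcongr
    -- A bad estimate for the kept sample costs ε for each of the `l.length + 1` draws; the last ε
    -- is for the fresh candidate.
    _ ≤ 1 / (l.length + 2) + ((ε + l.length * ε) + ε) := by
        rw [expect_add, expect_add, expect_const]
        refine add_le_add (expect_maximizeP_lt ν l) (add_le_add ?_ le_rfl)
        rw [expect_bind]
        refine (expect_mono fun acc => expect_maximizeP_le ν _ l acc).trans ?_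
        rw [expect_add, expect_const]
        gcongr
    _ = _ := by ring

/-! ### Efficiency of the choice by estimation. -/

section

variable {Φ : Prog → Prop} [hΦ : Prog.Closed Φ]

theorem Eff.countP {B : Data → PMF Data} {L : Data → Data} (hB : Eff Φ B) (hL : DEff Φ L) :
    Eff Φ fun x => OneOfTwo.countP (B x) (L x).toList nil := by
  obtain ⟨PL, hPL⟩ := hL.size_le
  refine Eff.loop (A := fun _ => Data.nil)
    (B := fun _ acc x => (B x).map fun d => if d ≠ Data.nil then Data.node .nil acc else acc) hL .nil
    (Eff.map (g := fun d y => if d ≠ Data.nil then Data.node .nil y.snd.fst else y.snd.fst)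
      (Eff.comp_det hB (.snd (.snd .id)))
      (.ite (.fst .id) (.node .nil (.fst (.snd (.snd .id)))) (.fst (.snd (.snd .id)))))
    (fun x j acc => acc.size ≤ 2 * j + 1) (2 * PL + 1) (fun x => by simp [Data.size])
    (fun x j acc e _ _ hI r hr => ?_) (fun x j acc hj hI => ?_)
  · simp only [PMF.support_map, Set.mem_image] at hr
    obtain ⟨d, -, rfl⟩ := hr
    split_ifs
    · simp only [Data.size]; omega
    · omega
  · have h1 := hPL x
    have h2 := length_toList_lt_size (L x)
    simp only [Polynomial.eval_add, Polynomial.eval_mul, Polynomial.eval_ofNat,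
      Polynomial.eval_one]
    omega

theorem Eff.estimateP {D : Data → PMF Data} {B : Data → Data → PMF Data} {L : Data → Data}
    (hD : Eff Φ D) (hB : Eff Φ fun y => B y.fst y.snd) (hL : DEff Φ L) :
    Eff Φ fun x => OneOfTwo.estimateP (D x) (fun c => B c x) (L x).toList := by
  refine Eff.bind hD ?_
  exact Eff.map (Eff.countP hB (DEff.comp hL (.snd .id))) (.node (.fst .id) (.fst (.snd .id)))

theorem maximizeP_support {ν : PMF Data} (l : List Data) : ∀ acc, ∀ e ∈ (maximizeP ν l acc).support,
    e = acc ∨ e ∈ ν.support := by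
  induction l with
  | nil => intro acc e he; left; simpa [maximizeP, foldP] using he
  | cons x xs ih =>
    intro acc e he
    simp only [maximizeP, foldP, PMF.support_bind, PMF.support_map, Set.mem_iUnion,
      Set.mem_image] at he
    obtain ⟨r, ⟨s, hs, rfl⟩, he⟩ := he
    rcases ih _ e he with h | h
    · split_ifs at h
      · exact Or.inl h
      · exact Or.inr (h ▸ hs)
    · exact Or.inr h

/-- Used for size bounds: whatever the trials do, the choice is no larger than a sample of `D` can
be. -/
theorem bestP_support {D : PMF Data} {B : Data → PMF Data} {l l' : List Data} {c : Data}
    (hc : c ∈ (bestP D B l l').support) : c ∈ D.support := by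
  simp only [bestP, PMF.support_bind, PMF.support_map, Set.mem_iUnion, Set.mem_image] at hc
  obtain ⟨e, ⟨e', he', he⟩, rfl⟩ := hc
  have h : e ∈ (estimateP D B l').support := by
    rcases maximizeP_support _ _ _ he with rfl | h
    · exact he'
    · exact h
  simp only [estimateP, PMF.support_bind, PMF.support_map, Set.mem_iUnion, Set.mem_image] at h
  obtain ⟨c, hc, m, -, rfl⟩ := h
  exact hc

theorem Eff.maximizeP {ν : Data → PMF Data} {L : Data → Data} (hν : Eff Φ ν) (hL : DEff Φ L) :
    Eff Φ fun y => OneOfTwo.maximizeP (ν y.snd) (L y.snd).toList y.fst := by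
  obtain ⟨P, hP⟩ := hν.size_le
  have hB : Eff Φ fun z => (ν z.snd.snd.snd).map fun e =>
      if drop e.fst z.snd.fst.fst ≠ Data.nil then z.snd.fst else e :=
    Eff.map (Eff.comp_det hν (.snd (.snd (.snd .id))))
      (.ite (.drop (.fst (.fst .id)) (.fst (.fst (.snd (.snd .id))))) (.fst (.snd (.snd .id)))
        (.fst .id))
  have h := @Eff.loop Φ _ (fun y => L y.snd) (fun y => y.fst)
    (fun _ acc y => (ν y.snd).map fun e => if drop e.fst acc.fst ≠ Data.nil then acc else e)
    (DEff.comp hL (.snd .id)) (.fst .id)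
  refine h hB (fun y _ acc => acc = y.fst ∨ acc ∈ (ν y.snd).support) (.X + P) (fun x => Or.inl rfl)
    (fun x j acc e _ _ hI r hr => ?_) (fun x j acc hj hI => ?_)
  · simp only [PMF.support_map, Set.mem_image] at hr
    obtain ⟨d, hd, rfl⟩ := hr
    split_ifs
    · exact hI
    · exact Or.inr hd
  · simp only [Polynomial.eval_add, Polynomial.eval_X]
    rcases hI with rfl | hI
    · exact (size_fst_le x).trans le_self_add
    · exact ((hP _ _ hI).trans (polynomial_eval_mono _ (size_snd_le x))).trans le_add_self

theorem Eff.bestP {D : Data → PMF Data} {B : Data → Data → PMF Data} {L L' : Data → Data}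
    (hD : Eff Φ D) (hB : Eff Φ fun y => B y.fst y.snd) (hL : DEff Φ L) (hL' : DEff Φ L') :
    Eff Φ fun x => OneOfTwo.bestP (D x) (fun c => B c x) (L x).toList (L' x).toList := by
  have h := Eff.estimateP hD hB hL'
  refine Eff.map (g := fun e _ => e.snd) (Eff.bind h ?_) (.snd (.fst .id))
  exact Eff.maximizeP h hL

end

/-! ### Random indices -/

/-- A random number below the length of a list, in unary. -/
noncomputable def indexP (L : Data) : PMF Data :=
  -- Random binary digits are appended to the number 1 until it reaches m = `L.toList.length`. It
  -- then lies in [m, 2m), and m is subtracted. With fair coins and bounded time exact uniformity is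
  -- out of reach in general; a lower bound suffices here.
  (foldP (fun _ acc => if drop acc L ≠ nil then
    (PMF.uniformOfFintype Bool).map fun b => revAppend acc (revAppend acc (ofBool b))
    else PMF.pure acc) L.toList (unary 1)).map fun v => drop L v

/-- Appending the binary digit `b` to `v`. -/
theorem revAppend_double (v : ℕ) (b : Bool) :
    revAppend (unary v) (revAppend (unary v) (ofBool b)) = unary (2 * v + b.toNat) := by
  have h : ofBool b = unary b.toNat := by cases b <;> rfl
  rw [h, revAppend_eq, revAppend_eq]
  simp only [List.reverse_replicate, toList_ofList, unary,
    List.replicate_append_replicate]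
  congr 2
  omega

theorem drop_unary_ne_nil {v : ℕ} {L : Data} : drop (unary v) L ≠ nil ↔ v < L.toList.length := by
  rw [not_iff_comm, not_lt, ← ofList_toList (drop _ _), toList_drop]
  simp only [toList_unary, List.length_replicate]
  constructor
  · intro h; rw [List.drop_eq_nil_of_le h]; rfl
  · intro h
    have := congrArg (fun d => d.toList.length) h
    simp at this
    omega

theorem Eff.indexP {L : Data → Data} (hL : DEff Prog.Any L) :
    Eff Prog.Any fun x => OneOfTwo.indexP (L x) := by
  obtain ⟨PL, hPL⟩ := hL.size_le
  have hstep : Eff Prog.Any fun y => (PMF.uniformOfFintype Bool).map fun b =>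
      revAppend y.snd.fst (revAppend y.snd.fst (ofBool b)) :=
    (Eff.map (g := fun b y => revAppend y.snd.fst (revAppend y.snd.fst b)) Eff.flip
      (.revAppend (.fst (.snd (.snd .id))) (.revAppend (.fst (.snd (.snd .id))) (.fst .id)))).congr
        fun x => by simp [PMF.map_comp, Function.comp_def]
  have hkeep : Eff Prog.Any fun y => PMF.pure y.snd.fst :=
    DEff.fst (Φ := Prog.Any) (.snd .id)
  have hcond : DEff Prog.Any fun y => drop y.snd.fst (L y.snd.snd) :=
    .drop (.fst (.snd .id)) (DEff.comp hL (.snd (.snd .id)))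
  have hB := Eff.ite hcond hstep hkeep
  have h := @Eff.loop Prog.Any _ L (fun _ => unary 1)
    (fun _ acc x => if drop acc (L x) ≠ Data.nil then
      (PMF.uniformOfFintype Bool).map fun b => revAppend acc (revAppend acc (ofBool b))
      else PMF.pure acc) hL (.unary_const 1)
  refine Eff.map (g := fun v x => drop (L x) v) (h hB
    (fun x _ acc => ∃ v, acc = unary v ∧ v ≤ 2 * (L x).toList.length + 1) (4 * PL + 3) (fun x => ?_)
    (fun x j acc e _ _ hI r hr => ?_) (fun x j acc hj hI => ?_))
    (.drop (DEff.comp hL (.snd .id)) (.fst .id))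
  · exact ⟨1, rfl, by omega⟩
  · obtain ⟨v, rfl, hv⟩ := hI
    split_ifs at hr with h
    · simp only [PMF.support_map, Set.mem_image] at hr
      obtain ⟨b, -, rfl⟩ := hr
      have := drop_unary_ne_nil.1 h
      refine ⟨_, revAppend_double v b, ?_⟩
      have : b.toNat ≤ 1 := Bool.toNat_le b
      omega
    · simp only [PMF.support_pure, Set.mem_singleton_iff] at hr
      exact ⟨v, hr, hv⟩
  · obtain ⟨v, rfl, hv⟩ := hI
    have h1 := hPL x
    have h2 := length_toList_lt_size (L x)
    simp only [Polynomial.eval_add, Polynomial.eval_mul, Polynomial.eval_ofNat, size_unary]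
    omega

/-- The process follows the binary expansion of the target `w`: `v` is the prefix produced so far,
and `r` consists of the `s` digits still to come, each guessed with probability 1/2. A proper prefix
satisfies 2v ≤ w < 2m, so the process does not stop before `w`. -/
theorem le_foldP_index {m : ℕ} {w : ℕ} (h1 : m ≤ w) (h2 : w < 2 * m) (l : List Data) :
    ∀ (s v r : ℕ), s ≤ l.length → w = v * 2 ^ s + r → r < 2 ^ s →
      (2⁻¹ : ENNReal) ^ s ≤ foldP (fun _ acc => if drop acc (unary m) ≠ nil then
        (PMF.uniformOfFintype Bool).map fun b => revAppend acc (revAppend acc (ofBool b))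
        else PMF.pure acc) l (unary v) (unary w) := by
  induction l with
  | nil =>
    intro s v r hs hw hr
    obtain rfl : s = 0 := by simpa using hs
    obtain rfl : w = v := by simp at hr hw; omega
    simp [foldP]
  | cons x xs ih =>
    intro s v r hs hw hr
    rw [foldP]
    cases s with
    | zero =>
      obtain rfl : w = v := by simp at hr hw; omega
      rw [if_neg (by rw [drop_unary_ne_nil]; simpa using h1), PMF.pure_bind]
      exact ih 0 w 0 (by simp) (by simp) (by simp)
    | succ s =>
      have hv : v < m := by
        have : v * 2 ≤ v * 2 ^ (s + 1) :=
          Nat.mul_le_mul_left _ (by rw [pow_succ]; have := Nat.one_le_two_pow (n := s); omega)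
        omega
      rw [if_pos (by rw [drop_unary_ne_nil]; simpa using hv), PMF.bind_map]
      obtain ⟨b, r', hr', hb⟩ : ∃ (b : Bool) (r' : ℕ), r' < 2 ^ s ∧ r = b.toNat * 2 ^ s + r' := by
        rw [pow_succ] at hr
        rcases lt_or_ge r (2 ^ s) with h | h
        · exact ⟨false, r, h, by simp⟩
        · exact ⟨true, r - 2 ^ s, by omega, by simp; omega⟩
      have h := ih s (2 * v + b.toNat) r' (by simpa using hs)
        (by rw [hw, hb, pow_succ]; ring) hr'
      rw [PMF.bind_apply]
      refine le_trans ?_ (ENNReal.le_tsum b)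
      simp only [Function.comp_apply, revAppend_double, PMF.uniformOfFintype_apply,
        Fintype.card_bool]
      rw [pow_succ']
      exact mul_le_mul' (by simp) h

/-- Every index has a probability that is at least inverse linear. -/
theorem le_indexP {m j : ℕ} (hj : j < m) : (1 : ENNReal) / (2 * m) ≤ indexP (unary m) (unary j) := by
  -- The index `j` comes from the number m + j < 2m, which has s = ⌊log₂ w⌋ digits after the leading
  -- 1; its probability is at least 2^(-s) ≥ 1 / w.
  set w := m + j with hw
  set s := Nat.log 2 w with hs
  have hw0 : w ≠ 0 := by omega
  have hs1 : 2 ^ s ≤ w := Nat.pow_log_le_self 2 hw0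
  have hs2 : w < 2 ^ (s + 1) := Nat.lt_pow_succ_log_self (by norm_num) w
  have hsm : s ≤ m := by
    by_contra hlt
    have h1 : 2 ^ (m + 1) ≤ 2 ^ s := Nat.pow_le_pow_right (by norm_num) (by omega)
    have h2 : m < 2 ^ m := Nat.lt_two_pow_self
    rw [pow_succ] at h1
    omega
  have h := le_foldP_index (m := m) (w := w) (by omega) (by omega) (unary m).toList s 1 (w - 2 ^ s)
    (by simpa using hsm) (by omega) (by rw [pow_succ] at hs2; omega)
  have h2 : (1 : ENNReal) / (2 * m) ≤ 2⁻¹ ^ s := by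
    rw [one_div, ← ENNReal.inv_pow]
    refine ENNReal.inv_le_inv.2 ?_
    have : 2 ^ s ≤ 2 * m := by omega
    exact_mod_cast this
  refine h2.trans (h.trans ?_)
  rw [indexP, PMF.map_apply]
  refine le_trans (le_of_eq ?_) (ENNReal.le_tsum (unary w))
  rw [if_pos]
  rw [← ofList_toList (drop _ _), toList_drop]
  simp [unary, hw]

/-! ### The reduction: analysis

A solver `run` gets a list of puzzles, and `W p v i t` says that its output `t` solves the puzzle
`p`, with key `v`, at the position `i`. -/

/-- The output `t` solves all puzzles of the list, at the positions from `i` on. -/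
def solvesFrom (W : Data → Data → ℕ → Data → Bool) : ℕ → List (Data × Data) → Data → Bool
  | _, [], _ => true
  | i, pv :: l, t => W pv.1 pv.2 i t && solvesFrom W (i + 1) l t

section analysis

variable (G : PMF (Data × Data)) (run : Data → PMF Data) (W : Data → Data → ℕ → Data → Bool)

/-- Run the solver on the puzzles `π` (in reverse order) followed by `s` fresh puzzles; the result
is its output together with a bit that says whether all fresh puzzles are solved. -/
noncomputable def trial (π : Data) (s : ℕ) : PMF Data :=
  (sampleList (List.replicate s G)).bind fun l =>
    (run (revAppend π (ofList (l.map Prod.fst)))).map fun t =>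
      node (ofBool (solvesFrom W π.toList.length l t)) t

/-- The probability that all fresh puzzles are solved. -/
noncomputable def value (π : Data) (s : ℕ) : ENNReal := success ((trial G run W π s).map Data.fst)

/-- Repeat trials that succeed or fail until the first success. -/
noncomputable def untilSuccess (τ : PMF Data) : List Data → Data → PMF Data :=
  foldP fun _ acc => if acc.fst ≠ nil then PMF.pure acc else τ

/-- The probability that the puzzle is solved at the position after `π`, by the solver that repeats
trials with `s` further fresh puzzles until these are solved. -/
noncomputable def retryValue (rl : List Data) (π : Data) (s : ℕ) : ENNReal :=
  expect G fun pv => expect (untilSuccess (trial G run W (node pv.1 π) s) rl nil) fun y =>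
    if W pv.1 pv.2 π.toList.length y.snd then 1 else 0

theorem value_eq (π : Data) (s : ℕ) : value G run W π s =
    expect (trial G run W π s) fun y => if y.fst ≠ nil then 1 else 0 := by
  rw [value, success, expect_map]

theorem value_le_one (π : Data) (s : ℕ) : value G run W π s ≤ 1 := success_le_one _

theorem retryValue_le_one (rl : List Data) (π : Data) (s : ℕ) :
    retryValue G run W rl π s ≤ 1 :=
  expect_le fun _ => expect_le fun _ => by split_ifs <;> simp

/-- Moving the first fresh puzzle into the prefix does not change the input of the solver; only the
check of that puzzle is split off. -/
theorem value_succ (π : Data) (s : ℕ) : value G run W π (s + 1) =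
    expect G fun pv => expect (trial G run W (node pv.1 π) s) fun y =>
      if y.fst ≠ nil ∧ W pv.1 pv.2 π.toList.length y.snd then 1 else 0 := by
  rw [value_eq, trial, List.replicate_succ, sampleList]
  simp only [expect_bind, expect_map, trial, PMF.bind_bind, PMF.bind_map, Function.comp_def,
    solvesFrom, fst_node, snd_node, ofBool_ne_nil, Bool.and_eq_true, List.map_cons, ofList_cons,
    toList_node, List.length_cons]
  congr! 6 with pv l
  exact if_congr and_comm rfl rfl

theorem untilSuccess_of_ne_nil (τ : PMF Data) (l : List Data) {acc : Data} (h : acc.fst ≠ nil) :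
    untilSuccess τ l acc = PMF.pure acc := by
  induction l with
  | nil => rfl
  | cons x xs ih =>
    rw [untilSuccess, foldP, if_pos h, PMF.pure_bind]
    exact ih

/-- A geometric series: with a, b, c the probabilities of success with `φ`, success and failure, the
loop ends well with probability a(1 + c + ⋯ + c^(l-1)), and multiplication by b = 1 - c gives a - a
c^l. The form used avoids subtraction and division by b. -/
theorem expect_untilSuccess (τ : PMF Data) (φ : Data → Bool) (l : List Data) :
    ∀ acc, acc.fst = nil →
    (expect τ fun y => if y.fst ≠ nil then 1 else 0) *
      (expect (untilSuccess τ l acc) fun y => if y.fst ≠ nil ∧ φ y.snd then 1 else 0) +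
      (expect τ fun y => if y.fst ≠ nil ∧ φ y.snd then 1 else 0) *
        (expect τ fun y => if y.fst ≠ nil then 0 else 1) ^ l.length =
      expect τ fun y => if y.fst ≠ nil ∧ φ y.snd then 1 else 0 := by
  set a := expect τ fun y => if y.fst ≠ nil ∧ φ y.snd then 1 else 0 with ha
  set b := expect τ fun y => if y.fst ≠ nil then 1 else 0 with hb
  set c := expect τ fun y => if y.fst ≠ nil then 0 else 1 with hc
  have hbc : b + c = 1 := by
    rw [hb, hc, ← expect_add, ← expect_const τ 1]
    congr 1
    ext1 y
    split_ifs <;> simp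
  -- the value after a failed trial depends only on the number of trials that are left
  have hrec : ∀ l : List Data, ∃ w : ENNReal, b * w + a * c ^ l.length = a ∧
      ∀ acc, acc.fst = nil →
        (expect (untilSuccess τ l acc) fun y => if y.fst ≠ nil ∧ φ y.snd then 1 else 0) = w := by
    intro l
    induction l with
    | nil => exact ⟨0, by simp, fun acc h => by simp [untilSuccess, foldP, h]⟩
    | cons x xs ih =>
      obtain ⟨w, hw, hacc⟩ := ih
      -- Either the first trial decides, or it fails and the shorter loop starts afresh.
      refine ⟨a + c * w, ?_, fun acc h => ?_⟩
      · calc b * (a + c * w) + a * c ^ (x :: xs).length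
            = b * a + c * (b * w + a * c ^ xs.length) := by rw [List.length_cons, pow_succ]; ring
          _ = (b + c) * a := by rw [hw]; ring
          _ = a := by rw [hbc, one_mul]
      · rw [untilSuccess, foldP, if_neg (not_not.2 h), expect_bind]
        rw [ha, hc, ← expect_mul_right, ← expect_add]
        congr 1
        ext1 y
        by_cases hy : y.fst = nil
        · have := hacc y hy
          rw [untilSuccess] at this
          rw [this]; simp [hy]
        · have := untilSuccess_of_ne_nil τ xs hy
          rw [untilSuccess] at this
          rw [this, expect_pure]; simp [hy]
  intro acc h
  obtain ⟨w, hw, hacc⟩ := hrec l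
  rw [hacc acc h, hw]

/-- The term a c^l left over by the geometric series is at most b c^l, and (l + 1) b c^l ≤ (b +
c)^(l + 1) = 1. The bound needs no lower bound on b: if successes are rare, little is lost by never
seeing one. -/
theorem expect_trial_le (τ : PMF Data) (φ : Data → Bool) (l : List Data) :
    (expect τ fun y => if y.fst ≠ nil ∧ φ y.snd then 1 else 0) ≤
    (expect τ fun y => if y.fst ≠ nil then 1 else 0) *
      (expect (untilSuccess τ l nil) fun y => if φ y.snd then 1 else 0) + 1 / (l.length + 1) := by
  conv_lhs => rw [← expect_untilSuccess τ φ l nil rfl]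
  refine add_le_add (mul_le_mul_right (expect_mono fun y => ?_) _) ?_
  · split_ifs <;> simp_all
  set b := expect τ fun y => if y.fst ≠ nil then 1 else 0 with hb
  set c := expect τ fun y => if y.fst ≠ nil then 0 else 1 with hc
  have hbc : c + b = 1 := by
    rw [hb, hc, ← expect_add, ← expect_const τ 1]
    congr 1
    ext1 y
    split_ifs <;> simp
  have hab : (expect τ fun y => if y.fst ≠ nil ∧ φ y.snd then 1 else 0) ≤ b :=
    expect_mono fun y => by split_ifs <;> simp_all
  refine (mul_le_mul_left hab _).trans ?_
  rw [ENNReal.le_div_iff_mul_le (by simp) (by simp), mul_comm]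
  refine le_add_self.trans ((add_pow_succ_ge c b l.length).trans ?_)
  rw [hbc, one_pow]

/-- A puzzle that makes the remaining puzzles easy for the solver. -/
noncomputable def choosePuzzle (l k : List Data) (π : Data) (s : ℕ) : PMF Data :=
  bestP (G.map Prod.fst) (fun p => (trial G run W (node p π) s).map Data.fst) l k

/-- The error of the choice among `N + 1` candidates with `N'` trials for each. -/
noncomputable def choiceError (N N' : ℕ) (δ : ℝ) : ENNReal :=
  1 / (N + 2) + (N + 2) * ENNReal.ofReal (1 / (N' * δ ^ 2))

-- For every competitor p', a puzzle p has b(p) ≤ b(p') + δ, or else its contribution, at most 1, is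
-- charged to the event that p beats p' by more than δ. Averaging over p' = the chosen puzzle turns
-- this event into the choice error.
open Classical in
theorem value_succ_le (l rl : List Data) {l' : List Data} (hl' : 0 < l'.length) {δ : ℝ}
    (hδ : 0 < δ) (π : Data) (s : ℕ) :
    value G run W π (s + 1) ≤ retryValue G run W rl π s *
      ((expect (choosePuzzle G run W l l' π s) fun p => value G run W (node p π) s) +
        ENNReal.ofReal δ) + choiceError l.length l'.length δ + 1 / (rl.length + 1) := by
  set b : Data → ENNReal := fun p => value G run W (node p π) s with hb
  have key : ∀ p' : Data, value G run W π (s + 1) ≤ retryValue G run W rl π s *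
      (b p' + ENNReal.ofReal δ) + (expect (G.map Prod.fst) fun p =>
        if b p' + ENNReal.ofReal δ < b p then 1 else 0) + 1 / (rl.length + 1) := by
    intro p'
    rw [value_succ, retryValue, ← expect_mul_right, expect_map, ← expect_add]
    conv_rhs => rw [← expect_const G (1 / (rl.length + 1)), ← expect_add]
    refine expect_mono fun pv => ?_
    refine (expect_trial_le _ (W pv.1 pv.2 π.toList.length) rl).trans (add_le_add ?_ le_rfl)
    rw [← value_eq]
    change b pv.1 * _ ≤ _
    split_ifs with hlt
    · refine le_add_left (mul_le_one' (value_le_one G run W _ _)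
        (expect_le fun _ => by split_ifs <;> simp))
    · rw [add_zero, mul_comm]
      exact mul_le_mul_right (not_lt.1 hlt) _
  have hbest := expect_bestP_le (G.map Prod.fst)
    (fun p => (trial G run W (node p π) s).map Data.fst) l hl' hδ
  rw [← expect_const (choosePuzzle G run W l l' π s) (value G run W π (s + 1))]
  refine (expect_mono key).trans ?_
  rw [expect_add, expect_add, expect_const, expect_mul_left, expect_add, expect_const]
  exact add_le_add (add_le_add le_rfl hbest) le_rfl

/-- The successive choice of puzzles, out of a total of `m`. -/
noncomputable def choosePath (l l' : List Data) (m : ℕ) : List Data → Data → PMF Data :=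
  foldP fun _ acc => (choosePuzzle G run W l l' acc (m - (acc.toList.length + 1))).map
    fun p => node p acc

theorem foldP_append (body : Data → Data → PMF Data) (l₁ l₂ : List Data) : ∀ acc,
    foldP body (l₁ ++ l₂) acc = (foldP body l₁ acc).bind (foldP body l₂) := by
  induction l₁ with
  | nil => intro acc; simp [foldP, PMF.pure_bind]
  | cons x xs ih => intro acc; simp only [List.cons_append, foldP, PMF.bind_bind, ih]

theorem choosePath_succ (l l' : List Data) (m i : ℕ) :
    choosePath G run W l l' m (List.replicate (i + 1) nil) nil =
      (choosePath G run W l l' m (List.replicate i nil) nil).bind fun π =>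
        (choosePuzzle G run W l l' π (m - (π.toList.length + 1))).map fun p => node p π := by
  rw [choosePath, List.replicate_succ', foldP_append]
  congr 1
  ext1 π
  simp only [foldP]
  exact PMF.bind_pure _

theorem length_of_mem_choosePath (l l' : List Data) (m i : ℕ) :
    ∀ π ∈ (choosePath G run W l l' m (List.replicate i nil) nil).support,
      π.toList.length = i := by
  induction i with
  | zero => intro π hπ; simp [choosePath, foldP] at hπ; simp [hπ]
  | succ i ih =>
    intro π hπ
    rw [choosePath_succ] at hπ
    simp only [PMF.support_bind, PMF.support_map, Set.mem_iUnion, Set.mem_image] at hπ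
    obtain ⟨π', hπ', p, -, rfl⟩ := hπ
    simp [ih π' hπ']

open Classical in
/-- If the repeated trials rarely do better than `h`, then the solver hardly does better than
`h ^ m`. -/
theorem value_nil_le (l rl : List Data) {l' : List Data} (hl' : 0 < l'.length) {δ : ℝ}
    (hδ : 0 < δ) (m : ℕ) (h Q : ENNReal) (hh : h ≤ 1)
    (hQ : ∀ i < m, (expect (choosePath G run W l l' m (List.replicate i nil) nil) fun π =>
      if h + 2 * ENNReal.ofReal δ < retryValue G run W rl π (m - (i + 1)) then 1 else 0) ≤ Q) :
    value G run W nil m ≤ h ^ m + m * (3 * ENNReal.ofReal δ + Q +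
      choiceError l.length l'.length δ + 1 / (rl.length + 1)) := by
  set d := ENNReal.ofReal δ with hd
  set err := 3 * d + Q + choiceError l.length l'.length δ + 1 / (rl.length + 1) with herr
  -- `F i` is the mean value after `i` choices. It interpolates between the success of the solver (i
  -- = 0) and a quantity that is at most 1 (i = m), with one factor `h` per step.
  set F : ℕ → ENNReal := fun i => expect (choosePath G run W l l' m (List.replicate i nil) nil)
    fun π => value G run W π (m - i) with hF
  have hstep : ∀ i < m, F i ≤ h * F (i + 1) + err := by
    intro i hi
    set s := m - (i + 1) with hs
    have hs1 : m - i = s + 1 := by omega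
    have hsucc : F (i + 1) = expect (choosePath G run W l l' m (List.replicate i nil) nil)
        fun π => expect (choosePuzzle G run W l l' π (m - (π.toList.length + 1)))
          fun p => value G run W (node p π) s := by
      simp only [hF]
      rw [choosePath_succ, expect_bind]
      simp only [expect_map, ← hs]
    calc F i ≤ expect (choosePath G run W l l' m (List.replicate i nil) nil) fun π =>
          h * (expect (choosePuzzle G run W l l' π (m - (π.toList.length + 1)))
            fun p => value G run W (node p π) s) + (3 * d +
            (if h + 2 * d < retryValue G run W rl π s then 1 else 0) +
            choiceError l.length l'.length δ + 1 / (rl.length + 1)) := by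
          refine expect_mono_support fun π hπ => ?_
          rw [length_of_mem_choosePath G run W l l' m i π hπ, ← hs, hs1]
          refine (value_succ_le G run W l rl hl' hδ π s).trans ?_
          rw [← hd, ← add_assoc, ← add_assoc]
          refine add_le_add (add_le_add ?_ le_rfl) le_rfl
          set X := expect (choosePuzzle G run W l l' π s) fun p => value G run W (node p π) s
          have hX : X ≤ 1 := expect_le fun p => value_le_one G run W _ _
          set R := retryValue G run W rl π s
          have hR : R ≤ 1 := retryValue_le_one G run W rl π s
          have hR' : R ≤ h + 2 * d + (if h + 2 * d < R then 1 else 0) := by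
            split_ifs with hlt
            · exact le_add_left hR
            · simpa using not_lt.1 hlt
          -- `R` exceeds h + 2d only on the event whose probability `Q` bounds. As X ≤ 1 and R ≤ 1,
          -- only `h` has to keep the factor `X`; the rest is additive error, with 2d + d = 3d.
          calc R * (X + d) = R * X + R * d := mul_add _ _ _
            _ ≤ (h + 2 * d + (if h + 2 * d < R then 1 else 0)) * X + 1 * d := by gcongr
            _ = h * X + (2 * d + (if h + 2 * d < R then 1 else 0)) * X + d := by ring
            _ ≤ h * X + (2 * d + (if h + 2 * d < R then 1 else 0)) * 1 + d := by gcongr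
            _ = h * X + (3 * d + (if h + 2 * d < R then 1 else 0)) := by ring
            _ = _ := by ring
      _ ≤ h * F (i + 1) + err := by
          rw [expect_add, expect_mul_left, ← hsucc]
          refine add_le_add le_rfl ?_
          rw [expect_add, expect_add, expect_add, expect_const, expect_const, expect_const, herr]
          gcongr
          exact hQ i hi
  have hind : ∀ j ≤ m, F 0 ≤ h ^ j * F j + j * err := by
    intro j
    induction j with
    | zero => intro _; simp
    | succ j ih =>
      intro hj
      calc F 0 ≤ h ^ j * F j + j * err := ih (by omega)
        _ ≤ h ^ j * (h * F (j + 1) + err) + j * err := by gcongr; exact hstep j (by omega)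
        _ = h ^ (j + 1) * F (j + 1) + h ^ j * err + j * err := by ring
        _ ≤ h ^ (j + 1) * F (j + 1) + 1 * err + j * err := by gcongr; exact pow_le_one₀ zero_le hh
        _ = _ := by push_cast; ring
  have h0 : F 0 = value G run W nil m := by simp [hF, choosePath, foldP]
  rw [← h0]
  refine (hind m le_rfl).trans (add_le_add ?_ le_rfl)
  calc h ^ m * F m ≤ h ^ m * 1 := by
        gcongr; exact expect_le fun π => value_le_one G run W _ _
    _ = h ^ m := mul_one _

end analysis

open Classical in
/-- If the chosen candidate does not do better than `h` on average, then random candidates rarely do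
better than `h`. -/
theorem expect_candidate_le (D : PMF Data) (B : Data → PMF Data) (l : List Data) {l' : List Data}
    (hl' : 0 < l'.length) {h δ ν : ℝ} (hδ : 0 < δ) (hδ1 : δ ≤ 1) (hh0 : 0 ≤ h) (hh : h ≤ 1)
    (hν : ν ≤ δ / 2) (hbest : (expect (bestP D B l l') fun c => success (B c)).toReal ≤ h + ν) :
    (expect D fun c => if ENNReal.ofReal h + 2 * ENNReal.ofReal δ < success (B c) then 1 else 0) ≤
      ENNReal.ofReal (4 / δ) * choiceError l.length l'.length δ := by
  set Q := expect D fun c => if ENNReal.ofReal h + 2 * ENNReal.ofReal δ < success (B c)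
    then 1 else 0 with hQ
  set μ := bestP D B l l' with hμ
  -- The threshold h + δ separates two scales. The chosen candidate stays below it with probability
  -- x ≥ δ / 4, and in that case every candidate above h + 2δ beats it by more than δ, which is
  -- unlikely.
  set t := ENNReal.ofReal h + ENNReal.ofReal δ with ht
  set x := expect μ fun c => if success (B c) ≤ t then 1 else 0 with hx
  set y := expect μ fun c => if success (B c) ≤ t then 0 else 1 with hy
  have hxy : x + y = 1 := by
    rw [hx, hy, ← expect_add, ← expect_const μ 1]
    congr 1
    ext1 c
    split_ifs <;> simp
  have h1 : x * Q ≤ choiceError l.length l'.length δ := by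
    refine le_trans ?_ (expect_bestP_le D B l hl' hδ)
    rw [hx, ← expect_mul_right]
    refine expect_mono fun c => ?_
    split_ifs with hc
    · rw [one_mul, hQ]
      refine expect_mono fun c' => ?_
      split_ifs with h2 h3
      · simp
      · refine absurd (lt_of_le_of_lt ?_ h2) h3
        calc success (B c) + ENNReal.ofReal δ ≤ t + ENNReal.ofReal δ := by gcongr
          _ = _ := by rw [ht]; ring
      · simp
      · simp
    · simp
  have h2 : t * y ≤ expect μ fun c => success (B c) := by
    rw [hy, ← expect_mul_left]
    refine expect_mono fun c => ?_
    split_ifs with hc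
    · simp
    · simpa using (not_le.1 hc).le
  have hE : (expect μ fun c => success (B c)) ≠ ⊤ :=
    ((expect_le fun c => success_le_one (B c)).trans_lt ENNReal.one_lt_top).ne
  have hxt : x ≠ ⊤ := (le_self_add.trans_lt (hxy.le.trans_lt ENNReal.one_lt_top)).ne
  have hyt : y ≠ ⊤ := (le_add_self.trans_lt (hxy.le.trans_lt ENNReal.one_lt_top)).ne
  have hxy' : x.toReal + y.toReal = 1 := by
    rw [← ENNReal.toReal_add hxt hyt, hxy, ENNReal.toReal_one]
  have h3 : (h + δ) * y.toReal ≤ h + ν := by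
    have := (ENNReal.toReal_mono hE h2).trans hbest
    rwa [ENNReal.toReal_mul, ht, ← ENNReal.ofReal_add hh0 hδ.le,
      ENNReal.toReal_ofReal (by linarith)] at this
  -- From (h + δ)(1 - x) ≤ h + ν ≤ h + δ / 2 follows δ / 2 ≤ (h + δ) x ≤ 2x.
  have h4 : δ / 4 ≤ x.toReal := by
    have hy' : y.toReal = 1 - x.toReal := by linarith
    rw [hy'] at h3
    have : (h + δ) * x.toReal ≤ 2 * x.toReal :=
      mul_le_mul_of_nonneg_right (by linarith) ENNReal.toReal_nonneg
    linarith
  have h5 : 1 ≤ ENNReal.ofReal (4 / δ) * x := by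
    rw [← ENNReal.ofReal_toReal hxt, ← ENNReal.ofReal_mul (by positivity), ← ENNReal.ofReal_one]
    refine ENNReal.ofReal_le_ofReal ?_
    calc (1 : ℝ) = 4 / δ * (δ / 4) := by field_simp
      _ ≤ _ := by gcongr
  calc Q = 1 * Q := (one_mul _).symm
    _ ≤ ENNReal.ofReal (4 / δ) * x * Q := by gcongr
    _ = ENNReal.ofReal (4 / δ) * (x * Q) := mul_assoc _ _ _
    _ ≤ _ := by gcongr

/-! ### The reduction: programs -/

section programs

variable (gen ver sol : Data → PMF Data)

/-- Verify the answers of `t` to both challenges, at the position given by the length of `i`, for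
the puzzle and key `pv`. -/
noncomputable def checkD (κ pv i t : Data) : PMF Data :=
  (ver (ofList [κ, pv.fst, pv.snd.fst, t.fst.get i.toList.length, ofBool false,
    t.snd.fst.get i.toList.length])).bind fun r =>
  if r ≠ nil then ver (ofList [κ, pv.fst, pv.snd.fst, t.fst.get i.toList.length, ofBool true,
    t.snd.snd.fst.get i.toList.length]) else PMF.pure nil

/-- The program of `trial`. -/
noncomputable def trialD (κ π s : Data) : PMF Data :=
  ((sampleList ((List.range s.toList.length).map fun _ => gen κ)).map ofList).bind fun l =>
  (sol (ofList [κ, revAppend π (ofList (l.toList.map Data.fst))])).bind fun t =>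
  -- Only the length of `revAppend π (unary i)` is used: it is the position of the i-th fresh
  -- puzzle.
  ((sampleList ((List.range s.toList.length).map fun i =>
    checkD ver κ (l.get i) (revAppend π (unary i)) t)).map ofList).map fun bs =>
  node (ofBool (bs.toList.all fun d => decide (d ≠ nil))) t

/-- Repeated trials with a candidate `c`, i.e. a list of puzzles and the number of further
puzzles. -/
noncomputable def retryD (R : Data → Data) (κ c p : Data) : PMF Data :=
  untilSuccess (trialD gen ver sol κ (node p c.fst) c.snd) (R κ).toList nil

/-- The program of `choosePuzzle`. -/
noncomputable def choosePuzzleD (L L' : Data → Data) (κ π s : Data) : PMF Data :=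
  bestP ((gen κ).map Data.fst) (fun p => (trialD gen ver sol κ (node p π) s).map Data.fst)
    (L κ).toList (L' κ).toList

/-- The program of `choosePath`. -/
noncomputable def choosePathD (L L' : Data → Data) (κ m i : Data) : PMF Data :=
  foldP (fun _ acc => (choosePuzzleD gen ver sol L L' κ acc (drop (node nil acc) m)).map
    fun p => node p acc) i.toList nil

/-- A random candidate. -/
noncomputable def candidateD (L L' M : Data → Data) (κ : Data) : PMF Data :=
  (indexP (M κ)).bind fun m => (indexP (M κ)).bind fun i =>
    -- The second component has length m - (|π| + 1): one position is reserved for the puzzle to be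
    -- solved, and the rest is filled with fresh ones.
    (choosePathD gen ver sol L L' κ m i).map fun π => node π (drop (node nil π) m)

/-- Test a candidate on a fresh puzzle. -/
noncomputable def testD (R : Data → Data) (c κ : Data) : PMF Data :=
  (gen κ).bind fun pv => (retryD gen ver sol R κ c pv.fst).bind fun y =>
    checkD ver κ pv c.fst y.snd

/-- The solver for a single puzzle: choose a good candidate, and use it. -/
noncomputable def solverD (L L' M R : Data → Data) (x : Data) : PMF Data :=
  (bestP (candidateD gen ver sol L L' M x.fst) (fun c => testD gen ver sol R c x.fst)
    (L x.fst).toList (L' x.fst).toList).bind fun c =>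
  (retryD gen ver sol R x.fst c x.snd.fst).map fun y =>
    -- `y` is a success bit followed by an output of the repeated solver; the triple at the position
    -- after the prefix is extracted. The bit is ignored, also if all retries failed.
    ofList [y.snd.fst.get c.fst.toList.length, y.snd.snd.fst.get c.fst.toList.length,
      y.snd.snd.snd.fst.get c.fst.toList.length]

variable {gen ver sol}

theorem Eff.checkD (hver : Eff Prog.Any ver) :
    Eff Prog.Any fun x => OneOfTwo.checkD ver x.fst x.snd.fst x.snd.snd.fst x.snd.snd.snd := by
  have harg : ∀ (b : Bool) {t g : Data → Data}, DEff Prog.Any t → DEff Prog.Any g →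
      DEff Prog.Any fun x => ofList [(t x).fst, (t x).snd.fst.fst, (t x).snd.fst.snd.fst,
        (t x).snd.snd.snd.fst.get (t x).snd.snd.fst.toList.length, ofBool b,
        (g x).get (t x).snd.snd.fst.toList.length] := by
    intro b t g ht hg
    have hb : DEff Prog.Any fun _ => ofBool b := by
      cases b
      · exact .nil
      · exact .node .nil .nil
    exact .node (.fst ht) (.node (.fst (.fst (.snd ht))) (.node (.fst (.snd (.fst (.snd ht))))
      (.node (.get (.fst (.snd (.snd ht))) (.fst (.snd (.snd (.snd ht)))))
        (.node hb (.node (.get (.fst (.snd (.snd ht))) hg) .nil)))))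
  have h1 := Eff.comp_det hver (harg false .id (.fst (.snd (.snd (.snd (.snd .id))))))
  have h2 := Eff.comp_det hver (harg true (.snd .id)
    (.fst (.snd (.snd (.snd (.snd (.snd (.snd .id))))))))
  refine Eff.bind h1 ?_
  exact Eff.ite (c := fun y => y.fst) (DEff.fst .id) h2 DEff.nil

theorem Eff.trialD (hgen : Eff Prog.Any gen) (hver : Eff Prog.Any ver) (hsol : Eff Prog.Any sol) :
    Eff Prog.Any fun x => OneOfTwo.trialD gen ver sol x.fst x.snd.fst x.snd.snd := by
  have h1 : Eff Prog.Any fun x : Data => ((sampleList ((List.range x.snd.snd.toList.length).map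
      fun _ => gen x.fst)).map ofList) :=
    Eff.collect (F := fun _ x => gen x.fst) (.snd (.snd .id))
      (Eff.comp_det hgen (.fst (.snd .id)))
  have h2 : Eff Prog.Any fun y : Data => sol (ofList [y.snd.fst, revAppend y.snd.snd.fst
      (ofList (y.fst.toList.map Data.fst))]) :=
    Eff.comp_det hsol (.node (.fst (.snd .id)) (.node (.revAppend (.fst (.snd (.snd .id)))
      (.mapList (.fst .id) (.fst .id))) .nil))
  have h3 : Eff Prog.Any fun z : Data => (sampleList ((List.range
      z.snd.snd.snd.snd.toList.length).map fun i => OneOfTwo.checkD ver z.snd.snd.fst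
        (z.snd.fst.get i) (revAppend z.snd.snd.snd.fst (unary i)) z.fst)).map ofList := by
    refine (Eff.collect (F := fun i z => OneOfTwo.checkD ver z.snd.snd.fst
        (z.snd.fst.get i.toList.length) (revAppend z.snd.snd.snd.fst i) z.fst)
      (.snd (.snd (.snd (.snd .id)))) ?_).congr fun x => by simp
    have harg : DEff Prog.Any fun y : Data => Data.node y.snd.snd.snd.fst (Data.node
        (y.snd.snd.fst.get y.fst.toList.length)
        (Data.node (revAppend y.snd.snd.snd.snd.fst y.fst) y.snd.fst)) :=
      .node (.fst (.snd (.snd (.snd .id)))) (.node (.get (.fst .id) (.fst (.snd (.snd .id))))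
        (.node (.revAppend (.fst (.snd (.snd (.snd (.snd .id))))) (.fst .id)) (.fst (.snd .id))))
    have h := Eff.comp_det (Eff.checkD hver) harg
    exact h
  refine Eff.bind h1 ?_
  refine Eff.bind h2 ?_
  refine Eff.map h3 ?_
  exact .node (.all (.fst .id)) (.fst (.snd .id))

theorem Eff.retryD {R : Data → Data} (hgen : Eff Prog.Any gen) (hver : Eff Prog.Any ver)
    (hsol : Eff Prog.Any sol) (hR : DEff Prog.Any R) :
    Eff Prog.Any fun x => OneOfTwo.retryD gen ver sol R x.fst x.snd.fst x.snd.snd := by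
  have hτ : Eff Prog.Any fun x : Data => OneOfTwo.trialD gen ver sol x.fst
      (Data.node x.snd.snd x.snd.fst.fst) x.snd.fst.snd := by
    have harg : DEff Prog.Any fun x : Data => Data.node x.fst
        (Data.node (Data.node x.snd.snd x.snd.fst.fst) x.snd.fst.snd) :=
      .node (.fst .id) (.node (.node (.snd (.snd .id)) (.fst (.fst (.snd .id))))
        (.snd (.fst (.snd .id))))
    have h := Eff.comp_det (Eff.trialD hgen hver hsol) harg
    exact h
  obtain ⟨P, hP⟩ := hτ.size_le
  have hkeep : Eff Prog.Any fun y => PMF.pure y.snd.fst :=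
    DEff.fst (Φ := Prog.Any) (.snd .id)
  have hB := Eff.ite (c := fun y => y.snd.fst.fst) (DEff.fst (.fst (.snd .id))) hkeep
    (Eff.comp_det hτ (.snd (.snd .id)))
  have h := @Eff.loop Prog.Any _ (fun x => R x.fst) (fun _ => nil)
    (fun _ acc x => if acc.fst ≠ nil then PMF.pure acc else
      OneOfTwo.trialD gen ver sol x.fst (Data.node x.snd.snd x.snd.fst.fst) x.snd.fst.snd)
    (DEff.comp hR (.fst .id)) .nil
  -- The accumulator is `nil` or the result of a single trial, so its size does not grow with the
  -- number of rounds.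
  refine h hB (fun x _ acc => acc.size ≤ P.eval x.size + 1) (P + 1)
    (fun x => by simp [Data.size]) (fun x j acc e _ _ hI r hr => ?_)
    (fun x j acc _ hI => by simpa using hI)
  split_ifs at hr
  · simp only [PMF.support_pure, Set.mem_singleton_iff] at hr
    rw [hr]; exact hI
  · exact (hP x r hr).trans (Nat.le_succ _)

theorem Eff.choosePuzzleD {L L' : Data → Data} (hgen : Eff Prog.Any gen) (hver : Eff Prog.Any ver)
    (hsol : Eff Prog.Any sol) (hL : DEff Prog.Any L) (hL' : DEff Prog.Any L') :
    Eff Prog.Any fun x => OneOfTwo.choosePuzzleD gen ver sol L L' x.fst x.snd.fst x.snd.snd := by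
  have harg : DEff Prog.Any fun y : Data => Data.node y.snd.fst
      (Data.node (Data.node y.fst y.snd.snd.fst) y.snd.snd.snd) :=
    .node (.fst (.snd .id)) (.node (.node (.fst .id) (.fst (.snd (.snd .id))))
      (.snd (.snd (.snd .id))))
  have h1 := Eff.comp_det (Eff.trialD hgen hver hsol) harg
  have h2 : Eff Prog.Any fun y : Data => (OneOfTwo.trialD gen ver sol y.snd.fst
      (Data.node y.fst y.snd.snd.fst) y.snd.snd.snd).map Data.fst :=
    Eff.map (g := fun y _ => y.fst) h1 (.fst (.fst .id))
  have h3 : Eff Prog.Any fun x : Data => (gen x.fst).map Data.fst :=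
    Eff.map (g := fun y _ => y.fst) (Eff.comp_det hgen (.fst .id)) (.fst (.fst .id))
  exact Eff.bestP (B := fun c x => (OneOfTwo.trialD gen ver sol x.fst
    (Data.node c x.snd.fst) x.snd.snd).map Data.fst) h3 h2 (DEff.comp hL (.fst .id))
    (DEff.comp hL' (.fst .id))

/-- A size bound for `choosePuzzleD` in terms of its input would compound over the loop, as the
prefix is part of that input. But the chosen puzzle is an output of `gen`, bounded in terms of the
security parameter alone, so the prefix grows linearly. -/
theorem Eff.choosePathD {L L' : Data → Data} (hgen : Eff Prog.Any gen) (hver : Eff Prog.Any ver)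
    (hsol : Eff Prog.Any sol) (hL : DEff Prog.Any L) (hL' : DEff Prog.Any L') :
    Eff Prog.Any fun x => OneOfTwo.choosePathD gen ver sol L L' x.fst x.snd.fst x.snd.snd := by
  obtain ⟨P, hP⟩ := hgen.size_le
  have harg : DEff Prog.Any fun y : Data => Data.node y.snd.snd.fst
      (Data.node y.snd.fst (drop (Data.node nil y.snd.fst) y.snd.snd.snd.fst)) :=
    .node (.fst (.snd (.snd .id))) (.node (.fst (.snd .id))
      (.drop (.node .nil (.fst (.snd .id))) (.fst (.snd (.snd (.snd .id))))))
  have h1 := Eff.comp_det (Eff.choosePuzzleD hgen hver hsol hL hL') harg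
  have h2 : Eff Prog.Any fun y : Data => (OneOfTwo.choosePuzzleD gen ver sol L L' y.snd.snd.fst
      y.snd.fst (drop (Data.node nil y.snd.fst) y.snd.snd.snd.fst)).map fun p => Data.node p y.snd.fst :=
    Eff.map h1 (.node (.fst .id) (.fst (.snd (.snd .id))))
  have h := @Eff.loop Prog.Any _ (fun x => x.snd.snd) (fun _ => nil)
    (fun _ acc x => (OneOfTwo.choosePuzzleD gen ver sol L L' x.fst acc
      (drop (Data.node nil acc) x.snd.fst)).map fun p => Data.node p acc) (.snd (.snd .id)) .nil
  refine h h2 (fun x j acc => acc.size ≤ 1 + j * (1 + P.eval x.size)) (1 + .X * (1 + P))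
    (fun x => by simp [Data.size]) (fun x j acc e _ _ hI r hr => ?_)
    (fun x j acc hj hI => ?_)
  · simp only [PMF.support_map, Set.mem_image] at hr
    obtain ⟨p, hp, rfl⟩ := hr
    have h3 := bestP_support hp
    simp only [PMF.support_map, Set.mem_image] at h3
    obtain ⟨pv, hpv, rfl⟩ := h3
    have h4 := (size_fst_le pv).trans ((hP _ _ hpv).trans
      (polynomial_eval_mono P (size_fst_le x)))
    simp only [Data.size]
    rw [add_mul, one_mul]
    omega
  · refine hI.trans ?_
    simp only [Polynomial.eval_add, Polynomial.eval_mul, Polynomial.eval_one, Polynomial.eval_X]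
    refine add_le_add le_rfl (Nat.mul_le_mul_right _ ?_)
    exact hj.le.trans ((length_toList_lt_size _).le.trans
      ((size_snd_le _).trans (size_snd_le _)))

theorem Eff.candidateD {L L' M : Data → Data} (hgen : Eff Prog.Any gen) (hver : Eff Prog.Any ver)
    (hsol : Eff Prog.Any sol) (hL : DEff Prog.Any L) (hL' : DEff Prog.Any L')
    (hM : DEff Prog.Any M) : Eff Prog.Any (OneOfTwo.candidateD gen ver sol L L' M) := by
  have harg : DEff Prog.Any fun y : Data => Data.node y.snd.snd (Data.node y.snd.fst y.fst) :=
    .node (.snd (.snd .id)) (.node (.fst (.snd .id)) (.fst .id))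
  have h1 := Eff.comp_det (Eff.choosePathD hgen hver hsol hL hL') harg
  have h2 : Eff Prog.Any fun y : Data => (OneOfTwo.choosePathD gen ver sol L L' y.snd.snd y.snd.fst
      y.fst).map fun π => Data.node π (drop (Data.node nil π) y.snd.fst) :=
    Eff.map h1 (.node (.fst .id) (.drop (.node .nil (.fst .id)) (.fst (.snd (.snd .id)))))
  have h3 := Eff.indexP hM
  exact Eff.bind h3 (Eff.bind (Eff.comp_det (G := fun x => OneOfTwo.indexP (M x)) h3
    (.snd .id)) h2)

theorem Eff.testD {R : Data → Data} (hgen : Eff Prog.Any gen) (hver : Eff Prog.Any ver)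
    (hsol : Eff Prog.Any sol) (hR : DEff Prog.Any R) :
    Eff Prog.Any fun x => OneOfTwo.testD gen ver sol R x.fst x.snd := by
  have harg1 : DEff Prog.Any fun y : Data => Data.node y.snd.snd (Data.node y.snd.fst y.fst.fst) :=
    .node (.snd (.snd .id)) (.node (.fst (.snd .id)) (.fst (.fst .id)))
  have h1 := Eff.comp_det (Eff.retryD hgen hver hsol hR) harg1
  have harg2 : DEff Prog.Any fun z : Data => Data.node z.snd.snd.snd (Data.node z.snd.fst
      (Data.node z.snd.snd.fst.fst z.fst.snd)) :=
    .node (.snd (.snd (.snd .id))) (.node (.fst (.snd .id))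
      (.node (.fst (.fst (.snd (.snd .id)))) (.snd (.fst .id))))
  have h2 := Eff.comp_det (Eff.checkD hver) harg2
  exact Eff.bind (Eff.comp_det hgen (.snd .id)) (Eff.bind h1 h2)

theorem Eff.solverD {L L' M R : Data → Data} (hgen : Eff Prog.Any gen) (hver : Eff Prog.Any ver)
    (hsol : Eff Prog.Any sol) (hL : DEff Prog.Any L) (hL' : DEff Prog.Any L')
    (hM : DEff Prog.Any M) (hR : DEff Prog.Any R) :
    Eff Prog.Any (OneOfTwo.solverD gen ver sol L L' M R) := by
  have h1 : Eff Prog.Any fun x => OneOfTwo.bestP (OneOfTwo.candidateD gen ver sol L L' M x)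
      (fun c => OneOfTwo.testD gen ver sol R c x) (L x).toList (L' x).toList :=
    Eff.bestP (Eff.candidateD hgen hver hsol hL hL' hM) (Eff.testD hgen hver hsol hR) hL hL'
  have harg : DEff Prog.Any fun y : Data => Data.node y.snd.fst (Data.node y.fst y.snd.snd.fst) :=
    .node (.fst (.snd .id)) (.node (.fst .id) (.fst (.snd (.snd .id))))
  have h2 := Eff.comp_det (Eff.retryD hgen hver hsol hR) harg
  have h3 : DEff Prog.Any fun z : Data => ofList [z.fst.snd.fst.get z.snd.fst.fst.toList.length,
      z.fst.snd.snd.fst.get z.snd.fst.fst.toList.length,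
      z.fst.snd.snd.snd.fst.get z.snd.fst.fst.toList.length] := by
    have hi : DEff Prog.Any fun z : Data => z.snd.fst.fst := .fst (.fst (.snd .id))
    have ht : DEff Prog.Any fun z : Data => z.fst.snd := .snd (.fst .id)
    exact .node (.get hi (.fst ht)) (.node (.get hi (.fst (.snd ht)))
      (.node (.get hi (.fst (.snd (.snd ht)))) .nil))
  exact Eff.bind (Eff.comp_det h1 (.fst .id)) (Eff.map h2 h3)

end programs

/-! ### The reduction: the programs do what they should -/

/-- The output `t` answers both challenges to the puzzle `p` at the position `i`. -/
def Puzzle.solves (Z : Puzzle) (k : ℕ) (p v : Data) (i : ℕ) (t : Data) : Bool :=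
  Z.V₂ k p v ((t.get 0).get i) ((t.get 1).get i) ((t.get 2).get i)

theorem solvesFrom_eq (W : Data → Data → ℕ → Data → Bool) (t : Data) (l : List (Data × Data)) :
    ∀ i, solvesFrom W i l t = (List.range l.length).all fun j =>
      W (l.getD j (nil, nil)).1 (l.getD j (nil, nil)).2 (i + j) t := by
  induction l with
  | nil => intro i; rfl
  | cons pv l ih =>
    intro i
    rw [solvesFrom, ih, List.length_cons, List.range_succ_eq_map, List.all_cons, List.all_map]
    simp [Function.comp_def, Nat.add_assoc, Nat.add_comm 1]

section semantics

variable {Z : Puzzle} {gen ver sol : Data → PMF Data} {k : ℕ}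

theorem checkD_eq
    (hver : ∀ p v o b a, ver (ofList [unary k, p, v, o, ofBool b, a]) =
      PMF.pure (ofBool (Z.V k p v o b a))) (pv i t : Data) :
    checkD ver (unary k) pv i t =
      PMF.pure (ofBool (Z.solves k pv.fst pv.snd.fst i.toList.length t)) := by
  rw [checkD, hver, PMF.pure_bind, hver, Puzzle.solves, Puzzle.V₂]
  simp only [get_succ, get_zero]
  cases Z.V k pv.fst pv.snd.fst (t.fst.get i.toList.length) false
    (t.snd.fst.get i.toList.length) <;> simp [ofBool]

theorem trialD_eq (hgen : gen (unary k) = (Z.G k).map fun pv => ofList [pv.1, pv.2])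
    (hver : ∀ p v o b a, ver (ofList [unary k, p, v, o, ofBool b, a]) =
      PMF.pure (ofBool (Z.V k p v o b a))) (π s : Data) :
    trialD gen ver sol (unary k) π s =
      trial (Z.G k) (fun ps => sol (ofList [unary k, ps])) (Z.solves k) π s.toList.length := by
  have hl := sampleList_map_map (fun pv : Data × Data => ofList [pv.1, pv.2])
    (List.replicate s.toList.length (Z.G k))
  rw [List.map_replicate] at hl
  rw [trialD, hgen, List.map_const', List.length_range, hl, PMF.map_comp, PMF.bind_map, trial]
  simp only [checkD_eq hver, sampleList_map_pure, PMF.pure_map]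
  refine PMF.ext fun d => ?_
  rw [PMF.bind_apply, PMF.bind_apply]
  refine tsum_congr fun l => ?_
  by_cases hl0 : sampleList (List.replicate s.toList.length (Z.G k)) l = 0
  · simp [hl0]
  have hlen : l.length = s.toList.length := by
    have := sampleList_length _ l ((PMF.mem_support_iff _ _).2 hl0)
    simpa using this
  congr 2
  rw [← PMF.bind_pure_comp]
  simp only [Function.comp_def, toList_ofList, List.map_map]
  congr 1
  ext1 t
  congr 3
  rw [solvesFrom_eq, hlen]
  rw [Bool.eq_iff_iff, List.all_map, List.all_eq_true, List.all_eq_true]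
  refine forall₂_congr fun j hj => ?_
  have hj' : j < l.length := by rw [hlen]; exact List.mem_range.1 hj
  simp [get_ofList, List.getD_eq_getElem?_getD, hj', toList_revAppend]

theorem retryD_eq (hgen : gen (unary k) = (Z.G k).map fun pv => ofList [pv.1, pv.2])
    (hver : ∀ p v o b a, ver (ofList [unary k, p, v, o, ofBool b, a]) =
      PMF.pure (ofBool (Z.V k p v o b a))) (R : Data → Data) (c p : Data) :
    retryD gen ver sol R (unary k) c p = untilSuccess (trial (Z.G k)
      (fun ps => sol (ofList [unary k, ps])) (Z.solves k) (node p c.fst) c.snd.toList.length)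
      (R (unary k)).toList nil := by
  rw [retryD, trialD_eq hgen hver]

/-- A test is the single-puzzle game against the retry solver, played on a puzzle whose key is
known. -/
theorem success_testD (hgen : gen (unary k) = (Z.G k).map fun pv => ofList [pv.1, pv.2])
    (hver : ∀ p v o b a, ver (ofList [unary k, p, v, o, ofBool b, a]) =
      PMF.pure (ofBool (Z.V k p v o b a))) (R : Data → Data) (c : Data) :
    success (testD gen ver sol R c (unary k)) = retryValue (Z.G k)
      (fun ps => sol (ofList [unary k, ps])) (Z.solves k) (R (unary k)).toList c.fst
      c.snd.toList.length := by
  rw [success, testD, hgen]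
  simp only [PMF.bind_map, expect_bind, Function.comp_def, checkD_eq hver, expect_pure,
    retryD_eq hgen hver, ofBool_ne_nil, ofList_cons, fst_node, snd_node, retryValue]

theorem choosePuzzleD_eq (hgen : gen (unary k) = (Z.G k).map fun pv => ofList [pv.1, pv.2])
    (hver : ∀ p v o b a, ver (ofList [unary k, p, v, o, ofBool b, a]) =
      PMF.pure (ofBool (Z.V k p v o b a))) (L L' : Data → Data) (π s : Data) :
    choosePuzzleD gen ver sol L L' (unary k) π s = choosePuzzle (Z.G k)
      (fun ps => sol (ofList [unary k, ps])) (Z.solves k) (L (unary k)).toList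
      (L' (unary k)).toList π s.toList.length := by
  rw [choosePuzzleD, choosePuzzle, hgen, PMF.map_comp]
  simp only [trialD_eq hgen hver]
  rfl

theorem choosePathD_eq (hgen : gen (unary k) = (Z.G k).map fun pv => ofList [pv.1, pv.2])
    (hver : ∀ p v o b a, ver (ofList [unary k, p, v, o, ofBool b, a]) =
      PMF.pure (ofBool (Z.V k p v o b a))) (L L' : Data → Data) (m i : ℕ) :
    choosePathD gen ver sol L L' (unary k) (unary m) (unary i) = choosePath (Z.G k)
      (fun ps => sol (ofList [unary k, ps])) (Z.solves k) (L (unary k)).toList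
      (L' (unary k)).toList m (List.replicate i nil) nil := by
  rw [choosePathD, choosePath, toList_unary]
  simp only [choosePuzzleD_eq hgen hver, toList_drop, toList_node, toList_unary, List.length_cons,
    List.length_drop, List.length_replicate]

/-- The candidate is chosen without looking at the given puzzle, so the two draws can be exchanged.
The real game then coincides with one more test of the chosen candidate. -/
theorem expect_solverD (hgen : gen (unary k) = (Z.G k).map fun pv => ofList [pv.1, pv.2])
    (hver : ∀ p v o b a, ver (ofList [unary k, p, v, o, ofBool b, a]) =
      PMF.pure (ofBool (Z.V k p v o b a))) (L L' M R : Data → Data) :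
    (expect (Z.G k) fun pv => expect (solverD gen ver sol L L' M R (ofList [unary k, pv.1]))
      fun t => if Z.V₂ k pv.1 pv.2 (t.get 0) (t.get 1) (t.get 2) then 1 else 0) =
    expect (bestP (candidateD gen ver sol L L' M (unary k))
      (fun c => testD gen ver sol R c (unary k)) (L (unary k)).toList (L' (unary k)).toList)
      fun c => success (testD gen ver sol R c (unary k)) := by
  simp only [success_testD hgen hver]
  unfold retryValue
  rw [expect_comm]
  congr 1
  ext1 pv
  simp only [solverD, ofList_cons, fst_node, snd_node, ofList_nil, expect_bind, expect_map,
    retryD_eq hgen hver, get_zero, get_succ, Puzzle.solves]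
  rfl

open Classical in
/-- A random candidate is good, if the candidates with given lengths often are. -/
theorem expect_choosePath_le (hgen : gen (unary k) = (Z.G k).map fun pv => ofList [pv.1, pv.2])
    (hver : ∀ p v o b a, ver (ofList [unary k, p, v, o, ofBool b, a]) =
      PMF.pure (ofBool (Z.V k p v o b a))) (L L' M R : Data → Data) {J m i : ℕ}
    (hM : M (unary k) = unary J) (hm : m < J) (hi : i < J) (h : ENNReal) :
    (expect (choosePath (Z.G k) (fun ps => sol (ofList [unary k, ps])) (Z.solves k)
      (L (unary k)).toList (L' (unary k)).toList m (List.replicate i nil) nil) fun π =>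
        if h < retryValue (Z.G k) (fun ps => sol (ofList [unary k, ps])) (Z.solves k)
          (R (unary k)).toList π (m - (i + 1)) then 1 else 0) ≤
      (2 * J) ^ 2 * expect (candidateD gen ver sol L L' M (unary k)) fun c =>
        if h < success (testD gen ver sol R c (unary k)) then 1 else 0 := by
  set X := expect (choosePath (Z.G k) (fun ps => sol (ofList [unary k, ps])) (Z.solves k)
      (L (unary k)).toList (L' (unary k)).toList m (List.replicate i nil) nil) fun π =>
        if h < retryValue (Z.G k) (fun ps => sol (ofList [unary k, ps])) (Z.solves k)
          (R (unary k)).toList π (m - (i + 1)) then 1 else 0 with hX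
  have hJ : (2 * (J : ENNReal)) * (1 / (2 * J)) = 1 := by
    rw [one_div]
    refine ENNReal.mul_inv_cancel ?_ (by finiteness)
    have : J ≠ 0 := by omega
    simpa using this
  -- The two guesses are independent, and each is right with probability at least 1 / (2J).
  have h1 : 1 / (2 * (J : ENNReal)) * (1 / (2 * (J : ENNReal)) * X) ≤
      expect (candidateD gen ver sol L L' M (unary k)) fun c =>
        if h < success (testD gen ver sol R c (unary k)) then 1 else 0 := by
    rw [candidateD, hM, expect_bind]
    refine le_trans ?_ (mul_le_expect _ _ (unary m))
    refine mul_le_mul' (le_indexP hm) ?_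
    rw [expect_bind]
    refine le_trans ?_ (mul_le_expect _ _ (unary i))
    refine mul_le_mul' (le_indexP hi) ?_
    rw [expect_map, choosePathD_eq hgen hver, hX]
    refine expect_mono_support fun π hπ => ?_
    have hlen := length_of_mem_choosePath _ _ _ _ _ _ _ π hπ
    simp only [success_testD hgen hver, fst_node, snd_node, toList_drop, toList_node,
      List.length_cons, toList_unary, List.length_drop, List.length_replicate, hlen]
    exact le_rfl
  calc X = (2 * J * (1 / (2 * J))) * (2 * J * (1 / (2 * J))) * X := by rw [hJ]; ring
    _ = (2 * J) ^ 2 * (1 / (2 * (J : ENNReal)) * (1 / (2 * (J : ENNReal)) * X)) := by ring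
    _ ≤ _ := by gcongr

end semantics

/-- With an empty prefix all puzzles are fresh and all are checked. The integrands agree only for
lists of the right length, i.e. on the support. -/
theorem Puzzle.solveBoth_rep (Z : Puzzle) (n : ℕ → ℕ) (T : Prog) (k : ℕ) :
    (Z.rep n).solveBoth T k true =
      value (Z.G k) (fun ps => T.run (ofList [unary k, ps])) (Z.solves k) nil (n k) := by
  rw [apply_true_eq_expect, solveBoth, expect_bind, value_eq, trial, expect_bind]
  simp only [expect_map, rep]
  refine le_antisymm (expect_mono_support fun l hl => ?_) (expect_mono_support fun l hl => ?_) <;>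
  · have hlen : l.length = n k := by simpa using sampleList_length _ l hl
    refine le_of_eq ?_
    have h0 : revAppend nil (ofList (l.map Prod.fst)) = ofList (l.map Prod.fst) := rfl
    simp only [h0, fst_node, ofBool_ne_nil, solvesFrom_eq, hlen]
    congr 1
    ext1 t
    refine if_congr ?_ rfl rfl
    simp only [V₂, solves, Bool.and_eq_true, decide_eq_true_eq, List.all_eq_true, List.mem_range,
      toList_nil, List.length_nil, zero_add, ← forall_and, get_ofList]
    refine forall_congr' fun i => ?_
    refine imp_congr_right fun hi => ?_
    have hil : i < l.length := by omega
    simp [List.getD_eq_getElem?_getD, hil]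

/-! ### Hardness -/

/-- The base 2k + 2 is one more than the size of `unary k`, so such powers can be computed by the
reduction. Strictness makes n(k) itself a possible value of a random index below the bound. -/
theorem exists_pow_bound (P : Polynomial ℕ) : ∃ a : ℕ, ∀ k, P.eval k < (2 * k + 2) ^ a := by
  refine ⟨P.eval 1 + P.natDegree, fun k => ?_⟩
  have h1 : P.eval k ≤ P.eval 1 * (2 * k + 2) ^ P.natDegree := by
    rw [Polynomial.eval_eq_sum_range, Polynomial.eval_eq_sum_range, Finset.sum_mul]
    refine Finset.sum_le_sum fun i hi => ?_
    rw [one_pow, mul_one]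
    refine Nat.mul_le_mul_left _ ((Nat.pow_le_pow_left (by omega) i).trans
      (Nat.pow_le_pow_right (by omega) ?_))
    have := Finset.mem_range.1 hi
    omega
  have h2 : P.eval 1 < (2 * k + 2) ^ P.eval 1 :=
    Nat.lt_two_pow_self.trans_le (Nat.pow_le_pow_left (by omega) _)
  rw [pow_add]
  exact h1.trans_lt (Nat.mul_lt_mul_of_pos_right h2 (by positivity))

/-- The polynomial `(size + 1) ^ e` of the size of the security parameter, in unary. -/
noncomputable def powSize (e : ℕ) (κ : Data) : Data := unary ((κ.size + 1) ^ e)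

theorem DEff.powSize (e : ℕ) : DEff Prog.Any (OneOfTwo.powSize e) :=
  DEff.unary_pow (DEff.unary_add (DEff.size .id) (DEff.unary_const 1)) e

theorem powSize_unary (e k : ℕ) : powSize e (unary k) = unary ((2 * k + 2) ^ e) := by
  rw [powSize, size_unary]

theorem Negligible.eventually_le {ν : ℕ → ℝ} (hν : Negligible ν) (d : ℕ) {C : ℝ} (hC : 0 < C) :
    ∀ᶠ k in Filter.atTop, ν k ≤ C / (2 * k + 2 : ℝ) ^ d := by
  have h1 := (hν d).eventually (gt_mem_nhds (by positivity : 0 < C / 4 ^ d))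
  filter_upwards [h1, Filter.eventually_ge_atTop 1] with k hk hk1
  have hk1' : (1 : ℝ) ≤ k := by exact_mod_cast hk1
  rcases le_total (ν k) 0 with h0 | h0
  · exact h0.trans (by positivity)
  rw [le_div_iff₀ (by positivity)]
  calc ν k * (2 * k + 2 : ℝ) ^ d ≤ ν k * (4 * k) ^ d := by gcongr; linarith
    _ = 4 ^ d * (k ^ d * ν k) := by rw [mul_pow]; ring
    _ ≤ 4 ^ d * (C / 4 ^ d) := by gcongr
    _ = C := by field_simp

theorem negligible_of_eventually_le {ν : ℕ → ℝ} (h0 : ∀ k, 0 ≤ ν k)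
    (h : ∀ c : ℕ, ∃ C : ℝ, ∀ᶠ k in Filter.atTop, ν k ≤ C / (2 * k + 2 : ℝ) ^ c) :
    Negligible ν := by
  rw [Negligible, Asymptotics.superpolynomialDecay_iff_abs_isBoundedUnder _
    tendsto_natCast_atTop_atTop]
  intro c
  obtain ⟨C, hC⟩ := h c
  refine ⟨C, ?_⟩
  rw [Filter.eventually_map]
  filter_upwards [hC] with k hk
  rw [abs_of_nonneg (mul_nonneg (by positivity) (h0 k))]
  rw [le_div_iff₀ (by positivity)] at hk
  refine le_trans ?_ hk
  rw [mul_comm]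
  have := h0 k
  gcongr
  linarith

/-- With δ = 1 / (uw) the number of trials is chosen such that N' δ^2 = N^2, and the error is at
most 1 / N + (N + 2) / N^2 ≤ 4 / N. -/
theorem choiceError_le {u w : ℝ} {N N' : ℕ} (hu : 1 ≤ u) (hw : 1 ≤ w) (hN : (N : ℝ) = u ^ 4 * w ^ 2)
    (hN' : (N' : ℝ) = (u ^ 4 * w ^ 2) ^ 2 * (u * w) ^ 2) :
    choiceError N N' (1 / (u * w)) ≤ ENNReal.ofReal (4 / (u ^ 4 * w ^ 2)) := by
  have hN1 : (1 : ℝ) ≤ N := by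
    rw [hN]; exact one_le_mul_of_one_le_of_one_le (one_le_pow₀ hu) (one_le_pow₀ hw)
  have h1 : (1 : ENNReal) / (N + 2) ≤ ENNReal.ofReal (1 / N) := by
    rw [ENNReal.ofReal_div_of_pos (by linarith), ENNReal.ofReal_one, ENNReal.ofReal_natCast]
    gcongr
    exact le_self_add
  have h2 : ((N : ENNReal) + 2) * ENNReal.ofReal (1 / (N' * (1 / (u * w)) ^ 2)) ≤
      ENNReal.ofReal (3 / N) := by
    have : (N : ENNReal) + 2 = ENNReal.ofReal (N + 2) := by
      rw [ENNReal.ofReal_add (by positivity) (by norm_num), ENNReal.ofReal_natCast]; norm_num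
    rw [this, ← ENNReal.ofReal_mul (by positivity)]
    refine ENNReal.ofReal_le_ofReal ?_
    have h3 : (N' : ℝ) * (1 / (u * w)) ^ 2 = N ^ 2 := by
      rw [hN', hN]; field_simp
    rw [h3, mul_one_div, div_le_div_iff₀ (by positivity) (by positivity)]
    nlinarith
  rw [choiceError]
  refine (add_le_add h1 h2).trans ?_
  rw [← ENNReal.ofReal_add (by positivity) (by positivity), ← hN]
  refine ENNReal.ofReal_le_ofReal (le_of_eq ?_)
  ring

theorem Puzzle.IsHard.rep_eventually_le {Z : Puzzle} (hZ : Z.IsOneOfTwoPuzzle) {h : ℕ → ℝ}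
    (hh : ∀ k, h k ∈ Set.Icc (0 : ℝ) 1) {n : ℕ → ℕ}
    (hn : ∃ P : Polynomial ℕ, ∀ k, n k ≤ P.eval k) (hhard : Z.IsHard fun k => 1 - h k)
    {T : Prog} (hT : T.PolyTime) (c : ℕ) : ∀ᶠ k in Filter.atTop,
      ((Z.rep n).solveBoth T k true).toReal ≤ h k ^ n k + 72 / (2 * k + 2 : ℝ) ^ c := by
  obtain ⟨P, hP⟩ := hn
  obtain ⟨a, ha⟩ := exists_pow_bound P
  obtain ⟨fG, -, hfG, eG⟩ := hZ.effG
  obtain ⟨fV, -, -, hfV, eV⟩ := hZ.effV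
  have hgen : Eff Prog.Any fG.run := Eff.run trivial hfG
  have hver : Eff Prog.Any fV.run := Eff.run trivial hfV
  have hsol : Eff Prog.Any T.run := Eff.run trivial hT
  -- With u = (2k+2)^a > n(k) and w = (2k+2)^c, the lengths are N = u^4 w^2 for `L`, N^2 (uw)^2 for
  -- `L'`, u for `M` and uw for `R`. The choice error 4 / N is multiplied by u from the n steps,
  -- (2u)^2 from the guesses and 4 / δ = 4uw, which this N reduces to 64 / w.
  set e := 4 * a + 2 * c with he
  set L := powSize e with hL
  set L' := powSize (2 * e + 2 * (a + c)) with hL'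
  set M := powSize a with hM
  set R := powSize (a + c) with hR
  obtain ⟨T', -, hT', eT'⟩ := (Eff.solverD (L := L) (L' := L') (M := M) (R := R) hgen hver hsol
    (DEff.powSize _) (DEff.powSize _) (DEff.powSize _) (DEff.powSize _)).exists_run
  -- The single-puzzle solver depends on `c`, hence so does ν; it only has to drop below δ / 2
  -- eventually.
  obtain ⟨ν, hν, hνle⟩ := hhard T' hT'
  filter_upwards [hν.eventually_le (a + c) (by norm_num : (0 : ℝ) < 1 / 2)] with k hk
  have hK : (1 : ℝ) ≤ 2 * k + 2 := by
    have : (0 : ℝ) ≤ k := by positivity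
    linarith
  set u : ℝ := (2 * k + 2 : ℝ) ^ a with hu
  set w : ℝ := (2 * k + 2 : ℝ) ^ c with hw
  have hu1 : 1 ≤ u := one_le_pow₀ hK
  have hw1 : 1 ≤ w := one_le_pow₀ hK
  have huw : (2 * k + 2 : ℝ) ^ (a + c) = u * w := pow_add _ _ _
  set δ : ℝ := 1 / (u * w) with hδ
  have hδ0 : 0 < δ := by positivity
  have hδ1 : δ ≤ 1 := by
    rw [hδ, div_le_one (by positivity)]
    exact one_le_mul_of_one_le_of_one_le hu1 hw1
  have hlen : ∀ e, (powSize e (unary k)).toList.length = (2 * k + 2) ^ e := by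
    intro e; rw [powSize_unary]; simp
  have hl' : 0 < (L' (unary k)).toList.length := by rw [hL', hlen]; positivity
  have hce := choiceError_le (N := (L (unary k)).toList.length)
    (N' := (L' (unary k)).toList.length) hu1 hw1
    (by rw [hL, hlen]; push_cast; rw [he, pow_add, pow_mul', pow_mul'])
    (by rw [hL', hlen]; push_cast; rw [he, pow_add, pow_mul', pow_mul', huw, pow_add, pow_mul',
      pow_mul'])
  rw [← hδ] at hce
  set ce := choiceError (L (unary k)).toList.length (L' (unary k)).toList.length δ with hcedef
  have hver' := fun p v o b a => eV k p v o b a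
  have hbest : (expect (bestP (candidateD fG.run fV.run T.run L L' M (unary k))
      (fun c => testD fG.run fV.run T.run R c (unary k)) (L (unary k)).toList
      (L' (unary k)).toList) fun c =>
        success (testD fG.run fV.run T.run R c (unary k))).toReal ≤ h k + ν k := by
    rw [← expect_solverD (eG k) hver']
    have h1 := hνle k
    rw [apply_true_eq_expect, solveBoth, expect_bind] at h1
    simp only [expect_map, eT', sub_sub_cancel] at h1
    exact h1
  have hQ := expect_candidate_le _ _ _ hl' hδ0 hδ1 (hh k).1 (hh k).2
    (by rw [huw] at hk; rw [hδ]; exact hk.trans (le_of_eq (by ring))) hbest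
  rw [← hcedef] at hQ
  have hMk : M (unary k) = unary ((2 * k + 2) ^ a) := powSize_unary a k
  have hnk : n k < (2 * k + 2) ^ a := (hP k).trans_lt (ha k)
  have hval := value_nil_le (Z.G k) (fun ps => T.run (ofList [unary k, ps])) (Z.solves k)
    (L (unary k)).toList (R (unary k)).toList hl' hδ0 (n k) (ENNReal.ofReal (h k)) _
    (ENNReal.ofReal_le_one.2 (hh k).2) (fun i hi =>
      (expect_choosePath_le (eG k) hver' L L' M R hMk hnk (hi.trans hnk) _).trans
        (mul_le_mul_right (hQ.trans (mul_le_mul_right hce _)) _))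
  rw [← hcedef, ← solveBoth_rep] at hval
  have hJ : (2 * (((2 * k + 2) ^ a : ℕ) : ENNReal)) ^ 2 = ENNReal.ofReal ((2 * u) ^ 2) := by
    rw [ENNReal.ofReal_pow (by positivity), ENNReal.ofReal_mul (by norm_num), hu]
    congr 2
    · norm_num
    · rw [← ENNReal.ofReal_natCast]; push_cast; rfl
  have hr : (1 : ENNReal) / ((R (unary k)).toList.length + 1) ≤ ENNReal.ofReal δ := by
    rw [hR, hlen, hδ, ENNReal.ofReal_div_of_pos (by positivity), ENNReal.ofReal_one, ← huw]
    have : ENNReal.ofReal ((2 * k + 2 : ℝ) ^ (a + c)) = ((2 * k + 2) ^ (a + c) : ℕ) := by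
      rw [← ENNReal.ofReal_natCast]; push_cast; rfl
    rw [this]
    gcongr
    exact le_self_add
  have hnu : (n k : ENNReal) ≤ ENNReal.ofReal u := by
    rw [← ENNReal.ofReal_natCast]
    refine ENNReal.ofReal_le_ofReal ?_
    rw [hu]
    exact_mod_cast hnk.le
  have hfinal : (Z.rep n).solveBoth T k true ≤ ENNReal.ofReal (h k ^ n k + 72 / w) := by
    refine hval.trans ?_
    calc _ ≤ ENNReal.ofReal (h k) ^ n k + ENNReal.ofReal u * (3 * ENNReal.ofReal δ +
          ENNReal.ofReal ((2 * u) ^ 2) * (ENNReal.ofReal (4 / δ) *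
            ENNReal.ofReal (4 / (u ^ 4 * w ^ 2))) + ENNReal.ofReal (4 / (u ^ 4 * w ^ 2)) +
            ENNReal.ofReal δ) := by
          rw [hJ]; gcongr
      _ = ENNReal.ofReal (h k ^ n k + u * (3 * δ + (2 * u) ^ 2 * (4 / δ * (4 / (u ^ 4 * w ^ 2))) +
            4 / (u ^ 4 * w ^ 2) + δ)) := by
          have h3 : (3 : ENNReal) = ENNReal.ofReal 3 := by norm_num
          rw [h3, ← ENNReal.ofReal_pow (hh k).1, ← ENNReal.ofReal_mul (by positivity),
            ← ENNReal.ofReal_mul (by positivity), ← ENNReal.ofReal_mul (by positivity),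
            ← ENNReal.ofReal_add (by positivity) (by positivity),
            ← ENNReal.ofReal_add (by positivity) (by positivity),
            ← ENNReal.ofReal_add (by positivity) (by positivity),
            ← ENNReal.ofReal_mul (by positivity),
            ← ENNReal.ofReal_add (pow_nonneg (hh k).1 _) (by positivity)]
      _ ≤ _ := by
          refine ENNReal.ofReal_le_ofReal (add_le_add le_rfl ?_)
          -- The terms 3δ and δ give 4 / w, the amplified choice error gives 64 / w, and the
          -- remaining 4u / N is at most 4 / w.
          have h1 : u * (3 * δ + (2 * u) ^ 2 * (4 / δ * (4 / (u ^ 4 * w ^ 2))) +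
              4 / (u ^ 4 * w ^ 2) + δ) = 68 / w + 4 / (u ^ 3 * w * w) := by
            rw [hδ]; field_simp; ring
          have h2 : 4 / (u ^ 3 * w * w) ≤ 4 / w := by
            gcongr
            exact le_mul_of_one_le_left (by positivity)
              (one_le_mul_of_one_le_of_one_le (one_le_pow₀ hu1) hw1)
          rw [h1]
          refine (add_le_add le_rfl h2).trans (le_of_eq ?_)
          ring
  refine (ENNReal.toReal_mono ENNReal.ofReal_ne_top hfinal).trans (le_of_eq ?_)
  exact ENNReal.toReal_ofReal (add_nonneg (pow_nonneg (hh k).1 _) (by positivity))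

theorem Puzzle.IsHard.rep {Z : Puzzle} (hZ : Z.IsOneOfTwoPuzzle) {h : ℕ → ℝ}
    (hh : ∀ k, h k ∈ Set.Icc (0 : ℝ) 1) {n : ℕ → ℕ}
    (hn : ∃ P : Polynomial ℕ, ∀ k, n k ≤ P.eval k) (hhard : Z.IsHard fun k => 1 - h k) :
    (Z.rep n).IsHard fun k => 1 - h k ^ n k := by
  intro T hT
  -- The positive part of the excess over h^n is below every inverse polynomial eventually, with a
  -- separate reduction for each exponent.
  refine ⟨fun k => max 0 (((Z.rep n).solveBoth T k true).toReal - h k ^ n k), ?_, fun k => ?_⟩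
  · refine negligible_of_eventually_le (fun k => le_max_left _ _) fun c => ⟨72, ?_⟩
    filter_upwards [IsHard.rep_eventually_le hZ hh hn hhard hT c] with k hk
    exact max_le (by positivity) (by linarith)
  · have := le_max_right 0 (((Z.rep n).solveBoth T k true).toReal - h k ^ n k)
    linarith

end OneOfTwo

theorem mainTheorem2 (Z : OneOfTwo.Puzzle) (hZ : Z.IsOneOfTwoPuzzle)
    (η h : ℕ → ℝ) (hη : ∀ k, η k ∈ Set.Icc (0 : ℝ) 1) (hh : ∀ k, h k ∈ Set.Icc (0 : ℝ) 1)
    (n : ℕ → ℕ) (hn : ∃ P : Polynomial ℕ, ∀ k, n k ≤ P.eval k)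
    (hcomplete : Z.HasCompleteness η) (hhard : Z.IsHard fun k => 1 - h k) :
    (OneOfTwo.PolyTimeComputable n → (Z.rep n).IsOneOfTwoPuzzle) ∧
      (Z.rep n).HasCompleteness (fun k => η k ^ n k) ∧
      (Z.rep n).IsHard (fun k => 1 - h k ^ n k) :=
  ⟨fun hn' => hZ.rep hn', hcomplete.rep hη hn, OneOfTwo.Puzzle.IsHard.rep hZ hh hn hhard⟩
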